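/- Let $(V,H,V')$ be a normal triple of real Hilbert spaces ($V$ is continuously and densely embedded in $H$, $V'$ is the dual of $V$ relative to the inner product of $H$, and $\langle\cdot,\cdot\rangle$ is the duality between $V'$ and $V$), let $0<T<\infty$, and let $\mathcal A(t):V\to V'$ and $\mathcal M_k(t):V\to H$, $k\ge1$, $t\in[0,T]$, be bounded linear operators, strongly measurable in $t$, with $\sup_{t\in[0,T]}\|\mathcal A(t)\|<\infty$ and $\sum_k\|\mathcal M_k(t)v\|_H^2<\infty$ for all $v\in V$, $t\in[0,T]$. Let $\{m_i\}_{i\ge1}\subset L_\infty((0,T))$ be an orthonormal basis of $L_2((0,T))$, and let $\mathcal J$ be the set of multi-indices $\alpha=(\alpha_i^k)_{i,k\ge1}$ of non-negative integers with $|\alpha|=\sum_{i,k}\alpha_i^k<\infty$; $\alpha^-(i,k)$ denotes $\alpha$ with $\alpha_i^k$ replaced by $\max(\alpha_i^k-1,0)$. For a non-random $u_0\in H$, let $u=\sum_{\alpha\in\mathcal J}u_\alpha\xi_\alpha$ (a formal series in the Cameron-Martin basis $\{\xi_\alpha\}$ built from $\{m_i\}$ and independent standard Wiener processes $w_k$)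 be the Wiener chaos solution of the homogeneous equation $$du(t)=\mathcal A u(t)\,dt+\sum_k\mathcal M_k u(t)\,dw_k(t),\quad 0<t\le T,\qquad u(0)=u_0 ,$$ that is, $u_\alpha\in L_2((0,T);V)\cap C([0,T];H)$ and, in $V'$, for every $\alpha\in\mathcal J$, $$u_\alpha(t)=u_0\,1_{\{|\alpha|=0\}}+\int_0^t\mathcal A u_\alpha(s)\,ds+\int_0^t\sum_{i,k}\sqrt{\alpha_i^k}\,\mathcal M_k u_{\alpha^-(i,k)}(s)\,m_i(s)\,ds .$$ Assume that there are $\varepsilon>0$ and $C_0\in\mathbb R$ such that $$2\langle\mathcal A(t)v,v\rangle+\sum_k\|\mathcal M_k(t)v\|_H^2+\varepsilon\|v\|_V^2\le C_0\|v\|_H^2,\qquad t\in[0,T],\ v\in V .$$ Then there exists $b>0$, independent of $u_0$, $\{m_i\}$, $n$ and $t$, such that for all $u_0\in H$, all $n\ge0$ and all $t\in[0,T]$ $$\sum_{|\alpha|=n}\|u_\alpha(t)\|_H^2\le e^{C_0t}\,\frac{\|u_0\|_H^2}{(1+b)^n}.$$ If, in addition, $\sum_k\|\mathcal M_k(t)\varphi\|_H^2\le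 C_3\|\varphi\|_H^2$ for all $t\in[0,T]$, $\varphi\in V$, and $C_1,\delta>0$ are such that $\langle\mathcal A(t)v,v\rangle+\delta\|v\|_V^2\le C_1\|v\|_H^2$ for all $t\in[0,T]$, $v\in V$, then for all $n\ge0$ and $t\in[0,T]$ $$\sum_{|\alpha|=n}\|u_\alpha(t)\|_H^2\le\frac{(C_3t)^n}{n!}\,e^{2C_1t}\,\|u_0\|_H^2 .$$ -/

import Mathlib

open MeasureTheory Set
open scoped ENNReal

noncomputable section

namespace WienerChaos

/-- Multi-indices `α = (α_i^k)` with finitely many nonzero entries; the entry `α_i^k` is `α (i, k)`,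
where `i` is the time index and `k` the noise index (both counted from `0`). -/
abbrev MultiIndex : Type := (ℕ × ℕ) →₀ ℕ

/-- The length `|α| = ∑_{i,k} α_i^k`. -/
def order (α : MultiIndex) : ℕ := α.sum fun _ a => a

/-- The multi-index `α⁻(i,k)`: the entry at `(i, k)` is replaced by `max (α_i^k - 1) 0`
(the subtraction of natural numbers is truncated). -/
def lower (α : MultiIndex) (p : ℕ × ℕ) : MultiIndex := α - Finsupp.single p 1

/-- A normal triple `V ↪ H ↪ V'` of real Hilbert spaces: `V` is continuously, injectively and densely
embedded into `H`. The space `V'`, the dual of `V` relative to the inner product of `H`,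
is realized as `StrongDual ℝ V`; the duality `⟨v', v⟩` is the evaluation `v' v`. -/
structure NormalTriple (V H : Type*) [NormedAddCommGroup V] [InnerProductSpace ℝ V]
    [NormedAddCommGroup H] [InnerProductSpace ℝ H] where
  emb : V →L[ℝ] H
  injective : Function.Injective emb
  denseRange : DenseRange emb

section

variable {V H : Type*} [NormedAddCommGroup V] [InnerProductSpace ℝ V]
  [NormedAddCommGroup H] [InnerProductSpace ℝ H]

/-- The embedding `H ↪ V'`, `h ↦ (v ↦ (h, v)_H)`. -/
def NormalTriple.dualEmb (S : NormalTriple V H) (h : H) : StrongDual ℝ V :=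
  (innerSL ℝ h).comp S.emb

/-- The embedding of `H` into `V'` is the one for which `⟨h, v⟩ = (h, v)_H`. -/
theorem NormalTriple.dualEmb_apply (S : NormalTriple V H) (h : H) (v : V) :
    S.dualEmb h v = inner ℝ h (S.emb v) := rfl

/-- Standing conditions on the operators `A(t) : V → V'` and `M_k(t) : V → H`, `t ∈ [0,T]`:
strong measurability in time, a bound on `A(t)` that is uniform in time, and
`∑_k ‖M_k(t) v‖² < ∞`. -/
structure IsCoefficientFamily (T : ℝ) (A : ℝ → V →L[ℝ] StrongDual ℝ V)
    (M : ℕ → ℝ → V →L[ℝ] H) : Prop where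
  measurable_A : ∀ v : V, AEStronglyMeasurable (fun t => A t v) (volume.restrict (Ioo 0 T))
  measurable_M : ∀ k, ∀ v : V,
    AEStronglyMeasurable (fun t => M k t v) (volume.restrict (Ioo 0 T))
  bounded_A : ∃ K : ℝ, ∀ t ∈ Icc 0 T, ‖A t‖ ≤ K
  summable_M : ∀ t ∈ Icc 0 T, ∀ v : V, Summable fun k => ‖M k t v‖ ^ 2

/-- Strong parabolicity with the constants `ε` and `C₀`. -/
def StronglyParabolic (S : NormalTriple V H) (T : ℝ) (A : ℝ → V →L[ℝ] StrongDual ℝ V)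
    (M : ℕ → ℝ → V →L[ℝ] H) (ε C₀ : ℝ) : Prop :=
  ∀ t ∈ Icc 0 T, ∀ v : V,
    2 * A t v v + ∑' k, ‖M k t v‖ ^ 2 + ε * ‖v‖ ^ 2 ≤ C₀ * ‖S.emb v‖ ^ 2

/-- Coercivity of `A(t)` with the constants `δ` and `C₁`. -/
def Coercive (S : NormalTriple V H) (T : ℝ) (A : ℝ → V →L[ℝ] StrongDual ℝ V) (δ C₁ : ℝ) : Prop :=
  ∀ t ∈ Icc 0 T, ∀ v : V, A t v v + δ * ‖v‖ ^ 2 ≤ C₁ * ‖S.emb v‖ ^ 2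

/-- The adjoint of the Malliavin derivative on sequences `g = (g_k)` of generalized random
processes. A generalized random process `∑_α g_α ξ_α` is a formal series and is represented by the
family of its coefficients:
`(D* g)_α(t) = ∑_{i,k} ∫_0^t √(α_i^k) m_i(s) g_{k, α⁻(i,k)}(s) ds`.
The terms with `α_i^k = 0` vanish, so that the sum runs over the support of `α`. -/
def malliavinAdjoint {X : Type*} [NormedAddCommGroup X] [NormedSpace ℝ X]
    (m : ℕ → ℝ → ℝ) (g : ℕ → MultiIndex → ℝ → X) (α : MultiIndex) (t : ℝ) : X :=
  ∑ p ∈ α.support, ∫ s in (0 : ℝ)..t, (√(α p : ℝ) * m p.1 s) • g p.2 (lower α p) s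

/-- `v = ∑_α v_α ξ_α` is a `w(V, V')` Wiener chaos solution of the homogeneous equation
`du = A u dt + ∑_k M_k u dw_k`, `u(0) = u₀` (nonrandom): each coefficient belongs to
`L₁((0,T); V)`, and `u(t) = u₀ + ∫_0^t A u ds + ∑_k (D*_k (M_k u))(t)`
holds coefficient by coefficient in `L₁((0,T); V')`. -/
structure IsWienerChaosSolution (S : NormalTriple V H) (T : ℝ)
    (A : ℝ → V →L[ℝ] StrongDual ℝ V) (M : ℕ → ℝ → V →L[ℝ] H) (m : ℕ → ℝ → ℝ)
    (u₀ : H) (v : MultiIndex → ℝ → V) : Prop where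
  integrable : ∀ α, Integrable (v α) (volume.restrict (Ioo 0 T))
  equation : ∀ α, ∀ᵐ t ∂(volume.restrict (Ioo 0 T)),
    S.dualEmb (S.emb (v α t)) =
      (if α = 0 then S.dualEmb u₀ else 0) + (∫ s in (0 : ℝ)..t, A s (v α s))
        + malliavinAdjoint m (fun k β s => S.dualEmb (M k s (v β s))) α t

/-- The coefficients `v_α` lie in `L₂((0,T); V)`, and `u_α` is the version of `v_α` that
is continuous on `[0,T]` with values in `H`. -/
structure IsContinuousVersion (S : NormalTriple V H) (T : ℝ)
    (v : MultiIndex → ℝ → V) (u : MultiIndex → ℝ → H) : Prop where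
  memLp : ∀ α, MemLp (v α) 2 (volume.restrict (Ioo 0 T))
  continuousOn : ∀ α, ContinuousOn (u α) (Icc 0 T)
  ae_eq : ∀ α, ∀ᵐ t ∂(volume.restrict (Ioo 0 T)), S.emb (v α t) = u α t

end

end WienerChaos

end

/-!
The coefficients of order `n` are compared with those of a discretized noise, for which the sum over
all coefficients can be estimated by energy estimates only; no probability is used.

*Reduction.* With `λ = C₀ / 2` in the first part and `λ = C₁` in the second one, the functions
`exp (-λ t) u_α(t)` solve the propagator with `A - λ` in place of `A`
(`IsWienerChaosSolution.equation_weighted`), and `⟨(A - λ) v, v⟩ ≤ -c ‖v‖_V²`. Let `R` be the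
solution operator of `w' = (A - λ) w + f`, `w(0) = 0`. It exists by Lions' projection lemma
(`NormalTriple.exists_solution`); it is unique and causal by the energy inequality, which also gives
`‖w(t)‖_H² + 2 ∫_0^t |⟨(A - λ) w, w⟩| ≤ (∫_0^t ‖f‖_H)²` with the sharp constant `1`
(`IsSolution.energy_le_sq`). The left-hand side is the *energy* of `w` at the time `t`. The
propagator becomes a recursion `u_α = R (∑ √(α_i^k) m_i M_k u_{α⁻(i,k)})` for `α ≠ 0`. It loses
its weights when multi-indices are replaced by finite sequences of index pairs, `n! / α!` of which
represent the multi-index `α` (`chaos`, `chaos_eq_smul`, `sum_multiFactorial_tally`).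

*Discretization.* Divide `(0,T)` into cells, replace the `m_i` by the normalized indicators of the
cells, and keep only the terms with at most one noise per cell (`cellChaos`). For a forcing term `g`
times the indicators, the sharp energy estimate and the Cauchy-Schwarz inequality on each cell bound
the sum of the energies by `∫_0^t ‖g‖²` (`sum_energy_bump_le`). This is the analogue of the Itô
isometry. Hence the total energy of order `n + 1` is at most `n + 1` times the integral of
`∑_k ‖M_k ·‖²` over the coefficients of order `n` (`sum_energy_cellChaos_succ_le`). If
`2 ⟨(A - λ) v, v⟩ + (1 + b) ∑_k ‖M_k v‖² ≤ 0`, the energy controls `1 + b` times this integral, and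
induction yields the geometric bound (`sum_cellChaos_le_geometric`); if
`∑_k ‖M_k v‖² ≤ C₃ ‖v‖_H²`, induction yields the factorial bound (`sum_cellChaos_le_factorial`).

*Change of basis and limit.* By Bessel's inequality the matrix that carries the cell indicators into
an orthonormal family `(m_i)` is a contraction, and so are its tensor powers; so the bounds persist
for the coefficients in the rotated basis (`rotatedChaos`, `sum_norm_sq_prod_le_of_contraction`).
By causality these satisfy the recursion for `(m_i)` up to errors from single cells, and
they converge to the true coefficients as the mesh tends to zero (`tendsto_rotatedChaos`).
-/

noncomputable section

namespace WienerChaos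

/-! ### Multiplication operators on Bochner spaces -/

section Multiplication

variable {Ω E F : Type*} [MeasurableSpace Ω] {μ : Measure Ω}
  [NormedAddCommGroup E] [NormedSpace ℝ E] [NormedAddCommGroup F] [NormedSpace ℝ F]

/-- A strongly measurable family of operators maps strongly measurable functions to strongly
measurable functions. No separability is needed: the argument is approximated by simple
functions. -/
theorem aestronglyMeasurable_clm_apply {B : Ω → E →L[ℝ] F} {x : Ω → E}
    (hB : ∀ e, AEStronglyMeasurable (fun t => B t e) μ) (hx : AEStronglyMeasurable x μ) :
    AEStronglyMeasurable (fun t => B t (x t)) μ := by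
  obtain ⟨y, hy, hxy⟩ := hx
  suffices h : AEStronglyMeasurable (fun t => B t (y t)) μ by
    refine h.congr ?_
    filter_upwards [hxy] with t ht
    rw [ht]
  refine aestronglyMeasurable_of_tendsto_ae Filter.atTop
    (f := fun n t => B t (hy.approx n t)) (fun n => ?_) ?_
  · have : (fun t => B t (hy.approx n t)) = fun t => ∑ e ∈ (hy.approx n).range,
        ((hy.approx n) ⁻¹' {e}).indicator (fun t => B t e) t := by
      funext t
      rw [Finset.sum_eq_single (hy.approx n t)]
      · simp
      · intro b _ hb
        exact indicator_of_notMem (by simpa using hb.symm) _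
      · intro h
        exact absurd (SimpleFunc.mem_range_self _ t) h
    rw [this]
    exact Finset.aestronglyMeasurable_fun_sum _
      fun e _ => (hB e).indicator ((hy.approx n).measurableSet_fiber e)
  · exact Filter.Eventually.of_forall fun t =>
      ((B t).continuous.tendsto _).comp (hy.tendsto_approx t)

/-- A strongly measurable family of operators with essentially bounded norms. -/
structure IsBddFamily (μ : Measure Ω) (B : Ω → E →L[ℝ] F) (C : ℝ) : Prop where
  meas : ∀ e, AEStronglyMeasurable (fun t => B t e) μ
  bound : ∀ᵐ t ∂μ, ‖B t‖ ≤ C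

theorem IsBddFamily.memLp {B : Ω → E →L[ℝ] F} {C : ℝ} (h : IsBddFamily μ B C) {x : Ω → E}
    {p : ℝ≥0∞} (hx : MemLp x p μ) : MemLp (fun t => B t (x t)) p μ := by
  refine hx.of_le_mul (c := C) (aestronglyMeasurable_clm_apply h.meas hx.1) ?_
  filter_upwards [h.bound] with t ht
  exact (B t).le_of_opNorm_le ht _

/-- The operator `x ↦ (t ↦ B t (x t))` on square integrable functions. -/
def IsBddFamily.op {B : Ω → E →L[ℝ] F} {C : ℝ} (h : IsBddFamily μ B C) :
    Lp E 2 μ →L[ℝ] Lp F 2 μ :=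
  LinearMap.mkContinuous
    { toFun := fun x => (h.memLp (Lp.memLp x)).toLp
      map_add' := fun x y => by
        rw [← MemLp.toLp_add]
        refine MemLp.toLp_congr _ _ ?_
        filter_upwards [Lp.coeFn_add x y] with t ht
        rw [ht, Pi.add_apply, Pi.add_apply, map_add]
      map_smul' := fun c x => by
        rw [RingHom.id_apply, ← MemLp.toLp_const_smul]
        refine MemLp.toLp_congr _ _ ?_
        filter_upwards [Lp.coeFn_smul c x] with t ht
        rw [ht, Pi.smul_apply, Pi.smul_apply, map_smul] } C
    (fun x => by
      refine Lp.norm_le_mul_norm_of_ae_le_mul ?_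
      filter_upwards [h.bound, (h.memLp (Lp.memLp x)).coeFn_toLp] with t ht h2
      simp only [LinearMap.coe_mk, AddHom.coe_mk]
      rw [h2]
      exact (B t).le_of_opNorm_le ht _)

theorem IsBddFamily.coeFn_op {B : Ω → E →L[ℝ] F} {C : ℝ} (h : IsBddFamily μ B C)
    (x : Lp E 2 μ) : h.op x =ᵐ[μ] fun t => B t (x t) :=
  (h.memLp (Lp.memLp x)).coeFn_toLp

/-- Multiplication of square integrable functions by an essentially bounded scalar function. -/
def mulOp : Lp ℝ ∞ μ →L[ℝ] Lp E 2 μ →L[ℝ] Lp E 2 μ :=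
  (ContinuousLinearMap.lsmul ℝ ℝ).holderL μ ∞ 2 2

theorem coeFn_mulOp (e : Lp ℝ ∞ μ) (x : Lp E 2 μ) :
    mulOp e x =ᵐ[μ] fun t => e t • x t :=
  (ContinuousLinearMap.lsmul ℝ ℝ : ℝ →L[ℝ] E →L[ℝ] E).coeFn_holder e x

/-- Multiplication by scalar functions commutes with operators that act pointwise in time. -/
theorem mulOp_op {B : Ω → E →L[ℝ] F} {C : ℝ} (h : IsBddFamily μ B C) (e : Lp ℝ ∞ μ)
    (x : Lp E 2 μ) : mulOp e (h.op x) = h.op (mulOp e x) := by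
  refine Lp.ext ?_
  filter_upwards [coeFn_mulOp e (h.op x), h.coeFn_op x, h.coeFn_op (mulOp e x), coeFn_mulOp e x]
    with t h1 h2 h3 h4
  rw [h1, h2, h3, h4, map_smul]

theorem norm_sq_eq_integral {E : Type*} [NormedAddCommGroup E] (x : Lp E 2 μ) :
    ‖x‖ ^ 2 = ∫ t, ‖x t‖ ^ 2 ∂μ := by
  rw [Lp.norm_def, toReal_eLpNorm (Lp.aestronglyMeasurable x),
    lpNorm_eq_integral_norm_rpow_toReal (by simp) (by simp) (Lp.aestronglyMeasurable x),
    ← Real.rpow_natCast, ← Real.rpow_mul (integral_nonneg fun _ => by positivity)]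
  simp

theorem integrable_norm_sq {E : Type*} [NormedAddCommGroup E] (x : Lp E 2 μ) :
    Integrable (fun t => ‖x t‖ ^ 2) μ :=
  (memLp_two_iff_integrable_sq_norm (Lp.aestronglyMeasurable x)).1 (Lp.memLp x)

end Multiplication

/-! ### Integration by parts for primitives of integrable functions -/

section Primitive

variable {E F G : Type*} [NormedAddCommGroup E] [NormedSpace ℝ E] [CompleteSpace E]
  [NormedAddCommGroup F] [NormedSpace ℝ F] [CompleteSpace F]
  [NormedAddCommGroup G] [NormedSpace ℝ G] [CompleteSpace G]

/-- Monotonicity of `∫_0^t` for functions that are compared almost everywhere on `(0,T)`. -/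
theorem intervalIntegral_mono_ae_Ioo {T t : ℝ} (ht : t ∈ Icc 0 T) {f g : ℝ → ℝ}
    (hf : IntegrableOn f (Ioc 0 t)) (hg : IntegrableOn g (Ioc 0 t))
    (h : ∀ᵐ s ∂volume.restrict (Ioo 0 T), f s ≤ g s) :
    ∫ s in (0 : ℝ)..t, f s ≤ ∫ s in (0 : ℝ)..t, g s := by
  rw [intervalIntegral.integral_of_le ht.1, intervalIntegral.integral_of_le ht.1,
    integral_Ioc_eq_integral_Ioo, integral_Ioc_eq_integral_Ioo]
  exact setIntegral_mono_ae_restrict (hf.mono_set Ioo_subset_Ioc_self)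
    (hg.mono_set Ioo_subset_Ioc_self)
    (ae_mono (Measure.restrict_mono (Ioo_subset_Ioo_right ht.2) le_rfl) h)

/-- `∫_0^t` does not distinguish functions that agree almost everywhere on `(0,T)`. -/
theorem intervalIntegral_congr_ae_Ioo {E : Type*} [NormedAddCommGroup E] [NormedSpace ℝ E]
    {T t : ℝ} (ht : t ∈ Icc 0 T) {f g : ℝ → E}
    (h : ∀ᵐ s ∂volume.restrict (Ioo 0 T), f s = g s) :
    ∫ s in (0 : ℝ)..t, f s = ∫ s in (0 : ℝ)..t, g s := by
  rw [intervalIntegral.integral_of_le ht.1, intervalIntegral.integral_of_le ht.1,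
    integral_Ioc_eq_integral_Ioo, integral_Ioc_eq_integral_Ioo]
  exact integral_congr_ae (ae_mono (Measure.restrict_mono (Ioo_subset_Ioo_right ht.2) le_rfl) h)

/-- Fubini's theorem on a triangle: the forward and the backward primitive are adjoint with respect
to every continuous bilinear map. -/
theorem integral_bilin_primitive_left_eq_right {a b : ℝ} (hab : a ≤ b) (B : E →L[ℝ] F →L[ℝ] G)
    {x : ℝ → E} {y : ℝ → F} (hx : IntegrableOn x (Ioc a b)) (hy : IntegrableOn y (Ioc a b)) :
    ∫ t in a..b, B (∫ s in a..t, x s) (y t) = ∫ s in a..b, B (x s) (∫ t in s..b, y t) := by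
  have hK : Integrable (fun z : ℝ × ℝ => {z : ℝ × ℝ | z.1 < z.2}.indicator
      (fun z => B (x z.1) (y z.2)) z)
      ((volume.restrict (Ioc a b)).prod (volume.restrict (Ioc a b))) := by
    refine Integrable.indicator ?_ (measurableSet_lt measurable_fst measurable_snd)
    exact Integrable.op_fst_snd (op := fun u v => B u v) (by fun_prop) ⟨‖B‖, B.le_opNorm₂⟩ hx hy
  rw [intervalIntegral.integral_of_le hab, intervalIntegral.integral_of_le hab]
  have h1 : ∀ t ∈ Ioc a b, B (∫ s in a..t, x s) (y t) = ∫ s in Ioc a b,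
      {z : ℝ × ℝ | z.1 < z.2}.indicator (fun z => B (x z.1) (y z.2)) (s, t) := by
    intro t ht
    have e1 : (fun s => {z : ℝ × ℝ | z.1 < z.2}.indicator (fun z => B (x z.1) (y z.2)) (s, t))
        = (Iio t).indicator (fun s => B.flip (y t) (x s)) := by
      funext s
      by_cases h : s < t <;> simp [indicator, h]
    rw [e1, setIntegral_indicator measurableSet_Iio,
      ContinuousLinearMap.integral_comp_comm _ (hx.mono_set inter_subset_left)]
    have e2 : Ioc a b ∩ Iio t = Ioo a t := by
      ext s; simp only [mem_inter_iff, mem_Ioc, mem_Iio, mem_Ioo] at *; grind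
    rw [e2, intervalIntegral.integral_of_le ht.1.le, integral_Ioc_eq_integral_Ioo]
    rfl
  have h2 : ∀ s ∈ Ioc a b, B (x s) (∫ t in s..b, y t) = ∫ t in Ioc a b,
      {z : ℝ × ℝ | z.1 < z.2}.indicator (fun z => B (x z.1) (y z.2)) (s, t) := by
    intro s hs
    have e1 : (fun t => {z : ℝ × ℝ | z.1 < z.2}.indicator (fun z => B (x z.1) (y z.2)) (s, t))
        = (Ioi s).indicator (fun t => B (x s) (y t)) := by
      funext t
      by_cases h : s < t <;> simp [indicator, h]
    rw [e1, setIntegral_indicator measurableSet_Ioi,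
      ContinuousLinearMap.integral_comp_comm _ (hy.mono_set inter_subset_left)]
    have e2 : Ioc a b ∩ Ioi s = Ioc s b := by
      ext t; simp only [mem_inter_iff, mem_Ioc, mem_Ioi] at *; grind
    rw [e2, intervalIntegral.integral_of_le hs.2]
  rw [setIntegral_congr_fun measurableSet_Ioc h1, setIntegral_congr_fun measurableSet_Ioc h2]
  exact (integral_integral_swap hK).symm

/-- Twice the integral of `φ` against its primitive is the square of the total integral. -/
theorem two_mul_integral_mul_primitive {T : ℝ} (hT : 0 ≤ T) {φ : ℝ → ℝ}
    (hφ : IntegrableOn φ (Ioc 0 T)) :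
    2 * ∫ t in (0 : ℝ)..T, φ t * ∫ s in (0 : ℝ)..t, φ s = (∫ t in (0 : ℝ)..T, φ t) ^ 2 := by
  have hi : IntervalIntegrable φ volume 0 T :=
    (intervalIntegrable_iff_integrableOn_Ioc_of_le hT).2 hφ
  have hc : ContinuousOn (fun t => ∫ s in (0 : ℝ)..t, φ s) (uIcc 0 T) :=
    intervalIntegral.continuousOn_primitive_interval' hi left_mem_uIcc
  have h := integral_bilin_primitive_left_eq_right hT (ContinuousLinearMap.mul ℝ ℝ) hφ hφ
  simp only [ContinuousLinearMap.mul_apply'] at h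
  have h2 : ∫ s in (0 : ℝ)..T, φ s * ∫ t in s..T, φ t
      = ∫ s in (0 : ℝ)..T, (φ s * (∫ t in (0 : ℝ)..T, φ t) - φ s * ∫ t in (0 : ℝ)..s, φ t) := by
    refine intervalIntegral.integral_congr fun s hs => ?_
    have := intervalIntegral.integral_add_adjacent_intervals
      (hi.mono_set (uIcc_subset_uIcc left_mem_uIcc hs))
      (hi.mono_set (uIcc_subset_uIcc hs right_mem_uIcc))
    simp only [← this]
    ring
  rw [intervalIntegral.integral_sub (hi.mul_const _) (hi.mul_continuousOn hc),
    intervalIntegral.integral_mul_const] at h2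
  simp_rw [mul_comm (∫ s in (0 : ℝ).._, φ s) (φ _)] at h
  linarith [h, h2]

/-- The product rule for `exp (-lam t) P t`, where `P` is a primitive of an integrable function. -/
theorem exp_smul_primitive {t : ℝ} (ht : 0 ≤ t) (lam : ℝ) {x : ℝ → E}
    (hx : IntegrableOn x (Ioc 0 t)) (y : E) :
    Real.exp (-lam * t) • (y + ∫ s in (0 : ℝ)..t, x s) = y + ∫ s in (0 : ℝ)..t,
      (Real.exp (-lam * s) • x s
        - lam • Real.exp (-lam * s) • (y + ∫ r in (0 : ℝ)..s, x r)) := by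
  have hi : IntervalIntegrable x volume 0 t :=
    (intervalIntegrable_iff_integrableOn_Ioc_of_le ht).2 hx
  have hc : ContinuousOn (fun t => ∫ s in (0 : ℝ)..t, x s) (uIcc 0 t) :=
    intervalIntegral.continuousOn_primitive_interval' hi left_mem_uIcc
  have hexp : Continuous fun s : ℝ => Real.exp (-lam * s) := by fun_prop
  have hprim : ∀ r : ℝ, ∫ s in (0 : ℝ)..r, lam * Real.exp (-lam * s)
      = 1 - Real.exp (-lam * r) := by
    intro r
    rw [intervalIntegral.integral_eq_sub_of_hasDerivAt (f := fun s => -Real.exp (-lam * s))]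
    · simp; ring
    · intro s _
      have := ((hasDerivAt_id s).const_mul (-lam)).exp.neg
      convert! this using 1
      simp; ring
    · exact (by fun_prop : Continuous fun s => lam * Real.exp (-lam * s)).intervalIntegrable _ _
  have h := integral_bilin_primitive_left_eq_right ht
    (ContinuousLinearMap.lsmul ℝ ℝ : ℝ →L[ℝ] E →L[ℝ] E)
    (x := fun s => lam * Real.exp (-lam * s)) (y := x)
    ((by fun_prop : Continuous fun s => lam * Real.exp (-lam * s)).integrableOn_Ioc) hx
  simp only [ContinuousLinearMap.lsmul_apply, hprim] at h
  have h2 : ∫ s in (0 : ℝ)..t, (lam * Real.exp (-lam * s)) • ∫ r in s..t, x r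
      = ∫ s in (0 : ℝ)..t, ((lam * Real.exp (-lam * s)) • (y + ∫ r in (0 : ℝ)..t, x r)
        - (lam • Real.exp (-lam * s) • (y + ∫ r in (0 : ℝ)..s, x r))) := by
    refine intervalIntegral.integral_congr fun s hs => ?_
    have := intervalIntegral.integral_add_adjacent_intervals
      (hi.mono_set (uIcc_subset_uIcc left_mem_uIcc hs))
      (hi.mono_set (uIcc_subset_uIcc hs right_mem_uIcc))
    simp only [← this]
    module
  have hI1 : IntervalIntegrable (fun s => (lam * Real.exp (-lam * s)) •
      (y + ∫ r in (0 : ℝ)..t, x r)) volume 0 t :=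
    (by fun_prop : Continuous fun s => (lam * Real.exp (-lam * s)) •
      (y + ∫ r in (0 : ℝ)..t, x r)).intervalIntegrable _ _
  have hI2 : IntervalIntegrable (fun s => lam • Real.exp (-lam * s) •
      (y + ∫ r in (0 : ℝ)..s, x r)) volume 0 t :=
    ContinuousOn.intervalIntegrable (by fun_prop)
  have hI3 : IntervalIntegrable (fun s => Real.exp (-lam * s) • x s) volume 0 t :=
    hi.continuousOn_smul hexp.continuousOn
  rw [intervalIntegral.integral_sub hI1 hI2, intervalIntegral.integral_smul_const, hprim] at h2
  simp only [sub_smul, one_smul] at h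
  rw [intervalIntegral.integral_sub hi hI3] at h
  rw [intervalIntegral.integral_sub hI3 hI2]
  rw [h2] at h
  rw [← sub_eq_zero] at h ⊢
  rw [← h]
  module

/-- A Gronwall inequality for square roots, with the sharp constant. -/
theorem two_mul_integral_mul_le_sq {T : ℝ} {φ z : ℝ → ℝ} (hφ : IntegrableOn φ (Ioc 0 T))
    (hφ0 : ∀ t, 0 ≤ φ t) (hz0 : ∀ t, 0 ≤ z t) (hφz : IntegrableOn (fun t => φ t * z t) (Ioc 0 T))
    (h : ∀ᵐ t ∂volume.restrict (Ioo 0 T), z t ^ 2 ≤ 2 * ∫ s in (0 : ℝ)..t, φ s * z s)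
    {t : ℝ} (ht : t ∈ Icc 0 T) :
    2 * ∫ s in (0 : ℝ)..t, φ s * z s ≤ (∫ s in (0 : ℝ)..t, φ s) ^ 2 := by
  have sub : ∀ {t}, t ∈ Icc 0 T → Ioc 0 t ⊆ Ioc 0 T := fun ht => Ioc_subset_Ioc_right ht.2
  have hi : ∀ {t}, t ∈ Icc 0 T → IntervalIntegrable φ volume 0 t := fun ht =>
    (intervalIntegrable_iff_integrableOn_Ioc_of_le ht.1).2 (hφ.mono_set (sub ht))
  have hiz : ∀ {t}, t ∈ Icc 0 T → IntervalIntegrable (fun t => φ t * z t) volume 0 t := fun ht =>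
    (intervalIntegrable_iff_integrableOn_Ioc_of_le ht.1).2 (hφz.mono_set (sub ht))
  have hΦ0 : ∀ {t}, 0 ≤ t → 0 ≤ ∫ s in (0 : ℝ)..t, φ s := fun ht =>
    intervalIntegral.integral_nonneg ht fun s _ => hφ0 s
  -- A bound with the constant `1 + x` improves itself to one with `1 + x / 2 ≥ √(1 + x)`.
  have step : ∀ x : ℝ, 0 ≤ x →
      (∀ t ∈ Icc 0 T, 2 * ∫ s in (0 : ℝ)..t, φ s * z s ≤ (1 + x) * (∫ s in (0 : ℝ)..t, φ s) ^ 2) →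
      ∀ t ∈ Icc 0 T,
        2 * ∫ s in (0 : ℝ)..t, φ s * z s ≤ (1 + x / 2) * (∫ s in (0 : ℝ)..t, φ s) ^ 2 := by
    intro x hx hyp t ht
    have hc : ContinuousOn (fun t => ∫ s in (0 : ℝ)..t, φ s) (uIcc 0 t) :=
      intervalIntegral.continuousOn_primitive_interval' (hi ht) left_mem_uIcc
    have hle : ∫ s in (0 : ℝ)..t, φ s * z s
        ≤ ∫ s in (0 : ℝ)..t, (1 + x / 2) * (φ s * ∫ r in (0 : ℝ)..s, φ r) := by
      refine intervalIntegral_mono_ae_Ioo ht (hiz ht).1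
        (((hi ht).mul_continuousOn hc).const_mul _).1 ?_
      filter_upwards [h, ae_restrict_mem measurableSet_Ioo] with s hs hsT
      have hs' : s ∈ Icc 0 T := ⟨hsT.1.le, hsT.2.le⟩
      have h1 := hyp s hs'
      have h2 := hΦ0 hs'.1
      have h3 : z s ≤ (1 + x / 2) * ∫ r in (0 : ℝ)..s, φ r := by
        refine abs_le_of_sq_le_sq' ?_ (by positivity) |>.2
        nlinarith [mul_nonneg (sq_nonneg x) (sq_nonneg (∫ r in (0 : ℝ)..s, φ r))]
      calc φ s * z s ≤ φ s * ((1 + x / 2) * ∫ r in (0 : ℝ)..s, φ r) := by gcongr; exact hφ0 s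
        _ = _ := by ring
    rw [intervalIntegral.integral_const_mul] at hle
    have := two_mul_integral_mul_primitive ht.1 (hφ.mono_set (sub ht))
    nlinarith
  -- The initial bound, with the constant `4`, uses that the right-hand side of `h` is monotone.
  have h4 : ∀ t ∈ Icc 0 T,
      2 * ∫ s in (0 : ℝ)..t, φ s * z s ≤ (1 + 3) * (∫ s in (0 : ℝ)..t, φ s) ^ 2 := by
    intro t ht
    set Y := 2 * ∫ s in (0 : ℝ)..t, φ s * z s with hY
    have hY0 : 0 ≤ Y := mul_nonneg zero_le_two
      (intervalIntegral.integral_nonneg ht.1 fun s _ => mul_nonneg (hφ0 s) (hz0 s))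
    have hle : ∫ s in (0 : ℝ)..t, φ s * z s ≤ ∫ s in (0 : ℝ)..t, φ s * √Y := by
      refine intervalIntegral_mono_ae_Ioo (T := t) ⟨ht.1, le_rfl⟩ (hiz ht).1
        ((hi ht).mul_const _).1 ?_
      filter_upwards [ae_mono (Measure.restrict_mono (Ioo_subset_Ioo_right ht.2) le_rfl) h,
        ae_restrict_mem measurableSet_Ioo] with s hs hst
      refine mul_le_mul_of_nonneg_left (Real.le_sqrt_of_sq_le (hs.trans ?_)) (hφ0 s)
      refine mul_le_mul_of_nonneg_left ?_ zero_le_two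
      exact intervalIntegral.integral_mono_interval le_rfl hst.1.le hst.2.le
        (Filter.Eventually.of_forall fun s => mul_nonneg (hφ0 s) (hz0 s)) (hiz ht)
    rw [intervalIntegral.integral_mul_const] at hle
    have hs := Real.sq_sqrt hY0
    have hs0 := Real.sqrt_nonneg Y
    have h2 := hΦ0 ht.1
    nlinarith [sq_nonneg (√Y - 2 * ∫ s in (0 : ℝ)..t, φ s)]
  have hn : ∀ n : ℕ, ∀ t ∈ Icc 0 T,
      2 * ∫ s in (0 : ℝ)..t, φ s * z s ≤ (1 + 3 * (1 / 2) ^ n) * (∫ s in (0 : ℝ)..t, φ s) ^ 2 := by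
    intro n
    induction n with
    | zero => simpa using h4
    | succ n ih =>
      have := step _ (by positivity) ih
      intro t ht
      refine (this t ht).trans (le_of_eq ?_)
      ring
  have hlim : Filter.Tendsto (fun n : ℕ => (1 + 3 * (1 / 2 : ℝ) ^ n) * (∫ s in (0 : ℝ)..t, φ s) ^ 2)
      Filter.atTop (nhds ((1 + 3 * 0) * (∫ s in (0 : ℝ)..t, φ s) ^ 2)) :=
    (((tendsto_pow_atTop_nhds_zero_of_lt_one (by norm_num) (by norm_num)).const_mul 3).const_add
      1).mul_const _
  simpa using ge_of_tendsto' hlim fun n => hn n t ht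

end Primitive

/-! ### The energy inequality in a normal triple -/

section Translation

variable {E : Type*} [NormedAddCommGroup E]

/-- Translation by `r` on square integrable functions on the line. -/
def translate (r : ℝ) (x : Lp E 2 (volume : Measure ℝ)) : Lp E 2 (volume : Measure ℝ) :=
  Lp.compMeasurePreserving (fun t => t + r) (measurePreserving_add_right volume r) x

theorem coeFn_translate (r : ℝ) {f : ℝ → E} (hf : MemLp f 2 volume) :
    translate r hf.toLp =ᵐ[volume] fun t => f (t + r) :=
  (Lp.coeFn_compMeasurePreserving _ (measurePreserving_add_right volume r)).trans
    ((measurePreserving_add_right volume r).quasiMeasurePreserving.ae_eq hf.coeFn_toLp)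

theorem continuous_translate (x : Lp E 2 (volume : Measure ℝ)) :
    Continuous fun r => translate r x := by
  let g : C(ℝ, C(ℝ, ℝ)) := ContinuousMap.curry ⟨fun p : ℝ × ℝ => p.2 + p.1, by fun_prop⟩
  exact Continuous.compMeasurePreservingLp (f := fun _ : ℝ => x) continuous_const g.continuous
    (fun r => measurePreserving_add_right volume r) (by simp)

variable [NormedSpace ℝ E]

/-- Joint continuity of the pairing of two translated functions over a fixed interval. -/
theorem continuous_integral_pairing_translate {f : ℝ → StrongDual ℝ E} {w : ℝ → E}
    (hf : MemLp f 2 volume) (hw : MemLp w 2 volume) (a b : ℝ) :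
    Continuous fun p : ℝ × ℝ => ∫ t in Ioc a b, f (t + p.1) (w (t + p.2)) := by
  let e : Lp ℝ ∞ (volume : Measure ℝ) :=
    indicatorConstLp ∞ (measurableSet_Ioc (a := a) (b := b)) (by simp) 1
  have h : ∀ p : ℝ × ℝ, ∫ t in Ioc a b, f (t + p.1) (w (t + p.2)) =
      (ContinuousLinearMap.id ℝ (StrongDual ℝ E)).lpPairing volume 2 2
        (translate p.1 hf.toLp) (mulOp e (translate p.2 hw.toLp)) := by
    intro p
    rw [ContinuousLinearMap.lpPairing_eq_integral, ← integral_indicator measurableSet_Ioc]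
    refine integral_congr_ae ?_
    filter_upwards [coeFn_translate p.1 hf, coeFn_translate p.2 hw,
      coeFn_mulOp e (translate p.2 hw.toLp),
      (indicatorConstLp_coeFn : e =ᵐ[volume] _)] with t h1 h2 h3 h4
    rw [h3, h1, h2, h4]
    by_cases ht : t ∈ Ioc a b <;> simp [ht]
  simp_rw [h]
  have c1 := (continuous_translate hf.toLp).comp (continuous_fst (X := ℝ) (Y := ℝ))
  have c2 := (continuous_translate hw.toLp).comp (continuous_snd (X := ℝ) (Y := ℝ))
  exact ((ContinuousLinearMap.continuous _).comp c1).clm_apply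
    ((ContinuousLinearMap.continuous _).comp c2)

theorem integrable_pairing_translate {f : ℝ → StrongDual ℝ E} {w : ℝ → E}
    (hf : MemLp f 2 volume) (hw : MemLp w 2 volume) (r h : ℝ) :
    Integrable fun t => f (t + r) (w (t + h)) := by
  have h1 : MemLp (fun t => f (t + r)) 2 volume :=
    hf.comp_measurePreserving (measurePreserving_add_right volume r)
  have h2 : MemLp (fun t => w (t + h)) 2 volume :=
    hw.comp_measurePreserving (measurePreserving_add_right volume h)
  exact memLp_one_iff_integrable.1
    ((ContinuousLinearMap.id ℝ (StrongDual ℝ E)).memLp_of_bilin 1 h1 h2)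

/-- The Steklov average of `f`, paired with a translate of `w`, as an average of pairings of
translates. -/
theorem integral_steklov_pairing {f : ℝ → StrongDual ℝ E} {w : ℝ → E}
    (hf : MemLp f 2 volume) (hw : MemLp w 2 volume) (a b : ℝ) {h : ℝ} (hh : 0 ≤ h) :
    IntegrableOn (fun t => (∫ s in t..t + h, f s) (w (t + h))) (Ioc a b) ∧
    ∫ t in Ioc a b, (∫ s in t..t + h, f s) (w (t + h))
      = ∫ r in (0 : ℝ)..h, ∫ t in Ioc a b, f (t + r) (w (t + h)) := by
  have hqm : Measure.QuasiMeasurePreserving (fun z : ℝ × ℝ => z.1 + z.2)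
      ((volume.restrict (Ioc a b)).prod (volume.restrict (Ioc 0 h))) volume := by
    rw [Measure.prod_restrict]
    exact (quasiMeasurePreserving_add volume volume).mono_left
      Measure.absolutelyContinuous_restrict
  have hqm' : Measure.QuasiMeasurePreserving (fun z : ℝ × ℝ => z.1 + h)
      ((volume.restrict (Ioc a b)).prod (volume.restrict (Ioc 0 h))) volume := by
    refine (measurePreserving_add_right volume h).quasiMeasurePreserving.comp ?_
    exact Measure.quasiMeasurePreserving_fst.mono_right Measure.absolutelyContinuous_restrict
  have hmeas : AEStronglyMeasurable (fun z : ℝ × ℝ => f (z.1 + z.2) (w (z.1 + h)))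
      ((volume.restrict (Ioc a b)).prod (volume.restrict (Ioc 0 h))) :=
    (ContinuousLinearMap.id ℝ (StrongDual ℝ E)).aestronglyMeasurable_comp₂
      (hf.1.comp_quasiMeasurePreserving hqm) (hw.1.comp_quasiMeasurePreserving hqm')
  have hf2 : Integrable (fun t => ‖f t‖ ^ 2) := (memLp_two_iff_integrable_sq_norm hf.1).1 hf
  have hw2 : Integrable (fun t => ‖w t‖ ^ 2) := (memLp_two_iff_integrable_sq_norm hw.1).1 hw
  have hint : Integrable (fun z : ℝ × ℝ => f (z.1 + z.2) (w (z.1 + h)))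
      ((volume.restrict (Ioc a b)).prod (volume.restrict (Ioc 0 h))) := by
    rw [integrable_prod_iff' hmeas]
    refine ⟨Filter.Eventually.of_forall fun r =>
      (integrable_pairing_translate hf hw r h).integrableOn, ?_⟩
    refine Integrable.of_bound hmeas.norm.prod_swap.integral_prod_right'
      ((∫ t, ‖f t‖ ^ 2) + ∫ t, ‖w t‖ ^ 2) (Filter.Eventually.of_forall fun r => ?_)
    rw [Real.norm_of_nonneg (integral_nonneg fun _ => norm_nonneg _),
      ← integral_add_right_eq_self (fun t => ‖f t‖ ^ 2) r,
      ← integral_add_right_eq_self (fun t => ‖w t‖ ^ 2) h,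
      ← integral_add (hf2.comp_add_right r) (hw2.comp_add_right h)]
    refine (setIntegral_le_integral (integrable_pairing_translate hf hw r h).norm
      (Filter.Eventually.of_forall fun _ => norm_nonneg _)).trans ?_
    refine integral_mono (integrable_pairing_translate hf hw r h).norm
      ((hf2.comp_add_right r).add (hw2.comp_add_right h)) fun t => ?_
    have := (f (t + r)).le_opNorm (w (t + h))
    simp only
    nlinarith [sq_nonneg (‖f (t + r)‖ - ‖w (t + h)‖), norm_nonneg (f (t + r)),
      norm_nonneg (w (t + h))]
  have e : ∀ t, (∫ s in t..t + h, f s) (w (t + h)) = ∫ r in Ioc 0 h, f (t + r) (w (t + h)) := by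
    intro t
    have hloc : IntegrableOn (fun r => f (t + r)) (Ioc 0 h) := by
      have : MemLp (fun r => f (t + r)) 2 volume :=
        hf.comp_measurePreserving (measurePreserving_add_left volume t)
      exact (this.restrict _).integrable one_le_two
    have e1 : ∫ s in t..t + h, f s = ∫ r in Ioc 0 h, f (t + r) := by
      rw [← intervalIntegral.integral_of_le hh, intervalIntegral.integral_comp_add_left, add_zero]
    rw [e1, ContinuousLinearMap.integral_apply hloc]
  refine ⟨?_, ?_⟩
  · simp_rw [e]
    exact hint.integral_prod_left
  · simp_rw [e]
    rw [intervalIntegral.integral_of_le hh]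
    exact integral_integral_swap hint

end Translation

section Energy

variable {V H : Type*} [NormedAddCommGroup V] [InnerProductSpace ℝ V]
  [NormedAddCommGroup H] [InnerProductSpace ℝ H]

/-- If `w ∈ L₂(V)` is a primitive, in `V'`, of `f ∈ L₂(V')`, then `‖w(b)‖² - ‖w(a)‖²` is at most
`2 ∫_a^b ⟨f, w⟩` for almost all `a < b`. The proof integrates
`‖w(t+h)‖² - ‖w(t)‖² ≤ 2 ⟨∫_t^{t+h} f, w(t+h)⟩` over `(a,b)`, divides by `h`, and lets `h → 0`. -/
theorem NormalTriple.energy_le (S : NormalTriple V H) {f : ℝ → StrongDual ℝ V} {w : ℝ → V}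
    (hf : MemLp f 2 volume) (hw : MemLp w 2 volume) {a₀ b₀ : ℝ} {y : StrongDual ℝ V}
    (h : ∀ᵐ t, t ∈ Ioo a₀ b₀ → S.dualEmb (S.emb (w t)) = y + ∫ s in a₀..t, f s) :
    ∃ Z : Set ℝ, (∀ᵐ t, t ∈ Z) ∧ ∀ a ∈ Z, ∀ b ∈ Z, a₀ < a → a < b → b < b₀ →
      ‖S.emb (w b)‖ ^ 2 - ‖S.emb (w a)‖ ^ 2 ≤ 2 * ∫ t in a..b, f t (w t) := by
  have hN : Integrable (fun t => ‖S.emb (w t)‖ ^ 2) := by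
    have : MemLp (fun t => S.emb (w t)) 2 volume := S.emb.comp_memLp' hw
    exact (memLp_two_iff_integrable_sq_norm this.1).1 this
  -- `Z` consists of the times at which the primitives of `‖w‖²` have the derivative `‖w‖²`.
  refine ⟨_, LocallyIntegrable.ae_hasDerivAt_integral hN.locallyIntegrable,
    fun a ha b hb ha0 hab hb0 => ?_⟩
  set N : ℝ → ℝ := fun t => ‖S.emb (w t)‖ ^ 2 with hNdef
  have hloc : ∀ u v, IntervalIntegrable f volume u v := fun u v =>
    ⟨(hf.restrict _).integrable one_le_two, (hf.restrict _).integrable one_le_two⟩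
  have key : ∀ h' ∈ Ioo 0 (b₀ - b), (∫ t in b..b + h', N t) - ∫ t in a..a + h', N t
      ≤ 2 * ∫ r in (0 : ℝ)..h', ∫ t in Ioc a b, f (t + r) (w (t + h')) := by
    intro h' hh'
    obtain ⟨i1, i2⟩ := integral_steklov_pairing hf hw a b hh'.1.le
    rw [← i2]
    have : (∫ t in b..b + h', N t) - ∫ t in a..a + h', N t
        = ∫ t in Ioc a b, (N (t + h') - N t) := by
      rw [integral_sub (hN.comp_add_right h').integrableOn hN.integrableOn,
        ← intervalIntegral.integral_of_le hab.le, ← intervalIntegral.integral_of_le hab.le,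
        intervalIntegral.integral_comp_add_right]
      have e1 := intervalIntegral.integral_add_adjacent_intervals
        (hN.intervalIntegrable (a := a) (b := b)) (hN.intervalIntegrable (a := b) (b := b + h'))
      have e2 := intervalIntegral.integral_add_adjacent_intervals
        (hN.intervalIntegrable (a := a) (b := a + h'))
        (hN.intervalIntegrable (a := a + h') (b := b + h'))
      linarith
    rw [this, ← integral_const_mul]
    refine setIntegral_mono_ae_restrict
      ((hN.comp_add_right h').integrableOn.sub hN.integrableOn) (i1.const_mul 2) ?_
    have hsh := (measurePreserving_add_right volume h').quasiMeasurePreserving.ae h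
    filter_upwards [ae_restrict_of_ae h, ae_restrict_of_ae hsh, ae_restrict_mem measurableSet_Ioc]
      with t h1 h2 ht
    have h1 := h1 ⟨ha0.trans ht.1, ht.2.trans_lt hb0⟩
    have h2 := h2 ⟨by linarith [ht.1, hh'.1], by linarith [ht.2, hh'.2]⟩
    have h3 : ∫ s in t..t + h', f s
        = S.dualEmb (S.emb (w (t + h'))) - S.dualEmb (S.emb (w t)) := by
      rw [h1, h2, ← intervalIntegral.integral_add_adjacent_intervals (hloc a₀ t) (hloc t (t + h'))]
      abel
    rw [h3, sub_apply, S.dualEmb_apply, S.dualEmb_apply,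
      real_inner_self_eq_norm_sq]
    have := norm_sub_sq_real (S.emb (w t)) (S.emb (w (t + h')))
    have h0 := sq_nonneg ‖S.emb (w t) - S.emb (w (t + h'))‖
    simp only [hNdef]
    linarith
  have lim : ∀ c, HasDerivAt (fun x => ∫ t in c..x, N t) (N c) c →
      Filter.Tendsto (fun h' => h'⁻¹ * ∫ t in c..c + h', N t) (nhdsWithin 0 (Ioi 0))
        (nhds (N c)) := by
    intro c hc
    have := hc.tendsto_slope_zero_right
    simpa using this
  rw [intervalIntegral.integral_of_le hab.le]
  refine le_of_forall_pos_le_add fun ε hε => ?_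
  have hcont := (continuous_integral_pairing_translate hf hw a b).tendsto (0, 0)
  simp only [add_zero] at hcont
  set I := ∫ t in Ioc a b, f t (w t)
  have hcont' := hcont.eventually (eventually_le_nhds (show I < I + ε / 2 by linarith))
  obtain ⟨δ, hδ, hδ'⟩ := Metric.eventually_nhds_iff.1 hcont'
  refine le_of_tendsto ((lim b (hb b)).sub (lim a (ha a))) ?_
  have hsmall : ∀ᶠ h' in nhdsWithin (0 : ℝ) (Ioi 0), h' ∈ Ioo 0 (min δ (b₀ - b)) :=
    Ioo_mem_nhdsGT (lt_min hδ (by linarith))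
  filter_upwards [hsmall] with h' hh'
  have hh1 : h' < δ := hh'.2.trans_le (min_le_left _ _)
  have hk := key h' ⟨hh'.1, hh'.2.trans_le (min_le_right _ _)⟩
  have hle : ∫ r in (0 : ℝ)..h', ∫ t in Ioc a b, f (t + r) (w (t + h'))
      ≤ ∫ r in (0 : ℝ)..h', (I + ε / 2) := by
    refine intervalIntegral.integral_mono_on hh'.1.le ?_ (by simp) ?_
    · exact ((continuous_integral_pairing_translate hf hw a b).comp
        (by fun_prop : Continuous fun r : ℝ => (r, h'))).intervalIntegrable _ _
    · intro r hr
      refine @hδ' (r, h') ?_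
      rw [Prod.dist_eq, Real.dist_eq, Real.dist_eq, sub_zero, sub_zero, abs_of_nonneg hr.1,
        abs_of_pos hh'.1]
      exact max_lt (hr.2.trans_lt hh1) hh1
  rw [intervalIntegral.integral_const, sub_zero, smul_eq_mul] at hle
  rw [← mul_sub, inv_mul_le_iff₀ hh'.1]
  linarith

end Energy

/-! ### Existence for linear parabolic equations -/

/-- Lions' projection lemma: a linear functional `ℓ` that is bounded by `‖Λ θ‖` is of the form
`θ ↦ Λ θ x`. -/
theorem exists_forall_apply_eq_of_abs_le {X Θ : Type*} [NormedAddCommGroup X]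
    [InnerProductSpace ℝ X] [CompleteSpace X] [AddCommGroup Θ] [Module ℝ Θ]
    (Λ : Θ →ₗ[ℝ] StrongDual ℝ X) (l : Θ →ₗ[ℝ] ℝ) (C : ℝ) (h : ∀ θ, |l θ| ≤ C * ‖Λ θ‖) :
    ∃ x : X, ∀ θ, Λ θ x = l θ := by
  have hker : LinearMap.ker Λ ≤ LinearMap.ker l := by
    intro θ hθ
    have := h θ
    rw [LinearMap.mem_ker.1 hθ, norm_zero, mul_zero] at this
    exact LinearMap.mem_ker.2 (abs_nonpos_iff.1 this)
  let g₀ : LinearMap.range Λ →ₗ[ℝ] ℝ :=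
    (LinearMap.ker Λ).liftQ l hker ∘ₗ Λ.quotKerEquivRange.symm.toLinearMap
  have hg₀ : ∀ θ, g₀ ⟨Λ θ, LinearMap.mem_range_self Λ θ⟩ = l θ := by
    intro θ
    have : Λ.quotKerEquivRange.symm ⟨Λ θ, LinearMap.mem_range_self Λ θ⟩
        = (LinearMap.ker Λ).mkQ θ := Λ.quotKerEquivRange_symm_apply_image θ _
    simp only [g₀, LinearMap.comp_apply, LinearEquiv.coe_coe]
    rw [this, Submodule.mkQ_apply, Submodule.liftQ_apply]
  let g₁ : StrongDual ℝ (LinearMap.range Λ) := g₀.mkContinuous C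
    (fun y : LinearMap.range Λ => by
      obtain ⟨y, θ, rfl⟩ := y
      rw [hg₀]
      exact h θ)
  obtain ⟨g, hg, -⟩ := exists_extension_norm_eq (LinearMap.range Λ) g₁
  refine ⟨(InnerProductSpace.toDual ℝ X).symm (g.comp (innerSL ℝ : X →L[ℝ] X →L[ℝ] ℝ)),
    fun θ => ?_⟩
  obtain ⟨y, hy⟩ := (InnerProductSpace.toDual ℝ X).surjective (Λ θ)
  have hk : g (Λ θ) = l θ := (hg ⟨Λ θ, LinearMap.mem_range_self Λ θ⟩).trans (hg₀ θ)
  rw [← hk, ← hy, InnerProductSpace.toDual_apply_apply, real_inner_comm,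
    InnerProductSpace.toDual_symm_apply]
  rfl

section Lp

variable {E : Type*} [NormedAddCommGroup E] {T : ℝ}

theorem integrableOn_Ioc_of_memLp {x : ℝ → E} (hx : MemLp x 2 (volume.restrict (Ioo 0 T))) {t : ℝ}
    (ht : t ≤ T) : IntegrableOn x (Ioc 0 t) := by
  have h1 : IntegrableOn x (Ioo 0 T) := hx.integrable one_le_two
  exact ((integrableOn_Ioc_iff_integrableOn_Ioo).2 h1).mono_set (Ioc_subset_Ioc_right ht)

theorem intervalIntegrable_of_memLp {x : ℝ → E} (hx : MemLp x 2 (volume.restrict (Ioo 0 T)))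
    {s t : ℝ} (hs : s ∈ Icc 0 T) (ht : t ∈ Icc 0 T) : IntervalIntegrable x volume s t := by
  refine IntervalIntegrable.mono_set (a := 0) (b := T) ?_ (uIcc_subset_uIcc ?_ ?_)
  · exact (intervalIntegrable_iff_integrableOn_Ioc_of_le (hs.1.trans hs.2)).2
      (integrableOn_Ioc_of_memLp hx le_rfl)
  · rwa [uIcc_of_le (hs.1.trans hs.2)]
  · rwa [uIcc_of_le (hs.1.trans hs.2)]

theorem memLp_two_of_continuousOn {x : ℝ → E} (hx : ContinuousOn x (Icc 0 T)) :
    MemLp x 2 (volume.restrict (Ioo 0 T)) := by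
  obtain ⟨C, hC⟩ := isCompact_Icc.exists_bound_of_continuousOn hx
  refine MemLp.of_bound ((hx.mono Ioo_subset_Icc_self).aestronglyMeasurable measurableSet_Ioo) C ?_
  filter_upwards [ae_restrict_mem measurableSet_Ioo] with t ht
  exact hC t (Ioo_subset_Icc_self ht)

variable [NormedSpace ℝ E]

theorem memLp_primitive {x : ℝ → E} (hx : MemLp x 2 (volume.restrict (Ioo 0 T))) :
    MemLp (fun t => ∫ s in (0 : ℝ)..t, x s) 2 (volume.restrict (Ioo 0 T)) := by
  rcases le_or_gt T 0 with hT | hT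
  · simp [Ioo_eq_empty_of_le hT]
  · refine memLp_two_of_continuousOn ?_
    have := intervalIntegral.continuousOn_primitive_interval'
      (intervalIntegrable_of_memLp hx (left_mem_Icc.2 hT.le) (right_mem_Icc.2 hT.le)) left_mem_uIcc
    rwa [uIcc_of_le hT.le] at this

theorem memLp_primitive_back {x : ℝ → E} (hx : MemLp x 2 (volume.restrict (Ioo 0 T))) :
    MemLp (fun t => ∫ s in t..T, x s) 2 (volume.restrict (Ioo 0 T)) := by
  rcases le_or_gt T 0 with hT | hT
  · simp [Ioo_eq_empty_of_le hT]
  · refine memLp_two_of_continuousOn ?_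
    have := intervalIntegral.continuousOn_primitive_interval'
      (intervalIntegrable_of_memLp hx (left_mem_Icc.2 hT.le) (right_mem_Icc.2 hT.le)) right_mem_uIcc
    rw [uIcc_of_le hT.le] at this
    simp_rw [intervalIntegral.integral_symm T]
    exact this.neg

theorem integral_timeInterval_eq (hT : 0 ≤ T) (x : ℝ → E) :
    ∫ t, x t ∂volume.restrict (Ioo 0 T) = ∫ t in (0 : ℝ)..T, x t := by
  rw [intervalIntegral.integral_of_le hT, integral_Ioc_eq_integral_Ioo]

/-- The backward primitive `θ ↦ (t ↦ ∫_t^T θ)` on square integrable functions. -/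
def primitiveBack (T : ℝ) : Lp E 2 (volume.restrict (Ioo 0 T)) →ₗ[ℝ]
    Lp E 2 (volume.restrict (Ioo 0 T)) where
  toFun x := (memLp_primitive_back (Lp.memLp x)).toLp
  map_add' x y := by
    rw [← MemLp.toLp_add]
    refine MemLp.toLp_congr _ _ ?_
    filter_upwards [ae_restrict_mem measurableSet_Ioo] with t ht
    have hT : T ∈ Icc 0 T := ⟨(ht.1.trans ht.2).le, le_rfl⟩
    have ht' : t ∈ Icc 0 T := Ioo_subset_Icc_self ht
    rw [Pi.add_apply, ← intervalIntegral.integral_add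
      (intervalIntegrable_of_memLp (Lp.memLp x) ht' hT)
      (intervalIntegrable_of_memLp (Lp.memLp y) ht' hT),
      intervalIntegral.integral_of_le ht.2.le, intervalIntegral.integral_of_le ht.2.le,
      integral_Ioc_eq_integral_Ioo, integral_Ioc_eq_integral_Ioo]
    exact integral_congr_ae (ae_mono (Measure.restrict_mono (Ioo_subset_Ioo_left ht.1.le) le_rfl)
      (Lp.coeFn_add x y))
  map_smul' c x := by
    rw [RingHom.id_apply, ← MemLp.toLp_const_smul]
    refine MemLp.toLp_congr _ _ ?_
    filter_upwards [ae_restrict_mem measurableSet_Ioo] with t ht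
    rw [Pi.smul_apply, ← intervalIntegral.integral_smul,
      intervalIntegral.integral_of_le ht.2.le, intervalIntegral.integral_of_le ht.2.le,
      integral_Ioc_eq_integral_Ioo, integral_Ioc_eq_integral_Ioo]
    exact integral_congr_ae (ae_mono (Measure.restrict_mono (Ioo_subset_Ioo_left ht.1.le) le_rfl)
      (Lp.coeFn_smul c x))

theorem coeFn_primitiveBack (x : Lp E 2 (volume.restrict (Ioo 0 T))) :
    primitiveBack T x =ᵐ[volume.restrict (Ioo 0 T)] fun t => ∫ s in t..T, x s :=
  (memLp_primitive_back (Lp.memLp x)).coeFn_toLp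

end Lp

variable {V H : Type*} [NormedAddCommGroup V] [InnerProductSpace ℝ V]
  [NormedAddCommGroup H] [InnerProductSpace ℝ H]

/-- The inner product of a real Hilbert space as a bounded bilinear map. -/
def innerL (H : Type*) [NormedAddCommGroup H] [InnerProductSpace ℝ H] : H →L[ℝ] H →L[ℝ] ℝ :=
  innerSL ℝ

theorem innerL_apply (x y : H) : innerL H x y = inner ℝ x y := rfl

/-- The embedding `H ↪ V'` as a bounded linear map. -/
def NormalTriple.dualEmbL (S : NormalTriple V H) : H →L[ℝ] StrongDual ℝ V :=
  ((ContinuousLinearMap.compL ℝ V H ℝ).flip S.emb).comp (innerL H)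

theorem NormalTriple.dualEmbL_apply (S : NormalTriple V H) (h : H) : S.dualEmbL h = S.dualEmb h :=
  rfl

/-- A bounded strongly measurable family of operators `A(t) : V → V'` with
`⟨A(t) v, v⟩ ≤ -c ‖v‖²` for almost all `t ∈ (0,T)`. -/
structure IsCoerciveFamily (T : ℝ) (A : ℝ → V →L[ℝ] StrongDual ℝ V) (K c : ℝ) : Prop extends
    IsBddFamily (volume.restrict (Ioo 0 T)) A K where
  pos : 0 < c
  coercive : ∀ᵐ t ∂volume.restrict (Ioo 0 T), ∀ v, A t v v ≤ -c * ‖v‖ ^ 2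

/-- Positivity of the Volterra operator. -/
theorem integral_inner_primitiveBack_nonneg [CompleteSpace H] {T : ℝ} (hT : 0 ≤ T) {x : ℝ → H}
    (hx : MemLp x 2 (volume.restrict (Ioo 0 T))) :
    0 ≤ ∫ t in (0 : ℝ)..T, inner ℝ (x t) (∫ s in t..T, x s) := by
  have hi := integrableOn_Ioc_of_memLp hx le_rfl
  have h := integral_bilin_primitive_left_eq_right hT (innerL H) hi hi
  simp only [innerL_apply] at h
  have h0 : (0 : ℝ) ∈ Icc 0 T := left_mem_Icc.2 hT
  have hTT : T ∈ Icc 0 T := right_mem_Icc.2 hT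
  have hc : ContinuousOn (fun t => ∫ s in (0 : ℝ)..t, x s) (uIcc 0 T) :=
    intervalIntegral.continuousOn_primitive_interval' (intervalIntegrable_of_memLp hx h0 hTT)
      left_mem_uIcc
  have hc' : ContinuousOn (fun t => ∫ s in t..T, x s) (uIcc 0 T) := by
    simp_rw [intervalIntegral.integral_symm T]
    exact (intervalIntegral.continuousOn_primitive_interval'
      (intervalIntegrable_of_memLp hx h0 hTT) right_mem_uIcc).neg
  have e : ∀ y : ℝ → H, ContinuousOn y (uIcc 0 T) →
      IntervalIntegrable (fun t => inner ℝ (x t) (y t)) volume 0 T := by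
    intro y hy
    have hyL : MemLp y 2 (volume.restrict (Ioo 0 T)) :=
      memLp_two_of_continuousOn (by rwa [uIcc_of_le hT] at hy)
    have : Integrable (fun t => inner ℝ (x t) (y t)) (volume.restrict (Ioo 0 T)) :=
      memLp_one_iff_integrable.1 ((innerL H).memLp_of_bilin 1 hx hyL)
    exact (intervalIntegrable_iff_integrableOn_Ioc_of_le hT).2
      ((integrableOn_Ioc_iff_integrableOn_Ioo).2 this)
  have h2 : 2 * ∫ t in (0 : ℝ)..T, inner ℝ (x t) (∫ s in t..T, x s)
      = ‖∫ t in (0 : ℝ)..T, x t‖ ^ 2 := by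
    rw [two_mul]
    nth_rw 1 [← h]
    simp_rw [real_inner_comm (x _) (∫ s in (0 : ℝ).._, x s)]
    rw [← intervalIntegral.integral_add (e _ hc) (e _ hc')]
    have : ∀ t ∈ uIcc 0 T, inner ℝ (x t) (∫ s in (0 : ℝ)..t, x s)
        + inner ℝ (x t) (∫ s in t..T, x s) = inner ℝ (∫ s in (0 : ℝ)..T, x s) (x t) := by
      intro t ht
      rw [uIcc_of_le hT] at ht
      rw [← inner_add_right, intervalIntegral.integral_add_adjacent_intervals
        (intervalIntegrable_of_memLp hx h0 ht) (intervalIntegrable_of_memLp hx ht hTT),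
        real_inner_comm]
    rw [intervalIntegral.integral_congr this, ← real_inner_self_eq_norm_sq]
    exact (innerL H (∫ s in (0 : ℝ)..T, x s)).intervalIntegral_comp_comm
      (intervalIntegrable_of_memLp hx h0 hTT)
  have := sq_nonneg ‖∫ t in (0 : ℝ)..T, x t‖
  linarith

/-- Existence for `w' = A w + f`, `w(0) = 0`, with `f ∈ L₂((0,T); V')`: Lions' projection lemma
applied to the weak formulation with the test functions `t ↦ ∫_t^T θ`. -/
theorem NormalTriple.exists_solution [CompleteSpace V] [CompleteSpace H] (S : NormalTriple V H)
    {T : ℝ} (hT : 0 ≤ T)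
    {A : ℝ → V →L[ℝ] StrongDual ℝ V} {K c : ℝ} (hA : IsCoerciveFamily T A K c)
    (f : Lp (StrongDual ℝ V) 2 (volume.restrict (Ioo 0 T))) :
    ∃ w : Lp V 2 (volume.restrict (Ioo 0 T)), ∀ᵐ t ∂volume.restrict (Ioo 0 T),
      S.dualEmb (S.emb (w t)) = ∫ s in (0 : ℝ)..t, (A s (w s) + f s) := by
  let μ : Measure ℝ := volume.restrict (Ioo 0 T)
  let ι : Lp V 2 μ →L[ℝ] Lp H 2 μ := S.emb.compLpL 2 μ
  have hι : ∀ x, ι x =ᵐ[μ] fun t => S.emb (x t) := fun x => S.emb.coeFn_compLpL x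
  let P : Lp (StrongDual ℝ V) 2 μ →L[ℝ] Lp V 2 μ →L[ℝ] ℝ :=
    (ContinuousLinearMap.id ℝ (StrongDual ℝ V)).lpPairing μ 2 2
  have hP : ∀ g x, P g x = ∫ t, g t (x t) ∂μ := fun g x =>
    ContinuousLinearMap.lpPairing_eq_integral _ g x
  let Λ : Lp V 2 μ →ₗ[ℝ] StrongDual ℝ (Lp V 2 μ) :=
    { toFun := fun θ => (innerL _ (ι θ)).comp ι
        - (P.flip (primitiveBack T θ)).comp hA.toIsBddFamily.op
      map_add' := fun x y => by
        ext z; simp; ring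
      map_smul' := fun r x => by
        ext z; simp; ring }
  have hΛ : ∀ θ z, Λ θ z = inner ℝ (ι θ) (ι z) - P (hA.toIsBddFamily.op z) (primitiveBack T θ) :=
    fun θ z => rfl
  let l : Lp V 2 μ →ₗ[ℝ] ℝ := (P f).toLinearMap ∘ₗ primitiveBack T
  have hcoer : ∀ θ, c * ‖primitiveBack T θ‖ ≤ ‖Λ θ‖ := by
    intro θ
    have h1 : c * ‖primitiveBack T θ‖ ^ 2 ≤ Λ θ (primitiveBack T θ) := by
      rw [hΛ, hP, L2.inner_def, norm_sq_eq_integral]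
      have e1 : 0 ≤ ∫ t, inner ℝ (ι θ t) (ι (primitiveBack T θ) t) ∂μ := by
        have hpos := integral_inner_primitiveBack_nonneg hT (x := fun t => S.emb (θ t))
          (S.emb.comp_memLp' (Lp.memLp θ))
        rw [← integral_timeInterval_eq hT] at hpos
        refine hpos.trans_eq (integral_congr_ae ?_)
        filter_upwards [hι θ, hι (primitiveBack T θ), coeFn_primitiveBack θ,
          ae_restrict_mem measurableSet_Ioo] with t h1 h2 h3 ht
        rw [h1, h2, h3]
        congr 1
        exact S.emb.intervalIntegral_comp_comm (intervalIntegrable_of_memLp (Lp.memLp θ)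
          (Ioo_subset_Icc_self ht) (right_mem_Icc.2 hT))
      have e2 : ∫ t, (hA.toIsBddFamily.op (primitiveBack T θ)) t (primitiveBack T θ t) ∂μ
          ≤ ∫ t, -c * ‖primitiveBack T θ t‖ ^ 2 ∂μ := by
        refine integral_mono_ae ?_ ((integrable_norm_sq _).const_mul _) ?_
        · exact memLp_one_iff_integrable.1 ((ContinuousLinearMap.id ℝ
            (StrongDual ℝ V)).memLp_of_bilin 1 (Lp.memLp _) (Lp.memLp _))
        · filter_upwards [hA.coercive, hA.toIsBddFamily.coeFn_op (primitiveBack T θ)] with t h1 h2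
          rw [h2]
          exact h1 _
      rw [integral_const_mul] at e2
      linarith
    have h2 := (le_abs_self _).trans ((Λ θ).le_opNorm (primitiveBack T θ))
    rcases (norm_nonneg (primitiveBack T θ)).eq_or_lt with h0 | h0
    · rw [← h0, mul_zero]; exact norm_nonneg (Λ θ)
    · refine le_of_mul_le_mul_right ?_ h0
      calc _ = c * ‖primitiveBack T θ‖ ^ 2 := by ring
        _ ≤ _ := h1.trans h2
  have hl : ∀ θ, |l θ| ≤ (‖P f‖ / c) * ‖Λ θ‖ := by
    intro θ
    have h1 : |l θ| ≤ ‖P f‖ * ‖primitiveBack T θ‖ := (P f).le_opNorm _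
    have h2 : ‖primitiveBack T θ‖ ≤ ‖Λ θ‖ / c := (le_div_iff₀' hA.pos).2 (hcoer θ)
    calc |l θ| ≤ ‖P f‖ * (‖Λ θ‖ / c) := h1.trans (by gcongr)
      _ = _ := by ring
  obtain ⟨w, hw⟩ := exists_forall_apply_eq_of_abs_le Λ l _ hl
  refine ⟨w, ?_⟩
  have hG : MemLp (fun s => A s (w s) + f s) 2 μ :=
    (hA.toIsBddFamily.memLp (Lp.memLp w)).add (Lp.memLp f)
  have hz : MemLp (fun t => S.dualEmb (S.emb (w t)) - ∫ s in (0 : ℝ)..t, (A s (w s) + f s)) 2 μ :=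
    ((S.dualEmbL.comp S.emb).comp_memLp' (Lp.memLp w)).sub (memLp_primitive hG)
  let Z : Lp (StrongDual ℝ V) 2 μ := hz.toLp
  have horth : ∀ θ : Lp V 2 μ, P Z θ = 0 := by
    intro θ
    have h1 := hw θ
    rw [hΛ] at h1
    have h2 : l θ = P f (primitiveBack T θ) := rfl
    rw [h2, sub_eq_iff_eq_add, ← add_apply, ← map_add, hP, L2.inner_def] at h1
    have e1 : ∫ t, inner ℝ (ι θ t) (ι w t) ∂μ = ∫ t, S.dualEmb (S.emb (w t)) (θ t) ∂μ := by
      refine integral_congr_ae ?_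
      filter_upwards [hι θ, hι w] with t h1 h2
      rw [h1, h2, S.dualEmb_apply, real_inner_comm]
    have e2 : ∫ t, (f + hA.toIsBddFamily.op w) t (primitiveBack T θ t) ∂μ
        = ∫ t, (∫ s in (0 : ℝ)..t, (A s (w s) + f s)) (θ t) ∂μ := by
      rw [integral_timeInterval_eq hT (fun t => (∫ s in (0 : ℝ)..t, (A s (w s) + f s)) (θ t))]
      have := integral_bilin_primitive_left_eq_right hT (ContinuousLinearMap.id ℝ (StrongDual ℝ V))
        (integrableOn_Ioc_of_memLp hG le_rfl) (integrableOn_Ioc_of_memLp (Lp.memLp θ) le_rfl)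
      simp only [ContinuousLinearMap.id_apply] at this
      rw [this, ← integral_timeInterval_eq hT]
      refine integral_congr_ae ?_
      filter_upwards [Lp.coeFn_add f (hA.toIsBddFamily.op w), hA.toIsBddFamily.coeFn_op w,
        coeFn_primitiveBack θ] with t h1 h2 h3
      rw [h1, Pi.add_apply, h2, h3, add_comm]
    rw [e1, e2, ← sub_eq_zero, ← integral_sub] at h1
    · rw [hP, ← h1]
      refine integral_congr_ae ?_
      filter_upwards [hz.coeFn_toLp] with t ht
      rw [ht, sub_apply]
    · exact memLp_one_iff_integrable.1 ((ContinuousLinearMap.id ℝ (StrongDual ℝ V)).memLp_of_bilin 1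
        ((S.dualEmbL.comp S.emb).comp_memLp' (Lp.memLp w)) (Lp.memLp θ))
    · exact memLp_one_iff_integrable.1 ((ContinuousLinearMap.id ℝ (StrongDual ℝ V)).memLp_of_bilin 1
        (memLp_primitive hG) (Lp.memLp θ))
  -- The Riesz representative of the defect is a test function.
  have hr : MemLp (fun t => (InnerProductSpace.toDual ℝ V).symm (Z t)) 2 μ :=
    (Lp.memLp Z).of_le
      ((InnerProductSpace.toDual ℝ V).symm.continuous.comp_aestronglyMeasurable
        (Lp.aestronglyMeasurable Z))
      (Filter.Eventually.of_forall fun t => by rw [LinearIsometryEquiv.norm_map])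
  have hZ0 : ‖Z‖ ^ 2 = 0 := by
    rw [norm_sq_eq_integral, ← horth hr.toLp, hP]
    refine integral_congr_ae ?_
    filter_upwards [hr.coeFn_toLp] with t ht
    rw [ht, ← InnerProductSpace.toDual_symm_apply, real_inner_self_eq_norm_sq,
      LinearIsometryEquiv.norm_map]
  have hZ : Z = 0 := by simpa using hZ0
  have h3 : Z =ᵐ[μ] 0 := by rw [hZ]; exact Lp.coeFn_zero _ _ _
  filter_upwards [h3, hz.coeFn_toLp] with t h1 h2
  rw [h2] at h1
  exact eq_of_sub_eq_zero h1

/-! ### Energy estimates up to the initial time -/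

/-- An inequality between continuous functions on `[0,T]` that holds almost everywhere holds
everywhere. -/
theorem le_of_ae_le_of_continuousOn {T : ℝ} (hT : 0 < T) {f g : ℝ → ℝ}
    (hf : ContinuousOn f (Icc 0 T)) (hg : ContinuousOn g (Icc 0 T))
    (h : ∀ᵐ t ∂volume.restrict (Ioo 0 T), f t ≤ g t) {t : ℝ} (ht : t ∈ Icc 0 T) : f t ≤ g t := by
  have h1 : (fun t => max (f t) (g t)) =ᵐ[volume.restrict (Icc 0 T)] g := by
    rw [← restrict_Ioo_eq_restrict_Icc]
    filter_upwards [h] with t ht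
    exact max_eq_right ht
  exact max_eq_right_iff.1 (Measure.eqOn_Icc_of_ae_eq volume hT.ne h1 (hf.sup hg) hg ht)

section Energy

variable {V H : Type*} [NormedAddCommGroup V] [InnerProductSpace ℝ V]
  [NormedAddCommGroup H] [InnerProductSpace ℝ H] {T : ℝ}

theorem integrable_pairing {f : ℝ → StrongDual ℝ V} {w : ℝ → V} {μ : Measure ℝ}
    (hf : MemLp f 2 μ) (hw : MemLp w 2 μ) : Integrable (fun t => f t (w t)) μ :=
  memLp_one_iff_integrable.1 ((ContinuousLinearMap.id ℝ (StrongDual ℝ V)).memLp_of_bilin 1 hf hw)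

theorem integrable_inner {f g : ℝ → H} {μ : Measure ℝ}
    (hf : MemLp f 2 μ) (hg : MemLp g 2 μ) : Integrable (fun t => inner ℝ (f t) (g t)) μ :=
  memLp_one_iff_integrable.1 ((innerL H).memLp_of_bilin 1 hf hg)

theorem integrable_norm_mul_norm {E : Type*} [NormedAddCommGroup E] {f g : ℝ → E} {μ : Measure ℝ}
    (hf : MemLp f 2 μ) (hg : MemLp g 2 μ) : Integrable (fun t => ‖f t‖ * ‖g t‖) μ :=
  memLp_one_iff_integrable.1 ((ContinuousLinearMap.mul ℝ ℝ).memLp_of_bilin 1 hf.norm hg.norm)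

theorem integrableOn_Ioc_of_integrable {E : Type*} [NormedAddCommGroup E] {f : ℝ → E}
    (hf : Integrable f (volume.restrict (Ioo 0 T))) {t : ℝ} (ht : t ≤ T) :
    IntegrableOn f (Ioc 0 t) := by
  have h1 : IntegrableOn f (Ioo 0 T) := hf
  exact ((integrableOn_Ioc_iff_integrableOn_Ioo).2 h1).mono_set (Ioc_subset_Ioc_right ht)

theorem intervalIntegrable_of_integrable {E : Type*} [NormedAddCommGroup E] {f : ℝ → E}
    (hf : Integrable f (volume.restrict (Ioo 0 T))) {t : ℝ} (ht : t ∈ Icc 0 T) :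
    IntervalIntegrable f volume 0 t :=
  (intervalIntegrable_iff_integrableOn_Ioc_of_le ht.1).2 (integrableOn_Ioc_of_integrable hf ht.2)

theorem continuousOn_primitive_of_integrable {E : Type*} [NormedAddCommGroup E] [NormedSpace ℝ E]
    (hT : 0 ≤ T) {f : ℝ → E} (hf : Integrable f (volume.restrict (Ioo 0 T))) :
    ContinuousOn (fun t => ∫ s in (0 : ℝ)..t, f s) (Icc 0 T) := by
  have := intervalIntegral.continuousOn_primitive_interval'
    (intervalIntegrable_of_integrable hf (right_mem_Icc.2 hT)) left_mem_uIcc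
  rwa [uIcc_of_le hT] at this

theorem memLp_indicator_Ioo {E : Type*} [NormedAddCommGroup E] {x : ℝ → E}
    (hx : MemLp x 2 (volume.restrict (Ioo 0 T))) : MemLp ((Ioo 0 T).indicator x) 2 volume :=
  (memLp_indicator_iff_restrict measurableSet_Ioo).2 hx

theorem integral_indicator_Ioo_of_nonpos {E : Type*} [NormedAddCommGroup E] [NormedSpace ℝ E]
    (g : ℝ → E) {u v : ℝ} (huv : u ≤ v) (hv : v ≤ 0) :
    ∫ s in u..v, (Ioo 0 T).indicator g s = 0 := by
  rw [intervalIntegral.integral_of_le huv]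
  refine setIntegral_eq_zero_of_forall_eq_zero fun s hs => ?_
  exact indicator_of_notMem (fun h => absurd h.1 (not_lt.2 (hs.2.trans hv))) _

theorem integral_indicator_Ioo_of_subset {E : Type*} [NormedAddCommGroup E] [NormedSpace ℝ E]
    (g : ℝ → E) {a t : ℝ} (ha : 0 ≤ a) (hat : a ≤ t) (ht : t < T) :
    ∫ s in a..t, (Ioo 0 T).indicator g s = ∫ s in a..t, g s := by
  rw [intervalIntegral.integral_of_le hat, intervalIntegral.integral_of_le hat]
  refine setIntegral_congr_fun measurableSet_Ioc fun s hs => ?_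
  exact indicator_of_mem (show s ∈ Ioo 0 T from ⟨ha.trans_lt hs.1, hs.2.trans_lt ht⟩) _

/-- The energy inequality with zero initial value; the functions are extended by zero to negative
times. -/
theorem NormalTriple.energy_le_of_zero (S : NormalTriple V H) {f : ℝ → StrongDual ℝ V} {w : ℝ → V}
    (hf : MemLp f 2 (volume.restrict (Ioo 0 T))) (hw : MemLp w 2 (volume.restrict (Ioo 0 T)))
    (h : ∀ᵐ t ∂volume.restrict (Ioo 0 T), S.dualEmb (S.emb (w t)) = ∫ s in (0 : ℝ)..t, f s) :
    ∀ᵐ t ∂volume.restrict (Ioo 0 T), ‖S.emb (w t)‖ ^ 2 ≤ 2 * ∫ s in (0 : ℝ)..t, f s (w s) := by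
  have hf1 : MemLp ((Ioo 0 T).indicator f) 2 volume :=
    memLp_indicator_Ioo hf
  have hw1 : MemLp ((Ioo 0 T).indicator w) 2 volume :=
    memLp_indicator_Ioo hw
  have hloc : ∀ u v, IntervalIntegrable ((Ioo 0 T).indicator f) volume u v := fun u v =>
    ⟨(hf1.restrict _).integrable one_le_two, (hf1.restrict _).integrable one_le_two⟩
  have h1 : ∀ᵐ t, t ∈ Ioo (-1) T →
      S.dualEmb (S.emb ((Ioo 0 T).indicator w t))
        = 0 + ∫ s in (-1 : ℝ)..t, ((Ioo 0 T).indicator f) s := by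
    have h2 := (ae_restrict_iff' measurableSet_Ioo).1 h
    have h3 : ∀ᵐ s : ℝ, s ≠ 0 := by simp [ae_iff, measure_singleton]
    filter_upwards [h2, h3] with t h2 h3 ht
    rw [zero_add]
    rcases lt_or_gt_of_ne h3 with h0 | h0
    · rw [integral_indicator_Ioo_of_nonpos f ht.1.le h0.le]
      have : (Ioo 0 T).indicator w t = 0 :=
        indicator_of_notMem (fun h => absurd h.1 (not_lt.2 h0.le)) _
      rw [this, map_zero]
      exact S.dualEmbL.map_zero
    · rw [← intervalIntegral.integral_add_adjacent_intervals (hloc _ 0) (hloc 0 t),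
        integral_indicator_Ioo_of_nonpos f (by norm_num) le_rfl, zero_add,
        integral_indicator_Ioo_of_subset f le_rfl h0.le ht.2, ← h2 ⟨h0, ht.2⟩]
      have : (Ioo 0 T).indicator w t = w t :=
        indicator_of_mem (show t ∈ Ioo 0 T from ⟨h0, ht.2⟩) _
      rw [this]
  obtain ⟨Z, hZ, hle⟩ := S.energy_le hf1 hw1 h1
  obtain ⟨a, haZ, ha⟩ : ∃ a ∈ Z, a ∈ Ioo (-1 : ℝ) 0 := by
    have hd : Dense Z := Measure.dense_of_ae hZ
    obtain ⟨a, ha, haZ⟩ := hd.exists_mem_open isOpen_Ioo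
      (nonempty_Ioo.2 (by norm_num : (-1 : ℝ) < 0))
    exact ⟨a, ha, haZ⟩
  filter_upwards [ae_restrict_of_ae hZ, ae_restrict_mem measurableSet_Ioo] with t htZ ht
  have h2 := hle a haZ t htZ ha.1 (ha.2.trans ht.1) ht.2
  have e1 : (Ioo 0 T).indicator w t = w t := indicator_of_mem ht _
  have e2 : ((Ioo 0 T).indicator w) a = 0 :=
    indicator_of_notMem (fun h => absurd h.1 (not_lt.2 ha.2.le)) _
  have e3 : (fun s => ((Ioo 0 T).indicator f) s (((Ioo 0 T).indicator w) s))
      = (Ioo 0 T).indicator (fun s => f s (w s)) := by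
    funext s
    by_cases hs : s ∈ Ioo 0 T <;> simp [hs]
  have hI : Integrable ((Ioo 0 T).indicator fun s => f s (w s)) :=
    (integrable_indicator_iff measurableSet_Ioo).2 (integrable_pairing hf hw)
  rw [e1, e2, e3, ← intervalIntegral.integral_add_adjacent_intervals
    (hI.intervalIntegrable (a := a) (b := 0)) (hI.intervalIntegrable (a := 0) (b := t)),
    integral_indicator_Ioo_of_nonpos _ ha.2.le le_rfl,
    integral_indicator_Ioo_of_subset _ le_rfl ht.1.le ht.2] at h2
  simpa using h2

theorem NormalTriple.dualEmb_injective (S : NormalTriple V H) : Function.Injective S.dualEmb := by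
  intro x y hxy
  refine S.denseRange.eq_of_inner_left ℝ fun v => ?_
  rw [← S.dualEmb_apply, ← S.dualEmb_apply, hxy]

/-- The energy inequality for a solution with a continuous version in `H` and initial value
`u₀`. -/
theorem NormalTriple.energy_le_of_continuousOn [CompleteSpace H] (S : NormalTriple V H) (hT : 0 < T)
    {f : ℝ → StrongDual ℝ V} {w : ℝ → V} {u : ℝ → H} {u₀ : H}
    (hf : MemLp f 2 (volume.restrict (Ioo 0 T))) (hw : MemLp w 2 (volume.restrict (Ioo 0 T)))
    (hu : ContinuousOn u (Icc 0 T)) (hwu : ∀ᵐ t ∂volume.restrict (Ioo 0 T), S.emb (w t) = u t)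
    (h : ∀ᵐ t ∂volume.restrict (Ioo 0 T),
      S.dualEmb (S.emb (w t)) = S.dualEmb u₀ + ∫ s in (0 : ℝ)..t, f s) :
    ∀ᵐ t ∂volume.restrict (Ioo 0 T),
      ‖S.emb (w t)‖ ^ 2 ≤ ‖u₀‖ ^ 2 + 2 * ∫ s in (0 : ℝ)..t, f s (w s) := by
  have hfi := hf.integrable one_le_two
  -- The continuous version attains the initial value.
  have hu0 : u 0 = u₀ := by
    refine S.dualEmb_injective ?_
    have h1 : (fun t => S.dualEmb (u t)) =ᵐ[volume.restrict (Icc 0 T)]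
        fun t => S.dualEmb u₀ + ∫ s in (0 : ℝ)..t, f s := by
      rw [← restrict_Ioo_eq_restrict_Icc]
      filter_upwards [h, hwu] with t h1 h2
      rw [← h1, h2]
    have h2 := Measure.eqOn_Icc_of_ae_eq volume hT.ne h1
      (S.dualEmbL.continuous.comp_continuousOn hu)
      (continuousOn_const.add (continuousOn_primitive_of_integrable hT.le hfi))
      (left_mem_Icc.2 hT.le)
    simpa using h2
  have hf1 : MemLp ((Ioo 0 T).indicator f) 2 volume :=
    memLp_indicator_Ioo hf
  have hw1 : MemLp ((Ioo 0 T).indicator w) 2 volume :=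
    memLp_indicator_Ioo hw
  have h1 : ∀ᵐ t, t ∈ Ioo 0 T →
      S.dualEmb (S.emb ((Ioo 0 T).indicator w t))
        = S.dualEmb u₀ + ∫ s in (0 : ℝ)..t, ((Ioo 0 T).indicator f) s := by
    filter_upwards [(ae_restrict_iff' measurableSet_Ioo).1 h] with t h2 ht
    have : (Ioo 0 T).indicator w t = w t := indicator_of_mem ht _
    rw [integral_indicator_Ioo_of_subset f le_rfl ht.1.le ht.2, this, h2 ht]
  obtain ⟨Z, hZ, hle⟩ := S.energy_le hf1 hw1 h1
  have hwu' := (ae_restrict_iff' measurableSet_Ioo).1 hwu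
  have hI := integrable_pairing hf hw
  have hd : Dense {t | t ∈ Z ∧ (t ∈ Ioo 0 T → S.emb (w t) = u t)} :=
    Measure.dense_of_ae (μ := volume) (by filter_upwards [hZ, hwu'] with t h1 h2 using ⟨h1, h2⟩)
  filter_upwards [ae_restrict_of_ae hZ, ae_restrict_mem measurableSet_Ioo] with t htZ ht
  have e1 : (Ioo 0 T).indicator w t = w t := indicator_of_mem ht _
  have e3 : (fun s => ((Ioo 0 T).indicator f) s (((Ioo 0 T).indicator w) s))
      = (Ioo 0 T).indicator (fun s => f s (w s)) := by
    funext s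
    by_cases hs : s ∈ Ioo 0 T <;> simp [hs]
  have hcont : ContinuousOn (fun a => ‖u a‖ ^ 2 + 2 * ∫ s in a..t, f s (w s)) (Icc 0 t) := by
    have c1 : ContinuousOn u (Icc 0 t) := hu.mono (Icc_subset_Icc_right ht.2.le)
    have c2 := intervalIntegral.continuousOn_primitive_interval'
      (intervalIntegrable_of_integrable hI (Ioo_subset_Icc_self ht)) right_mem_uIcc
    rw [uIcc_of_le ht.1.le] at c2
    simp_rw [intervalIntegral.integral_symm t]
    exact (c1.norm.pow 2).add (continuousOn_const.mul c2.neg)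
  have hall : ∀ a ∈ Z, (a ∈ Ioo 0 T → S.emb (w a) = u a) → a ∈ Ioo 0 t →
      ‖S.emb (w t)‖ ^ 2 ≤ ‖u a‖ ^ 2 + 2 * ∫ s in a..t, f s (w s) := by
    intro a haZ hau ha
    have haT : a ∈ Ioo 0 T := ⟨ha.1, ha.2.trans ht.2⟩
    have h2 := hle a haZ t htZ ha.1 ha.2 ht.2
    have e2 : ((Ioo 0 T).indicator w) a = w a := indicator_of_mem haT _
    rw [e1, e2, e3, integral_indicator_Ioo_of_subset _ ha.1.le ha.2.le ht.2, hau haT] at h2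
    linarith
  have hfr : (nhdsWithin (0 : ℝ)
      (Ioo 0 t ∩ {t | t ∈ Z ∧ (t ∈ Ioo 0 T → S.emb (w t) = u t)})).NeBot := by
    rw [← mem_closure_iff_nhdsWithin_neBot]
    refine closure_minimal (hd.open_subset_closure_inter isOpen_Ioo) isClosed_closure ?_
    rw [closure_Ioo ht.1.ne]
    exact left_mem_Icc.2 ht.1.le
  have hlim := (hcont 0 (left_mem_Icc.2 ht.1.le)).mono
    ((inter_subset_left (s := Ioo 0 t)
      (t := {t | t ∈ Z ∧ (t ∈ Ioo 0 T → S.emb (w t) = u t)})).trans Ioo_subset_Icc_self)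
  rw [← hu0]
  refine ge_of_tendsto hlim ?_
  filter_upwards [self_mem_nhdsWithin] with a ha
  exact hall a ha.2.1 ha.2.2 ha.1

end Energy

/-! ### The solution operator with zero initial value -/

section Solution

variable {V H : Type*} [NormedAddCommGroup V] [InnerProductSpace ℝ V]
  [NormedAddCommGroup H] [InnerProductSpace ℝ H] {T K c : ℝ}
  {A : ℝ → V →L[ℝ] StrongDual ℝ V}

/-- `w ∈ L₂((0,T); V)` solves `w' = A w + f`, `w(0) = 0`, in `V'`. -/
def IsSolution (S : NormalTriple V H) (T : ℝ) (A : ℝ → V →L[ℝ] StrongDual ℝ V)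
    (f : Lp H 2 (volume.restrict (Ioo 0 T))) (w : Lp V 2 (volume.restrict (Ioo 0 T))) : Prop :=
  ∀ᵐ t ∂volume.restrict (Ioo 0 T),
    S.dualEmb (S.emb (w t)) = ∫ s in (0 : ℝ)..t, (A s (w s) + S.dualEmb (f s))

theorem memLp_dualEmb (S : NormalTriple V H) {f : ℝ → H} {μ : Measure ℝ} (hf : MemLp f 2 μ) :
    MemLp (fun t => S.dualEmb (f t)) 2 μ :=
  S.dualEmbL.comp_memLp' hf

theorem memLp_emb (S : NormalTriple V H) (w : Lp V 2 (volume.restrict (Ioo 0 T))) :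
    MemLp (fun s => S.emb (w s)) 2 (volume.restrict (Ioo 0 T)) :=
  S.emb.comp_memLp' (Lp.memLp w)

theorem IsCoerciveFamily.memLp_rhs (S : NormalTriple V H) (hA : IsCoerciveFamily T A K c)
    (f : Lp H 2 (volume.restrict (Ioo 0 T))) (w : Lp V 2 (volume.restrict (Ioo 0 T))) :
    MemLp (fun s => A s (w s) + S.dualEmb (f s)) 2 (volume.restrict (Ioo 0 T)) :=
  (hA.toIsBddFamily.memLp (Lp.memLp w)).add (memLp_dualEmb S (Lp.memLp f))

theorem IsSolution.add {S : NormalTriple V H} (hA : IsCoerciveFamily T A K c)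
    {f f' : Lp H 2 (volume.restrict (Ioo 0 T))} {w w' : Lp V 2 (volume.restrict (Ioo 0 T))}
    (h : IsSolution S T A f w) (h' : IsSolution S T A f' w') :
    IsSolution S T A (f + f') (w + w') := by
  have e : ∀ (f : Lp H 2 (volume.restrict (Ioo 0 T))) (w : Lp V 2 (volume.restrict (Ioo 0 T))),
      Integrable (fun s => A s (w s) + S.dualEmb (f s)) (volume.restrict (Ioo 0 T)) :=
    fun f w => (hA.memLp_rhs S f w).integrable one_le_two
  filter_upwards [h, h', Lp.coeFn_add w w', ae_restrict_mem measurableSet_Ioo] with t h1 h2 h3 ht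
  have ht' := Ioo_subset_Icc_self ht
  rw [h3, Pi.add_apply, map_add, ← S.dualEmbL_apply, map_add, S.dualEmbL_apply, S.dualEmbL_apply,
    h1, h2, ← intervalIntegral.integral_add (intervalIntegrable_of_integrable (e _ _) ht')
    (intervalIntegrable_of_integrable (e _ _) ht')]
  refine intervalIntegral_congr_ae_Ioo ht' ?_
  filter_upwards [Lp.coeFn_add w w', Lp.coeFn_add f f'] with s h1 h2
  rw [h1, h2, Pi.add_apply, Pi.add_apply, map_add, ← S.dualEmbL_apply (_ + _), map_add,
    S.dualEmbL_apply, S.dualEmbL_apply]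
  abel

theorem IsSolution.smul {S : NormalTriple V H} (r : ℝ)
    {f : Lp H 2 (volume.restrict (Ioo 0 T))} {w : Lp V 2 (volume.restrict (Ioo 0 T))}
    (h : IsSolution S T A f w) : IsSolution S T A (r • f) (r • w) := by
  filter_upwards [h, Lp.coeFn_smul r w, ae_restrict_mem measurableSet_Ioo] with t h1 h3 ht
  have ht' := Ioo_subset_Icc_self ht
  rw [h3, Pi.smul_apply, map_smul, ← S.dualEmbL_apply, map_smul, S.dualEmbL_apply, h1,
    ← intervalIntegral.integral_smul]
  refine intervalIntegral_congr_ae_Ioo ht' ?_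
  filter_upwards [Lp.coeFn_smul r w, Lp.coeFn_smul r f] with s h1 h2
  rw [h1, h2, Pi.smul_apply, Pi.smul_apply, map_smul, ← S.dualEmbL_apply (_ • _), map_smul,
    S.dualEmbL_apply, smul_add]

/-- The energy inequality for the equation with the forcing term `f`. -/
theorem IsSolution.energy_le {S : NormalTriple V H} (hA : IsCoerciveFamily T A K c)
    {f : Lp H 2 (volume.restrict (Ioo 0 T))} {w : Lp V 2 (volume.restrict (Ioo 0 T))}
    (h : IsSolution S T A f w) : ∀ᵐ t ∂volume.restrict (Ioo 0 T),
      ‖S.emb (w t)‖ ^ 2 - 2 * ∫ s in (0 : ℝ)..t, A s (w s) (w s)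
        ≤ 2 * ∫ s in (0 : ℝ)..t, inner ℝ (f s) (S.emb (w s)) := by
  have h1 : MemLp (fun s => A s (w s)) 2 (volume.restrict (Ioo 0 T)) := hA.memLp (Lp.memLp w)
  have h12 := hA.memLp_rhs S f w
  filter_upwards [S.energy_le_of_zero h12 (Lp.memLp w) h,
    ae_restrict_mem measurableSet_Ioo] with t h3 ht
  have ht' := Ioo_subset_Icc_self ht
  simp_rw [add_apply, S.dualEmb_apply] at h3
  rw [intervalIntegral.integral_add
    (intervalIntegrable_of_integrable (integrable_pairing h1 (Lp.memLp w)) ht')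
    (intervalIntegrable_of_integrable
      (integrable_inner (Lp.memLp f) (memLp_emb S w)) ht')] at h3
  linarith

theorem IsCoerciveFamily.integral_le (hA : IsCoerciveFamily T A K c)
    (w : Lp V 2 (volume.restrict (Ioo 0 T))) {t : ℝ} (ht : t ∈ Icc 0 T) :
    c * ∫ s in (0 : ℝ)..t, ‖w s‖ ^ 2 ≤ - ∫ s in (0 : ℝ)..t, A s (w s) (w s) := by
  rw [← intervalIntegral.integral_neg, ← intervalIntegral.integral_const_mul]
  refine intervalIntegral_mono_ae_Ioo ht
    (integrableOn_Ioc_of_integrable ((integrable_norm_sq w).const_mul c) ht.2)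
    (integrableOn_Ioc_of_integrable
      (integrable_pairing (hA.memLp (Lp.memLp w)) (Lp.memLp w)).neg ht.2) ?_
  filter_upwards [hA.coercive] with s hs
  linarith [hs (w s)]

theorem IsCoerciveFamily.integral_nonpos (hA : IsCoerciveFamily T A K c)
    (w : Lp V 2 (volume.restrict (Ioo 0 T))) {t : ℝ} (ht : t ∈ Icc 0 T) :
    ∫ s in (0 : ℝ)..t, A s (w s) (w s) ≤ 0 := by
  have h1 := hA.integral_le w ht
  have h2 : 0 ≤ ∫ s in (0 : ℝ)..t, ‖w s‖ ^ 2 :=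
    intervalIntegral.integral_nonneg ht.1 fun _ _ => by positivity
  nlinarith [hA.pos]

/-- The energy of a solution is controlled by the `L₁((0,t); H)` norm of the forcing term, with
constant `1`. -/
theorem IsSolution.energy_le_sq {S : NormalTriple V H} (hA : IsCoerciveFamily T A K c)
    {f : Lp H 2 (volume.restrict (Ioo 0 T))} {w : Lp V 2 (volume.restrict (Ioo 0 T))}
    (h : IsSolution S T A f w) : ∀ᵐ t ∂volume.restrict (Ioo 0 T),
      ‖S.emb (w t)‖ ^ 2 - 2 * ∫ s in (0 : ℝ)..t, A s (w s) (w s)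
        ≤ (∫ s in (0 : ℝ)..t, ‖f s‖) ^ 2 := by
  have hιw := memLp_emb S w
  have hint := integrable_norm_mul_norm (Lp.memLp f) hιw
  have hle : ∀ᵐ t ∂volume.restrict (Ioo 0 T),
      ‖S.emb (w t)‖ ^ 2 - 2 * ∫ s in (0 : ℝ)..t, A s (w s) (w s)
        ≤ 2 * ∫ s in (0 : ℝ)..t, ‖f s‖ * ‖S.emb (w s)‖ := by
    filter_upwards [h.energy_le hA, ae_restrict_mem measurableSet_Ioo] with t h1 ht
    have ht' := Ioo_subset_Icc_self ht
    have : ∫ s in (0 : ℝ)..t, inner ℝ (f s) (S.emb (w s))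
        ≤ ∫ s in (0 : ℝ)..t, ‖f s‖ * ‖S.emb (w s)‖ :=
      intervalIntegral_mono_ae_Ioo ht'
        (integrableOn_Ioc_of_integrable (integrable_inner (Lp.memLp f) hιw) ht'.2)
        (integrableOn_Ioc_of_integrable hint ht'.2)
        (Filter.Eventually.of_forall fun s => real_inner_le_norm _ _)
    linarith
  filter_upwards [hle, ae_restrict_mem measurableSet_Ioo] with t h1 ht
  have ht' := Ioo_subset_Icc_self ht
  refine h1.trans (two_mul_integral_mul_le_sq
    (integrableOn_Ioc_of_memLp (Lp.memLp f) le_rfl).norm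
    (fun _ => norm_nonneg _) (fun _ => norm_nonneg _)
    (integrableOn_Ioc_of_integrable hint le_rfl) ?_ ht')
  filter_upwards [hle, ae_restrict_mem measurableSet_Ioo] with t h1 ht
  have := hA.integral_nonpos w (Ioo_subset_Icc_self ht)
  linarith

theorem IsSolution.integral_norm_sq_le {S : NormalTriple V H} (hT : 0 < T)
    (hA : IsCoerciveFamily T A K c)
    {f : Lp H 2 (volume.restrict (Ioo 0 T))} {w : Lp V 2 (volume.restrict (Ioo 0 T))}
    (h : IsSolution S T A f w) {t : ℝ} (ht : t ∈ Icc 0 T) :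
    2 * c * ∫ s in (0 : ℝ)..t, ‖w s‖ ^ 2 ≤ (∫ s in (0 : ℝ)..t, ‖f s‖) ^ 2 := by
  refine le_of_ae_le_of_continuousOn hT (f := fun t => 2 * c * ∫ s in (0 : ℝ)..t, ‖w s‖ ^ 2)
    (g := fun t => (∫ s in (0 : ℝ)..t, ‖f s‖) ^ 2)
    (continuousOn_const.mul (continuousOn_primitive_of_integrable hT.le (integrable_norm_sq w)))
    ((continuousOn_primitive_of_integrable hT.le
      ((Lp.memLp f).integrable one_le_two).norm).pow 2) ?_ ht
  filter_upwards [h.energy_le_sq hA, ae_restrict_mem measurableSet_Ioo] with t h1 ht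
  have := hA.integral_le w (Ioo_subset_Icc_self ht)
  have := sq_nonneg ‖S.emb (w t)‖
  linarith

/-- Solutions do not anticipate the forcing term. -/
theorem IsSolution.eq_zero_of_lt {S : NormalTriple V H} (hT : 0 < T)
    (hA : IsCoerciveFamily T A K c)
    {f : Lp H 2 (volume.restrict (Ioo 0 T))} {w : Lp V 2 (volume.restrict (Ioo 0 T))}
    (h : IsSolution S T A f w) {a : ℝ}
    (hf : ∀ᵐ t ∂volume.restrict (Ioo 0 T), t < a → f t = 0) :
    ∀ᵐ t ∂volume.restrict (Ioo 0 T), t < a → w t = 0 := by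
  rcases le_or_gt a 0 with ha | ha
  · filter_upwards [ae_restrict_mem measurableSet_Ioo] with t ht hta
    exact absurd ht.1 (not_lt.2 (hta.le.trans ha))
  set b := min a T
  have hb : b ∈ Icc 0 T := ⟨le_min ha.le hT.le, min_le_right _ _⟩
  have h1 := h.integral_norm_sq_le hT hA hb
  have h2 : ∫ s in (0 : ℝ)..b, ‖f s‖ = 0 := by
    rw [intervalIntegral.integral_of_le hb.1, integral_Ioc_eq_integral_Ioo]
    refine integral_eq_zero_of_ae ?_
    filter_upwards [ae_mono (Measure.restrict_mono (Ioo_subset_Ioo_right hb.2) le_rfl) hf,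
      ae_restrict_mem measurableSet_Ioo] with t h3 ht
    rw [h3 (ht.2.trans_le (min_le_left _ _)), norm_zero, Pi.zero_apply]
  have h3 : ∫ s in (0 : ℝ)..b, ‖w s‖ ^ 2 ≤ 0 := by
    rw [h2] at h1
    by_contra! h4
    have := mul_pos (mul_pos two_pos hA.pos) h4
    linarith
  rw [intervalIntegral.integral_of_le hb.1, integral_Ioc_eq_integral_Ioo] at h3
  have hi : IntegrableOn (fun s => ‖w s‖ ^ 2) (Ioo 0 b) :=
    (integrableOn_Ioc_of_integrable (integrable_norm_sq w) hb.2).mono_set Ioo_subset_Ioc_self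
  have h4 := (integral_eq_zero_iff_of_nonneg (fun s => sq_nonneg ‖w s‖) hi).1
    (h3.antisymm (integral_nonneg fun _ => by positivity))
  have h5 := (ae_restrict_iff' measurableSet_Ioo).1 h4
  filter_upwards [ae_restrict_of_ae h5, ae_restrict_mem measurableSet_Ioo] with t h6 ht hta
  have := h6 ⟨ht.1, lt_min hta ht.2⟩
  simpa using this

theorem IsSolution.unique {S : NormalTriple V H} (hT : 0 < T) (hA : IsCoerciveFamily T A K c)
    {f : Lp H 2 (volume.restrict (Ioo 0 T))} {w w' : Lp V 2 (volume.restrict (Ioo 0 T))}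
    (h : IsSolution S T A f w) (h' : IsSolution S T A f w') : w = w' := by
  have h1 := h.add hA (h'.smul (-1))
  have h2 : f + (-1 : ℝ) • f = 0 := by module
  rw [h2] at h1
  have h3 := h1.eq_zero_of_lt hT hA (a := T) (by
    filter_upwards [Lp.coeFn_zero H 2 (volume.restrict (Ioo 0 T))] with t ht _
    exact ht)
  have h4 : w + (-1 : ℝ) • w' = 0 := by
    refine Lp.ext ?_
    filter_upwards [h3, ae_restrict_mem measurableSet_Ioo,
      Lp.coeFn_zero V 2 (volume.restrict (Ioo 0 T))] with t h4 ht h5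
    rw [h4 ht.2, h5, Pi.zero_apply]
  rw [← sub_eq_zero, ← h4]
  module

variable [CompleteSpace V] [CompleteSpace H]

theorem exists_isSolution (S : NormalTriple V H) (hT : 0 < T) (hA : IsCoerciveFamily T A K c)
    (f : Lp H 2 (volume.restrict (Ioo 0 T))) : ∃ w, IsSolution S T A f w := by
  obtain ⟨w, hw⟩ := S.exists_solution hT.le hA (S.dualEmbL.compLpL 2 _ f)
  refine ⟨w, ?_⟩
  filter_upwards [hw, ae_restrict_mem measurableSet_Ioo] with t h1 ht
  rw [h1]
  refine intervalIntegral_congr_ae_Ioo (Ioo_subset_Icc_self ht) ?_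
  filter_upwards [S.dualEmbL.coeFn_compLpL f] with s hs
  rw [hs, S.dualEmbL_apply]

/-- The solution operator `f ↦ w` of `w' = A w + f`, `w(0) = 0`. -/
def solutionOp (S : NormalTriple V H) (hT : 0 < T) (hA : IsCoerciveFamily T A K c) :
    Lp H 2 (volume.restrict (Ioo 0 T)) →ₗ[ℝ] Lp V 2 (volume.restrict (Ioo 0 T)) where
  toFun f := (exists_isSolution S hT hA f).choose
  map_add' f f' := (exists_isSolution S hT hA _).choose_spec.unique hT hA
    ((exists_isSolution S hT hA f).choose_spec.add hA (exists_isSolution S hT hA f').choose_spec)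
  map_smul' r f := (exists_isSolution S hT hA _).choose_spec.unique hT hA
    ((exists_isSolution S hT hA f).choose_spec.smul r)

theorem isSolution_solutionOp (S : NormalTriple V H) (hT : 0 < T) (hA : IsCoerciveFamily T A K c)
    (f : Lp H 2 (volume.restrict (Ioo 0 T))) : IsSolution S T A f (solutionOp S hT hA f) :=
  (exists_isSolution S hT hA f).choose_spec

theorem IsSolution.eq_solutionOp {S : NormalTriple V H} (hT : 0 < T)
    (hA : IsCoerciveFamily T A K c) {f : Lp H 2 (volume.restrict (Ioo 0 T))}
    {w : Lp V 2 (volume.restrict (Ioo 0 T))} (h : IsSolution S T A f w) :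
    w = solutionOp S hT hA f :=
  h.unique hT hA (isSolution_solutionOp S hT hA f)

end Solution

/-! ### Orthonormal step functions and the Itô bound for one time interval -/

section Cells

variable {T : ℝ}

/-- The Cauchy-Schwarz inequality for integrals of real functions. -/
theorem sq_integral_mul_le {Ω : Type*} [MeasurableSpace Ω] {μ : Measure Ω} {f g : Ω → ℝ}
    (hf : MemLp f 2 μ) (hg : MemLp g 2 μ) :
    (∫ t, f t * g t ∂μ) ^ 2 ≤ (∫ t, f t ^ 2 ∂μ) * ∫ t, g t ^ 2 ∂μ := by
  have h1 : ∫ t, f t * g t ∂μ = inner ℝ hf.toLp hg.toLp := by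
    rw [L2.inner_def]
    refine integral_congr_ae ?_
    filter_upwards [hf.coeFn_toLp, hg.coeFn_toLp] with t h1 h2
    rw [h1, h2]
    simp [mul_comm]
  have h2 : ∀ {f : Ω → ℝ} (hf : MemLp f 2 μ), ∫ t, f t ^ 2 ∂μ = ‖hf.toLp‖ ^ 2 := by
    intro f hf
    rw [norm_sq_eq_integral]
    refine integral_congr_ae ?_
    filter_upwards [hf.coeFn_toLp] with t h1
    rw [h1]
    simp
  rw [h1, h2 hf, h2 hg, ← mul_pow, ← sq_abs]
  exact pow_le_pow_left₀ (abs_nonneg _) (abs_real_inner_le_norm _ _) 2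

/-- The `J`-th cell of the partition of the half line into intervals of length `h`. -/
def cell (h : ℝ) (J : ℕ) : Set ℝ := Ico (J * h) ((J + 1) * h)

theorem measurableSet_cell (h : ℝ) (J : ℕ) : MeasurableSet (cell h J) := measurableSet_Ico

theorem eq_of_mem_cell {h : ℝ} (hh : 0 < h) {J J' : ℕ} {t : ℝ} (h1 : t ∈ cell h J)
    (h2 : t ∈ cell h J') : J = J' := by
  have key : ∀ {J J' : ℕ}, t ∈ cell h J → t ∈ cell h J' → J ≤ J' := by
    intro J J' h1 h2
    have : (J : ℝ) < J' + 1 := lt_of_mul_lt_mul_right (h1.1.trans_lt h2.2) hh.le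
    exact_mod_cast Nat.lt_succ_iff.1 (by exact_mod_cast this)
  exact le_antisymm (key h1 h2) (key h2 h1)

theorem sum_indicator_cell_le {h : ℝ} (hh : 0 < h) (N : ℕ) {r : ℝ} (hr : 0 ≤ r) (t : ℝ) :
    ∑ J ∈ Finset.range N, (cell h J).indicator (fun _ => r) t ≤ r := by
  by_cases hex : ∃ J ∈ Finset.range N, t ∈ cell h J
  · obtain ⟨J, hJ, ht⟩ := hex
    rw [Finset.sum_eq_single_of_mem J hJ]
    · rw [indicator_of_mem ht]
    · intro J' _ hne
      exact indicator_of_notMem (fun h' => hne (eq_of_mem_cell hh h' ht)) _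
  · push Not at hex
    rw [Finset.sum_eq_zero fun J hJ => indicator_of_notMem (hex J hJ) _]
    exact hr

/-- The indicator function of a cell, as an essentially bounded function. -/
def cellInd (T h : ℝ) (J : ℕ) : Lp ℝ ∞ (volume.restrict (Ioo 0 T)) :=
  indicatorConstLp ∞ (measurableSet_cell h J) (measure_ne_top _ _) 1

theorem coeFn_cellInd (T h : ℝ) (J : ℕ) :
    cellInd T h J =ᵐ[volume.restrict (Ioo 0 T)] (cell h J).indicator fun _ => 1 :=
  indicatorConstLp_coeFn

/-- The indicator function of a cell, normalized in `L₂`. -/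
def bump (T h : ℝ) (J : ℕ) : Lp ℝ ∞ (volume.restrict (Ioo 0 T)) := (√h)⁻¹ • cellInd T h J

theorem coeFn_bump (T h : ℝ) (J : ℕ) :
    bump T h J =ᵐ[volume.restrict (Ioo 0 T)] (cell h J).indicator fun _ => (√h)⁻¹ := by
  filter_upwards [Lp.coeFn_smul (√h)⁻¹ (cellInd T h J), coeFn_cellInd T h J] with t h1 h2
  rw [bump, h1, Pi.smul_apply, h2]
  by_cases ht : t ∈ cell h J <;> simp [ht]

theorem integral_indicator_cell_sq_le {h : ℝ} (hh : 0 < h) (J : ℕ) {μ : Measure ℝ}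
    (hμ : μ ≤ volume) : ∫ s, ((cell h J).indicator (fun _ => (√h)⁻¹) s) ^ 2 ∂μ ≤ 1 := by
  have e : (fun s => ((cell h J).indicator (fun _ => (√h)⁻¹) s) ^ 2)
      = (cell h J).indicator fun _ => h⁻¹ := by
    funext s
    by_cases hs : s ∈ cell h J
    · simp [hs, Real.sq_sqrt hh.le]
    · simp [hs]
  have hv : volume (cell h J) = ENNReal.ofReal h := by
    rw [cell, Real.volume_Ico]; ring_nf
  have h1 : μ.real (cell h J) ≤ h := by
    refine ENNReal.toReal_le_of_le_ofReal hh.le ?_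
    exact (hμ _).trans hv.le
  rw [e, integral_indicator_const _ (measurableSet_cell h J), smul_eq_mul]
  calc μ.real (cell h J) * h⁻¹ ≤ h * h⁻¹ := by gcongr
    _ = 1 := mul_inv_cancel₀ hh.ne'

variable {V H : Type*} [NormedAddCommGroup V] [InnerProductSpace ℝ V]
  [NormedAddCommGroup H] [InnerProductSpace ℝ H] {K c : ℝ}
  {A : ℝ → V →L[ℝ] StrongDual ℝ V}

/-- The energy of `w` at time `t`: the squared norm in `H` plus the dissipation up to time `t`. -/
def energy (S : NormalTriple V H) (T : ℝ) (A : ℝ → V →L[ℝ] StrongDual ℝ V)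
    (w : Lp V 2 (volume.restrict (Ioo 0 T))) (t : ℝ) : ℝ :=
  ‖S.emb (w t)‖ ^ 2 - 2 * ∫ s in (0 : ℝ)..t, A s (w s) (w s)

theorem sq_norm_emb_le_energy (S : NormalTriple V H) (hA : IsCoerciveFamily T A K c)
    (w : Lp V 2 (volume.restrict (Ioo 0 T))) {t : ℝ} (ht : t ∈ Icc 0 T) :
    ‖S.emb (w t)‖ ^ 2 ≤ energy S T A w t := by
  have := hA.integral_nonpos w ht
  rw [energy]
  linarith

theorem energy_zero (S : NormalTriple V H) :
    ∀ᵐ t ∂volume.restrict (Ioo 0 T), energy S T A 0 t = 0 := by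
  have h0 := Lp.coeFn_zero V 2 (volume.restrict (Ioo 0 T))
  filter_upwards [h0, ae_restrict_mem measurableSet_Ioo] with t h1 ht
  have : ∫ s in (0 : ℝ)..t, A s ((0 : Lp V 2 (volume.restrict (Ioo 0 T))) s)
      ((0 : Lp V 2 (volume.restrict (Ioo 0 T))) s) = ∫ s in (0 : ℝ)..t, (0 : ℝ) := by
    refine intervalIntegral_congr_ae_Ioo (Ioo_subset_Icc_self ht) ?_
    filter_upwards [h0] with s hs
    rw [hs, Pi.zero_apply, map_zero]
  rw [energy, this, h1]
  simp

variable [CompleteSpace V] [CompleteSpace H]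

/-- The Itô bound for one time variable: for an arbitrary `g`, the solutions that are driven by `g`
times the normalized cell indicators have total energy at most `∫_0^t ‖g‖²`. On each cell this is
the energy estimate with the `L₁` norm of the forcing term, followed by the Cauchy-Schwarz
inequality; both have constant `1`. -/
theorem sum_energy_bump_le (S : NormalTriple V H) (hT : 0 < T) (hA : IsCoerciveFamily T A K c)
    {h : ℝ} (hh : 0 < h) (N : ℕ) (g : Lp H 2 (volume.restrict (Ioo 0 T))) :
    ∀ᵐ t ∂volume.restrict (Ioo 0 T),
      ∑ J ∈ Finset.range N, energy S T A (solutionOp S hT hA (mulOp (bump T h J) g)) t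
        ≤ ∫ s in (0 : ℝ)..t, ‖g s‖ ^ 2 := by
  have h1 : ∀ᵐ t ∂volume.restrict (Ioo 0 T), ∀ J : ℕ,
      energy S T A (solutionOp S hT hA (mulOp (bump T h J) g)) t
        ≤ (∫ s in (0 : ℝ)..t, ‖mulOp (bump T h J) g s‖) ^ 2 :=
    ae_all_iff.2 fun J => (isSolution_solutionOp S hT hA (mulOp (bump T h J) g)).energy_le_sq hA
  filter_upwards [h1, ae_restrict_mem measurableSet_Ioo] with t h1 ht
  have ht' := Ioo_subset_Icc_self ht
  have hg : MemLp (fun s => ‖g s‖) 2 (volume.restrict (Ioc 0 t)) := by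
    refine (memLp_two_iff_integrable_sq_norm ?_).2 ?_
    · exact (integrableOn_Ioc_of_memLp (Lp.memLp g) ht'.2).1.norm
    · simp_rw [norm_norm]
      exact integrableOn_Ioc_of_integrable (integrable_norm_sq g) ht'.2
  have hi : ∀ J, IntegrableOn (fun s => ((cell h J).indicator (fun s => ‖g s‖) s) ^ 2) (Ioc 0 t) :=
    fun J => (hg.indicator (measurableSet_cell h J)).integrable_sq
  have h2 : ∀ J, (∫ s in (0 : ℝ)..t, ‖mulOp (bump T h J) g s‖) ^ 2
      ≤ ∫ s in (0 : ℝ)..t, ((cell h J).indicator (fun s => ‖g s‖) s) ^ 2 := by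
    intro J
    have e : ∫ s in (0 : ℝ)..t, ‖mulOp (bump T h J) g s‖ = ∫ s in (0 : ℝ)..t,
        (cell h J).indicator (fun _ => (√h)⁻¹) s * (cell h J).indicator (fun s => ‖g s‖) s := by
      refine intervalIntegral_congr_ae_Ioo ht' ?_
      filter_upwards [coeFn_mulOp (bump T h J) g, coeFn_bump T h J] with s h3 h4
      rw [h3, h4, norm_smul]
      by_cases hs : s ∈ cell h J <;> simp [hs]
    have hm : MemLp ((cell h J).indicator fun _ => (√h)⁻¹) 2 (volume.restrict (Ioc 0 t)) :=
      (memLp_const _).indicator (measurableSet_cell h J)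
    rw [e, intervalIntegral.integral_of_le ht'.1, intervalIntegral.integral_of_le ht'.1]
    refine (sq_integral_mul_le hm (hg.indicator (measurableSet_cell h J))).trans ?_
    refine mul_le_of_le_one_left (integral_nonneg fun _ => sq_nonneg _) ?_
    exact integral_indicator_cell_sq_le hh J Measure.restrict_le_self
  refine (Finset.sum_le_sum fun J _ => (h1 J).trans (h2 J)).trans ?_
  rw [← intervalIntegral.integral_finsetSum fun J _ =>
    (intervalIntegrable_iff_integrableOn_Ioc_of_le ht'.1).2 (hi J)]
  refine intervalIntegral_mono_ae_Ioo ht' (integrable_finsetSum _ fun J _ => hi J)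
    (integrableOn_Ioc_of_integrable (integrable_norm_sq g) ht'.2)
    (Filter.Eventually.of_forall fun s => ?_)
  refine le_trans (le_of_eq (Finset.sum_congr rfl fun J _ => ?_))
    (sum_indicator_cell_le hh N (sq_nonneg ‖g s‖) s)
  by_cases hs : s ∈ cell h J <;> simp [hs]

end Cells

/-! ### The discretized chaos expansion -/

/-- Summation over sequences, with the entry at position `l` separated. -/
theorem sum_piFinset_succAbove {P M : Type*} [AddCommMonoid M] {n : ℕ}
    (l : Fin (n + 1)) (Q : Finset P) (F : P → (Fin n → P) → M) :
    ∑ q ∈ Fintype.piFinset (fun _ : Fin (n + 1) => Q), F (q l) (fun i => q (l.succAbove i))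
      = ∑ p ∈ Q, ∑ q ∈ Fintype.piFinset (fun _ : Fin n => Q), F p q := by
  rw [← Finset.sum_product']
  refine Finset.sum_equiv (Fin.insertNthEquiv (fun _ => P) l).symm ?_ ?_
  · intro q
    simp only [Fintype.mem_piFinset, Finset.mem_product, Fin.insertNthEquiv_symm_apply]
    exact Fin.forall_iff_succAbove l
  · intro q _
    rfl

section

variable {V H : Type*} [NormedAddCommGroup V] [InnerProductSpace ℝ V]
  [NormedAddCommGroup H] [InnerProductSpace ℝ H] {T K c : ℝ} {A : ℝ → V →L[ℝ] StrongDual ℝ V}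

/-- The chaos coefficients with respect to the normalized cell indicators, with at most one noise
per cell. For `q = ((J₁,k₁), …, (Jₙ,kₙ))` the value is zero unless the cells are distinct; then it
is the iterated solution in which the noises act in the order of the cells. The recursion removes
the entry whose cell is the last one, if there is such an entry. -/
def cellChaos (R : Lp H 2 (volume.restrict (Ioo 0 T)) →ₗ[ℝ] Lp V 2 (volume.restrict (Ioo 0 T)))
    (B : ℕ → Lp V 2 (volume.restrict (Ioo 0 T)) →L[ℝ] Lp H 2 (volume.restrict (Ioo 0 T)))
    (h : ℝ) (v₀ : Lp V 2 (volume.restrict (Ioo 0 T))) :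
    (n : ℕ) → (Fin n → ℕ × ℕ) → Lp V 2 (volume.restrict (Ioo 0 T))
  | 0, _ => v₀
  | n + 1, q => R (∑ l : Fin (n + 1),
      if ∀ i : Fin n, (q (l.succAbove i)).1 < (q l).1 then
        mulOp (bump T h (q l).1) (B (q l).2 (cellChaos R B h v₀ n fun i => q (l.succAbove i)))
      else 0)

variable [CompleteSpace V] [CompleteSpace H]

/-- The Itô bound: the total energy of the coefficients of order `n + 1` is at most the integral of
`∑_k ‖M_k ·‖²` over the coefficients of order `n`. -/
theorem sum_energy_cellChaos_succ_le (S : NormalTriple V H) (hT : 0 < T)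
    (hA : IsCoerciveFamily T A K c)
    (B : ℕ → Lp V 2 (volume.restrict (Ioo 0 T)) →L[ℝ] Lp H 2 (volume.restrict (Ioo 0 T)))
    {h : ℝ} (hh : 0 < h) (v₀ : Lp V 2 (volume.restrict (Ioo 0 T))) (N L n : ℕ) :
    ∀ᵐ t ∂volume.restrict (Ioo 0 T),
      (∑ q ∈ Fintype.piFinset fun _ : Fin (n + 1) => Finset.range N ×ˢ Finset.range L,
        energy S T A (cellChaos (solutionOp S hT hA) B h v₀ (n + 1) q) t) ≤
      (n + 1) * ∑ q ∈ Fintype.piFinset fun _ : Fin n => Finset.range N ×ˢ Finset.range L,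
        ∑ k ∈ Finset.range L, ∫ s in (0 : ℝ)..t,
          ‖B k (cellChaos (solutionOp S hT hA) B h v₀ n q) s‖ ^ 2 := by
  set R := solutionOp S hT hA
  have h1 : ∀ᵐ t ∂volume.restrict (Ioo 0 T), ∀ (q : Fin n → ℕ × ℕ) (k : ℕ),
      ∑ J ∈ Finset.range N, energy S T A (R (mulOp (bump T h J) (B k (cellChaos R B h v₀ n q)))) t
        ≤ ∫ s in (0 : ℝ)..t, ‖B k (cellChaos R B h v₀ n q) s‖ ^ 2 :=
    ae_all_iff.2 fun q => ae_all_iff.2 fun k => sum_energy_bump_le S hT hA hh N _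
  filter_upwards [h1, energy_zero S (T := T) (A := A), ae_restrict_mem measurableSet_Ioo]
    with t h1 h0 ht
  have hnn : ∀ w, 0 ≤ energy S T A w t := fun w =>
    (sq_nonneg _).trans (sq_norm_emb_le_energy S hA w (Ioo_subset_Icc_self ht))
  -- At most one entry of `q` belongs to the last cell.
  have h2 : ∀ q : Fin (n + 1) → ℕ × ℕ, energy S T A (cellChaos R B h v₀ (n + 1) q) t
      ≤ ∑ l : Fin (n + 1), energy S T A (R (mulOp (bump T h (q l).1)
          (B (q l).2 (cellChaos R B h v₀ n fun i => q (l.succAbove i))))) t := by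
    intro q
    rw [cellChaos]
    by_cases hex : ∃ l : Fin (n + 1), ∀ i : Fin n, (q (l.succAbove i)).1 < (q l).1
    · obtain ⟨l, hl⟩ := hex
      rw [Finset.sum_eq_single l, if_pos hl]
      · exact Finset.single_le_sum (f := fun l : Fin (n + 1) => energy S T A
          (R (mulOp (bump T h (q l).1)
            (B (q l).2 (cellChaos R B h v₀ n fun i => q (l.succAbove i))))) t)
          (fun l _ => hnn _) (Finset.mem_univ l)
      · intro l' _ hne
        refine if_neg fun hl' => ?_
        obtain ⟨i, hi⟩ := Fin.exists_succAbove_eq hne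
        obtain ⟨i', hi'⟩ := Fin.exists_succAbove_eq hne.symm
        have e1 := hl i
        have e2 := hl' i'
        rw [hi] at e1
        rw [hi'] at e2
        exact absurd e1 (not_lt.2 e2.le)
      · intro h'
        exact absurd (Finset.mem_univ l) h'
    · push Not at hex
      rw [Finset.sum_eq_zero, map_zero, h0]
      · exact Finset.sum_nonneg fun l _ => hnn _
      · intro l _
        refine if_neg fun hl => ?_
        obtain ⟨i, hi⟩ := hex l
        exact absurd (hl i) (not_lt.2 hi)
  refine (Finset.sum_le_sum fun q _ => h2 q).trans ?_
  rw [Finset.sum_comm]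
  have h3 : ∀ l : Fin (n + 1),
      ∑ q ∈ Fintype.piFinset fun _ : Fin (n + 1) => Finset.range N ×ˢ Finset.range L,
        energy S T A (R (mulOp (bump T h (q l).1)
          (B (q l).2 (cellChaos R B h v₀ n fun i => q (l.succAbove i))))) t
      ≤ ∑ q ∈ Fintype.piFinset fun _ : Fin n => Finset.range N ×ˢ Finset.range L,
        ∑ k ∈ Finset.range L, ∫ s in (0 : ℝ)..t, ‖B k (cellChaos R B h v₀ n q) s‖ ^ 2 := by
    intro l
    rw [sum_piFinset_succAbove l _ (fun p q => energy S T A (R (mulOp (bump T h p.1)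
          (B p.2 (cellChaos R B h v₀ n q)))) t), Finset.sum_comm]
    refine Finset.sum_le_sum fun q _ => ?_
    rw [Finset.sum_product_right]
    exact Finset.sum_le_sum fun k _ => h1 q k
  refine (Finset.sum_le_sum fun l _ => h3 l).trans (le_of_eq ?_)
  rw [Finset.sum_const, Finset.card_univ, Fintype.card_fin, nsmul_eq_mul]
  push_cast
  rfl

/-- The geometric bound for the discretized chaos expansion: the dissipation exceeds
`(1 + b) ∑_k ‖M_k ·‖²`. -/
theorem sum_cellChaos_le_geometric (S : NormalTriple V H) (hT : 0 < T)
    (hA : IsCoerciveFamily T A K c) {M : ℕ → ℝ → V →L[ℝ] H} {C : ℝ}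
    (hM : ∀ k, IsBddFamily (volume.restrict (Ioo 0 T)) (M k) C)
    {h : ℝ} (hh : 0 < h) {v₀ : Lp V 2 (volume.restrict (Ioo 0 T))} {u₀ : H}
    (h0 : ∀ᵐ t ∂volume.restrict (Ioo 0 T), energy S T A v₀ t ≤ ‖u₀‖ ^ 2) (N L : ℕ)
    {b : ℝ} (hb : 0 < b) (hpar : ∀ᵐ t ∂volume.restrict (Ioo 0 T), ∀ v,
      2 * A t v v + (1 + b) * ∑ k ∈ Finset.range L, ‖M k t v‖ ^ 2 ≤ 0) (n : ℕ) :
    ∀ᵐ t ∂volume.restrict (Ioo 0 T),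
      ∑ q ∈ Fintype.piFinset fun _ : Fin n => Finset.range N ×ˢ Finset.range L,
        energy S T A (cellChaos (solutionOp S hT hA) (fun k => (hM k).op) h v₀ n q) t
      ≤ n.factorial * (‖u₀‖ ^ 2 / (1 + b) ^ n) := by
  induction n with
  | zero =>
    filter_upwards [h0] with t ht
    simpa [cellChaos] using ht
  | succ n ih =>
    filter_upwards [ih, sum_energy_cellChaos_succ_le S hT hA (fun k => (hM k).op) hh v₀ N L n,
      ae_restrict_mem measurableSet_Ioo] with t h1 h2 ht
    have ht' := Ioo_subset_Icc_self ht
    refine h2.trans ?_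
    have h3 : ∀ w : Lp V 2 (volume.restrict (Ioo 0 T)),
        (1 + b) * ∑ k ∈ Finset.range L, ∫ s in (0 : ℝ)..t, ‖(hM k).op w s‖ ^ 2
          ≤ energy S T A w t := by
      intro w
      have e1 : (1 + b) * ∑ k ∈ Finset.range L, ∫ s in (0 : ℝ)..t, ‖(hM k).op w s‖ ^ 2
          = ∫ s in (0 : ℝ)..t, (1 + b) * ∑ k ∈ Finset.range L, ‖(hM k).op w s‖ ^ 2 := by
        rw [intervalIntegral.integral_const_mul, intervalIntegral.integral_finsetSum]
        exact fun k _ => intervalIntegrable_of_integrable (integrable_norm_sq _) ht'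
      have e2 : ∫ s in (0 : ℝ)..t, (1 + b) * ∑ k ∈ Finset.range L, ‖(hM k).op w s‖ ^ 2
          ≤ ∫ s in (0 : ℝ)..t, -2 * A s (w s) (w s) := by
        refine intervalIntegral_mono_ae_Ioo ht'
          (integrableOn_Ioc_of_integrable ((integrable_finsetSum _ fun k _ =>
            integrable_norm_sq ((hM k).op w)).const_mul _) ht'.2)
          (integrableOn_Ioc_of_integrable ((integrable_pairing
            (hA.toIsBddFamily.memLp (Lp.memLp w)) (Lp.memLp w)).const_mul _) ht'.2) ?_
        filter_upwards [hpar, ae_all_iff.2 fun k => (hM k).coeFn_op w] with s h4 h5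
        simp_rw [h5]
        linarith [h4 (w s)]
      rw [intervalIntegral.integral_const_mul (-2 : ℝ)] at e2
      rw [e1, energy]
      have := sq_nonneg ‖S.emb (w t)‖
      linarith
    have h4 : (1 + b) * ∑ q ∈ Fintype.piFinset fun _ : Fin n => Finset.range N ×ˢ Finset.range L,
        ∑ k ∈ Finset.range L, ∫ s in (0 : ℝ)..t,
          ‖(hM k).op (cellChaos (solutionOp S hT hA) (fun k => (hM k).op) h v₀ n q) s‖ ^ 2
        ≤ n.factorial * (‖u₀‖ ^ 2 / (1 + b) ^ n) := by
      rw [Finset.mul_sum]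
      exact (Finset.sum_le_sum fun q _ => h3 _).trans h1
    have h5 : (0 : ℝ) < 1 + b := by linarith
    rw [← le_div_iff₀' h5] at h4
    calc _ ≤ (n + 1 : ℝ) * (n.factorial * (‖u₀‖ ^ 2 / (1 + b) ^ n) / (1 + b)) := by gcongr
      _ = _ := by rw [Nat.factorial_succ, pow_succ]; push_cast; field_simp; ring

/-- The factorial bound for the discretized chaos expansion. -/
theorem sum_cellChaos_le_factorial (S : NormalTriple V H) (hT : 0 < T)
    (hA : IsCoerciveFamily T A K c) {M : ℕ → ℝ → V →L[ℝ] H} {C : ℝ}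
    (hM : ∀ k, IsBddFamily (volume.restrict (Ioo 0 T)) (M k) C)
    {h : ℝ} (hh : 0 < h) {v₀ : Lp V 2 (volume.restrict (Ioo 0 T))} {u₀ : H}
    (h0 : ∀ᵐ t ∂volume.restrict (Ioo 0 T), energy S T A v₀ t ≤ ‖u₀‖ ^ 2) (N L : ℕ)
    {C₃ : ℝ} (hC₃ : 0 ≤ C₃) (hM' : ∀ᵐ t ∂volume.restrict (Ioo 0 T), ∀ v,
      ∑ k ∈ Finset.range L, ‖M k t v‖ ^ 2 ≤ C₃ * ‖S.emb v‖ ^ 2) (n : ℕ) :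
    ∀ᵐ t ∂volume.restrict (Ioo 0 T),
      ∑ q ∈ Fintype.piFinset fun _ : Fin n => Finset.range N ×ˢ Finset.range L,
        energy S T A (cellChaos (solutionOp S hT hA) (fun k => (hM k).op) h v₀ n q) t
      ≤ (C₃ * t) ^ n * ‖u₀‖ ^ 2 := by
  induction n with
  | zero =>
    filter_upwards [h0] with t ht
    simpa [cellChaos] using ht
  | succ n ih =>
    filter_upwards [sum_energy_cellChaos_succ_le S hT hA (fun k => (hM k).op) hh v₀ N L n,
      ae_restrict_mem measurableSet_Ioo] with t h2 ht
    have ht' := Ioo_subset_Icc_self ht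
    refine h2.trans ?_
    set X := cellChaos (solutionOp S hT hA) (fun k => (hM k).op) h v₀ n
    have e1 : ∑ q ∈ Fintype.piFinset fun _ : Fin n => Finset.range N ×ˢ Finset.range L,
        ∑ k ∈ Finset.range L, ∫ s in (0 : ℝ)..t, ‖(hM k).op (X q) s‖ ^ 2
        = ∫ s in (0 : ℝ)..t,
          ∑ q ∈ Fintype.piFinset fun _ : Fin n => Finset.range N ×ˢ Finset.range L,
            ∑ k ∈ Finset.range L, ‖(hM k).op (X q) s‖ ^ 2 := by
      rw [intervalIntegral.integral_finsetSum]
      · refine Finset.sum_congr rfl fun q _ => (intervalIntegral.integral_finsetSum ?_).symm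
        exact fun k _ => intervalIntegrable_of_integrable (integrable_norm_sq _) ht'
      · exact fun q _ => intervalIntegrable_of_integrable
          (integrable_finsetSum _ fun k _ => integrable_norm_sq _) ht'
    have e2 : ∫ s in (0 : ℝ)..t,
          ∑ q ∈ Fintype.piFinset fun _ : Fin n => Finset.range N ×ˢ Finset.range L,
            ∑ k ∈ Finset.range L, ‖(hM k).op (X q) s‖ ^ 2
        ≤ ∫ s in (0 : ℝ)..t, C₃ ^ (n + 1) * ‖u₀‖ ^ 2 * s ^ n := by
      refine intervalIntegral_mono_ae_Ioo ht'
        (integrableOn_Ioc_of_integrable (integrable_finsetSum _ fun q _ =>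
          integrable_finsetSum _ fun k _ => integrable_norm_sq _) ht'.2)
        ((by fun_prop : Continuous fun s : ℝ => C₃ ^ (n + 1) * ‖u₀‖ ^ 2 * s ^ n).integrableOn_Ioc)
        ?_
      filter_upwards [ih, hM', ae_restrict_mem measurableSet_Ioo,
        ae_all_iff.2 fun q => ae_all_iff.2 fun k => (hM k).coeFn_op (X q)] with s h3 h4 hs h5
      simp_rw [h5]
      calc _ ≤ ∑ q ∈ Fintype.piFinset fun _ : Fin n => Finset.range N ×ˢ Finset.range L,
            C₃ * energy S T A (X q) s := by
            refine Finset.sum_le_sum fun q _ => (h4 _).trans ?_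
            exact mul_le_mul_of_nonneg_left
              (sq_norm_emb_le_energy S hA _ (Ioo_subset_Icc_self hs)) hC₃
        _ ≤ C₃ * ((C₃ * s) ^ n * ‖u₀‖ ^ 2) := by
            rw [← Finset.mul_sum]
            exact mul_le_mul_of_nonneg_left h3 hC₃
        _ = _ := by ring
    rw [intervalIntegral.integral_const_mul, integral_pow] at e2
    rw [e1]
    calc _ ≤ (n + 1 : ℝ) * (C₃ ^ (n + 1) * ‖u₀‖ ^ 2 * ((t ^ (n + 1) - 0 ^ (n + 1)) / (n + 1))) := by
          gcongr
      _ = _ := by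
          rw [zero_pow (Nat.succ_ne_zero n), sub_zero, mul_pow]
          field_simp

end

/-! ### Contractions and their tensor powers -/

section Contraction

variable {P Q : Type*}

/-- A real contraction matrix acts as a contraction on vectors with entries in an inner product
space. -/
theorem sum_norm_sq_le_of_contraction {E : Type*} [NormedAddCommGroup E] [InnerProductSpace ℝ E]
    {I : Finset P} {J : Finset Q} {C : P → Q → ℝ}
    (hC : ∀ x : Q → ℝ, ∑ p ∈ I, (∑ q ∈ J, C p q * x q) ^ 2 ≤ ∑ q ∈ J, x q ^ 2) (x : Q → E) :
    ∑ p ∈ I, ‖∑ q ∈ J, C p q • x q‖ ^ 2 ≤ ∑ q ∈ J, ‖x q‖ ^ 2 := by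
  classical
  -- Expand in an orthonormal basis of the span of the entries.
  set W : Submodule ℝ E := Submodule.span ℝ (J.image x : Set E)
  have hx : ∀ q ∈ J, x q ∈ W := fun q hq =>
    Submodule.subset_span (Finset.mem_coe.2 (Finset.mem_image_of_mem x hq))
  set y : Q → W := fun q => if hq : q ∈ J then ⟨x q, hx q hq⟩ else 0
  have hy : ∀ q ∈ J, ((y q : W) : E) = x q := fun q hq => by simp [y, hq]
  have : FiniteDimensional ℝ W := FiniteDimensional.span_finset ℝ _
  set e := stdOrthonormalBasis ℝ W
  have key : ∀ z : W, ‖z‖ ^ 2 = ∑ i, (inner ℝ (e i) z) ^ 2 := fun z => by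
    rw [← e.sum_sq_norm_inner_right z]
    simp
  have e1 : ∀ p, ‖∑ q ∈ J, C p q • x q‖ ^ 2 = ∑ i, (∑ q ∈ J, C p q * inner ℝ (e i) (y q)) ^ 2 := by
    intro p
    have : ∑ q ∈ J, C p q • x q = ((∑ q ∈ J, C p q • y q : W) : E) := by
      push_cast
      exact Finset.sum_congr rfl fun q hq => by rw [hy q hq]
    rw [this, ← Submodule.coe_norm, key]
    simp_rw [inner_sum, real_inner_smul_right]
  have e2 : ∀ q ∈ J, ‖x q‖ ^ 2 = ∑ i, (inner ℝ (e i) (y q)) ^ 2 := fun q hq => by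
    rw [← hy q hq, ← Submodule.coe_norm, key]
  simp_rw [e1]
  rw [Finset.sum_congr rfl e2, Finset.sum_comm, Finset.sum_comm (s := J)]
  exact Finset.sum_le_sum fun i _ => hC _

/-- The tensor powers of a contraction matrix are contractions. -/
theorem sum_norm_sq_prod_le_of_contraction {E : Type*} [NormedAddCommGroup E]
    [InnerProductSpace ℝ E] {I : Finset P} {J : Finset Q} {C : P → Q → ℝ}
    (hC : ∀ x : Q → ℝ, ∑ p ∈ I, (∑ q ∈ J, C p q * x q) ^ 2 ≤ ∑ q ∈ J, x q ^ 2)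
    (n : ℕ) (x : (Fin n → Q) → E) :
    ∑ p ∈ Fintype.piFinset fun _ : Fin n => I,
      ‖∑ q ∈ Fintype.piFinset fun _ : Fin n => J, (∏ l, C (p l) (q l)) • x q‖ ^ 2
      ≤ ∑ q ∈ Fintype.piFinset fun _ : Fin n => J, ‖x q‖ ^ 2 := by
  induction n with
  | zero => simp
  | succ n ih =>
    have hx : ∀ q : Fin (n + 1) → Q, x (Fin.cons (q 0) fun i => q ((0 : Fin (n + 1)).succAbove i))
        = x q := fun q => by
      congr 1
      funext i
      refine Fin.cases ?_ (fun i => ?_) i <;> simp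
    set Y : Q → (Fin n → P) → E := fun q₀ p =>
      ∑ q ∈ Fintype.piFinset fun _ : Fin n => J, (∏ l, C (p l) (q l)) • x (Fin.cons q₀ q)
    have e1 : ∀ p : Fin (n + 1) → P,
        ∑ q ∈ Fintype.piFinset fun _ : Fin (n + 1) => J, (∏ l, C (p l) (q l)) • x q
        = ∑ q₀ ∈ J, C (p 0) q₀ • Y q₀ fun i => p ((0 : Fin (n + 1)).succAbove i) := by
      intro p
      have := sum_piFinset_succAbove (0 : Fin (n + 1)) J fun q₀ q =>
        (C (p 0) q₀ * ∏ i, C (p ((0 : Fin (n + 1)).succAbove i)) (q i)) •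
          x (Fin.cons q₀ q)
      simp only [Y, Finset.smul_sum, smul_smul]
      rw [← this]
      refine Finset.sum_congr rfl fun q _ => ?_
      rw [hx q, Fin.prod_univ_succAbove _ 0]
    simp_rw [e1]
    rw [sum_piFinset_succAbove (0 : Fin (n + 1)) I fun p₀ p => ‖∑ q₀ ∈ J, C p₀ q₀ • Y q₀ p‖ ^ 2,
      Finset.sum_comm]
    refine (Finset.sum_le_sum fun p _ => sum_norm_sq_le_of_contraction hC fun q₀ => Y q₀ p).trans ?_
    rw [Finset.sum_comm]
    refine (Finset.sum_le_sum fun q₀ _ => ih fun q => x (Fin.cons q₀ q)).trans (le_of_eq ?_)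
    rw [← sum_piFinset_succAbove (0 : Fin (n + 1)) J fun q₀ q => ‖x (Fin.cons q₀ q)‖ ^ 2]
    exact Finset.sum_congr rfl fun q _ => by rw [hx q]

/-- The direct sum of copies of a matrix: the identity on the second index. -/
def kronId (C : ℕ → ℕ → ℝ) (p q : ℕ × ℕ) : ℝ := if p.2 = q.2 then C p.1 q.1 else 0

theorem kronId_contraction {I J : Finset ℕ} {C : ℕ → ℕ → ℝ}
    (hC : ∀ x : ℕ → ℝ, ∑ i ∈ I, (∑ j ∈ J, C i j * x j) ^ 2 ≤ ∑ j ∈ J, x j ^ 2) (L : Finset ℕ)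
    (x : ℕ × ℕ → ℝ) :
    ∑ p ∈ I ×ˢ L, (∑ q ∈ J ×ˢ L, kronId C p q * x q) ^ 2 ≤ ∑ q ∈ J ×ˢ L, x q ^ 2 := by
  rw [Finset.sum_product_right, Finset.sum_product_right]
  refine Finset.sum_le_sum fun k hk => (le_of_eq ?_).trans (hC fun j => x (j, k))
  refine Finset.sum_congr rfl fun i _ => ?_
  congr 1
  rw [Finset.sum_product]
  refine Finset.sum_congr rfl fun j _ => ?_
  rw [Finset.sum_eq_single_of_mem k hk fun k' _ hne => by simp [kronId, hne.symm]]
  simp [kronId]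

theorem norm_sum_smul_sq {E : Type*} [NormedAddCommGroup E] [InnerProductSpace ℝ E]
    {f : ℕ → E} {J : Finset ℕ}
    (hf : ∀ j ∈ J, ∀ j' ∈ J, inner ℝ (f j) (f j') = if j = j' then (1 : ℝ) else 0)
    (a : ℕ → ℝ) : ‖∑ j ∈ J, a j • f j‖ ^ 2 = ∑ j ∈ J, a j ^ 2 := by
  rw [← real_inner_self_eq_norm_sq, sum_inner]
  refine Finset.sum_congr rfl fun j hj => ?_
  rw [inner_sum, Finset.sum_eq_single_of_mem j hj fun j' hj' hne => by
    rw [real_inner_smul_left, real_inner_smul_right, hf j hj j' hj', if_neg hne.symm]; simp]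
  rw [real_inner_smul_left, real_inner_smul_right, hf j hj j hj, if_pos rfl]
  ring

/-- Bessel's inequality: the matrix of inner products of an orthonormal family with another
orthonormal family is a contraction. -/
theorem sum_inner_mul_sq_le {E : Type*} [NormedAddCommGroup E] [InnerProductSpace ℝ E]
    {e f : ℕ → E} (he : Orthonormal ℝ e) {J : Finset ℕ}
    (hf : ∀ j ∈ J, ∀ j' ∈ J, inner ℝ (f j) (f j') = if j = j' then (1 : ℝ) else 0)
    (I : Finset ℕ) (x : ℕ → ℝ) :
    ∑ i ∈ I, (∑ j ∈ J, inner ℝ (e i) (f j) * x j) ^ 2 ≤ ∑ j ∈ J, x j ^ 2 := by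
  have h1 := he.sum_inner_products_le (x := ∑ j ∈ J, x j • f j) (s := I)
  rw [norm_sum_smul_sq hf] at h1
  refine le_trans (le_of_eq (Finset.sum_congr rfl fun i _ => ?_)) h1
  rw [inner_sum]
  simp [real_inner_smul_right, mul_comm]

/-- The orthogonal projection onto the span of a finite orthonormal family is the best
approximation. -/
theorem norm_sub_sum_inner_smul_le {E : Type*} [NormedAddCommGroup E] [InnerProductSpace ℝ E]
    {f : ℕ → E} {J : Finset ℕ}
    (hf : ∀ j ∈ J, ∀ j' ∈ J, inner ℝ (f j) (f j') = if j = j' then (1 : ℝ) else 0)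
    (x : E) (a : ℕ → ℝ) :
    ‖x - ∑ j ∈ J, (inner ℝ x (f j) : ℝ) • f j‖ ≤ ‖x - ∑ j ∈ J, a j • f j‖ := by
  have key : ∀ a : ℕ → ℝ, ‖x - ∑ j ∈ J, a j • f j‖ ^ 2
      = ‖x‖ ^ 2 - 2 * ∑ j ∈ J, a j * inner ℝ x (f j) + ∑ j ∈ J, a j ^ 2 := by
    intro a
    rw [norm_sub_sq_real, norm_sum_smul_sq hf, inner_sum]
    simp_rw [real_inner_smul_right]
  refine le_of_sq_le_sq ?_ (norm_nonneg _)
  rw [key, key, ← sub_nonneg]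
  have : ∀ u v w z r : ℝ, r - 2 * u + v - (r - 2 * w + z) = v - 2 * u + (2 * w - z) := by
    intros; ring
  rw [this, Finset.mul_sum, Finset.mul_sum, ← Finset.sum_sub_distrib, ← Finset.sum_sub_distrib,
    ← Finset.sum_add_distrib]
  refine Finset.sum_nonneg fun j _ => ?_
  nlinarith [sq_nonneg (a j - inner ℝ x (f j))]

end Contraction

/-! ### The discretized expansion in a rotated basis -/

section Multiplication

variable {Ω : Type*} [MeasurableSpace Ω] {μ : Measure Ω} {E : Type*} [NormedAddCommGroup E]
  [NormedSpace ℝ E]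

/-- The inclusion of `L_∞` in `L₂` for a finite measure. -/
def toL2 [IsFiniteMeasure μ] : Lp ℝ ∞ μ →L[ℝ] Lp ℝ 2 μ :=
  (mulOp (μ := μ) (E := ℝ)).flip (Lp.const 2 μ (1 : ℝ))

theorem coeFn_toL2 [IsFiniteMeasure μ] (e : Lp ℝ ∞ μ) : toL2 e =ᵐ[μ] e := by
  filter_upwards [coeFn_mulOp e (Lp.const 2 μ (1 : ℝ)), Lp.coeFn_const 2 μ (1 : ℝ)] with t h1 h2
  rw [toL2, ContinuousLinearMap.flip_apply, h1, h2]
  simp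

theorem mulOp_comm (e e' : Lp ℝ ∞ μ) (x : Lp E 2 μ) :
    mulOp e (mulOp e' x) = mulOp e' (mulOp e x) := by
  apply Lp.ext
  filter_upwards [coeFn_mulOp e (mulOp e' x), coeFn_mulOp e' (mulOp e x), coeFn_mulOp e x,
    coeFn_mulOp e' x] with t h1 h2 h3 h4
  rw [h1, h2, h3, h4, smul_comm]

theorem inner_mulOp_left {E : Type*} [NormedAddCommGroup E] [InnerProductSpace ℝ E]
    (e : Lp ℝ ∞ μ) (x y : Lp E 2 μ) : (inner ℝ (mulOp e x) y : ℝ) = inner ℝ x (mulOp e y) := by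
  rw [L2.inner_def, L2.inner_def]
  refine integral_congr_ae ?_
  filter_upwards [coeFn_mulOp e x, coeFn_mulOp e y] with t h1 h2
  rw [h1, h2, real_inner_smul_left, real_inner_smul_right]

end Multiplication

section CellOperators

variable {T h : ℝ} {E : Type*} [NormedAddCommGroup E]

section

variable [NormedSpace ℝ E]

theorem mulOp_cellInd_cellInd (hh : 0 < h) (J J' : ℕ)
    (x : Lp E 2 (volume.restrict (Ioo 0 T))) :
    mulOp (cellInd T h J) (mulOp (cellInd T h J') x)
      = if J = J' then mulOp (cellInd T h J) x else 0 := by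
  apply Lp.ext
  filter_upwards [coeFn_mulOp (cellInd T h J) (mulOp (cellInd T h J') x),
    coeFn_mulOp (cellInd T h J') x, coeFn_mulOp (cellInd T h J) x, coeFn_cellInd T h J,
    coeFn_cellInd T h J', Lp.coeFn_zero E 2 (volume.restrict (Ioo 0 T))] with t h1 h2 h3 h4 h5 h6
  rw [h1, h2, h4, h5]
  split_ifs with hJ
  · subst hJ
    rw [h3, h4]
    by_cases ht : t ∈ cell h J <;> simp [ht]
  · rw [h6]
    by_cases ht : t ∈ cell h J
    · have : t ∉ cell h J' := fun ht' => hJ (eq_of_mem_cell hh ht ht')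
      simp [this]
    · simp [ht]

theorem mulOp_bump (J : ℕ) (x : Lp E 2 (volume.restrict (Ioo 0 T))) :
    mulOp (bump T h J) x = (√h)⁻¹ • mulOp (cellInd T h J) x := by
  rw [bump, map_smul, smul_apply]

theorem mulOp_bump_cellInd (hh : 0 < h) (J J' : ℕ)
    (x : Lp E 2 (volume.restrict (Ioo 0 T))) :
    mulOp (bump T h J) (mulOp (cellInd T h J') x)
      = if J = J' then mulOp (bump T h J) x else 0 := by
  rw [mulOp_bump, mulOp_cellInd_cellInd hh]
  split_ifs
  · rw [mulOp_bump]
  · rw [smul_zero]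

theorem exists_mem_cell (hh : 0 < h) {N : ℕ} (hN : N * h = T) {t : ℝ} (ht : t ∈ Ioo 0 T) :
    ∃ J ∈ Finset.range N, t ∈ cell h J := by
  refine ⟨⌊t / h⌋₊, ?_, ?_, ?_⟩
  · rw [Finset.mem_range, Nat.floor_lt (by have := ht.1; positivity), div_lt_iff₀ hh, hN]
    exact ht.2
  · rw [← le_div_iff₀ hh]
    exact Nat.floor_le (by have := ht.1; positivity)
  · rw [← div_lt_iff₀ hh]
    exact Nat.lt_floor_add_one _

theorem sum_mulOp_cellInd (hh : 0 < h) {N : ℕ} (hN : N * h = T)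
    (x : Lp E 2 (volume.restrict (Ioo 0 T))) :
    ∑ J ∈ Finset.range N, mulOp (cellInd T h J) x = x := by
  apply Lp.ext
  have h1 : ∀ᵐ t ∂volume.restrict (Ioo 0 T), ∀ J : ℕ, mulOp (cellInd T h J) x t
      = (cell h J).indicator (fun _ => (1 : ℝ)) t • x t := by
    refine ae_all_iff.2 fun J => ?_
    filter_upwards [coeFn_mulOp (cellInd T h J) x, coeFn_cellInd T h J] with t h2 h3
    rw [h2, h3]
  filter_upwards [Lp.coeFn_finsetSum (Finset.range N) fun J => mulOp (cellInd T h J) x, h1,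
    ae_restrict_mem measurableSet_Ioo] with t h2 h3 ht
  obtain ⟨J, hJ, hJt⟩ := exists_mem_cell hh hN ht
  rw [h2, Finset.sum_apply, Finset.sum_eq_single_of_mem J hJ, h3, indicator_of_mem hJt, one_smul]
  intro J' _ hne
  rw [h3, indicator_of_notMem (fun h' => hne (eq_of_mem_cell hh h' hJt)), zero_smul]

theorem toL2_bump_inner (hh : 0 < h) {N : ℕ} (hN : N * h = T) :
    ∀ J ∈ Finset.range N, ∀ J' ∈ Finset.range N,
      inner ℝ (toL2 (bump T h J)) (toL2 (bump T h J')) = if J = J' then (1 : ℝ) else 0 := by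
  intro J hJ J' _
  have e : inner ℝ (toL2 (bump T h J)) (toL2 (bump T h J'))
      = ∫ t in Ioo 0 T, (if J = J' then (cell h J).indicator (fun _ => h⁻¹) t else 0) := by
    rw [L2.inner_def]
    refine integral_congr_ae ?_
    filter_upwards [coeFn_toL2 (bump T h J), coeFn_toL2 (bump T h J'), coeFn_bump T h J,
      coeFn_bump T h J'] with t h1 h2 h3 h4
    rw [h1, h2, h3, h4]
    split_ifs with hJJ
    · subst hJJ
      by_cases ht : t ∈ cell h J
      · simp [ht, Real.sq_sqrt hh.le]
      · simp [ht]
    · by_cases ht : t ∈ cell h J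
      · have : t ∉ cell h J' := fun ht' => hJJ (eq_of_mem_cell hh ht ht')
        simp [this]
      · simp [ht]
  rw [e]
  split_ifs with hJJ
  · have hsub : Ioo (J * h) ((J + 1) * h) ⊆ Ioo 0 T := by
      refine Ioo_subset_Ioo (by positivity) ?_
      rw [← hN]
      have : (J + 1 : ℝ) ≤ N := by exact_mod_cast Finset.mem_range.1 hJ
      gcongr
    rw [integral_indicator_const _ (measurableSet_cell h J), smul_eq_mul, measureReal_def,
      Measure.restrict_apply (measurableSet_cell h J)]
    have hv : volume (cell h J ∩ Ioo 0 T) = ENNReal.ofReal h := by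
      have h1 : volume (Ioo (J * h) ((J + 1) * h)) = ENNReal.ofReal h := by
        rw [Real.volume_Ioo]; ring_nf
      have h2 : volume (cell h J) = ENNReal.ofReal h := by
        rw [cell, Real.volume_Ico]; ring_nf
      refine le_antisymm ((measure_mono inter_subset_left).trans h2.le) ?_
      rw [← h1]
      exact measure_mono (subset_inter Ioo_subset_Ico_self hsub)
    rw [hv, ENNReal.toReal_ofReal hh.le, mul_inv_cancel₀ hh.ne']
  · simp

end

variable [InnerProductSpace ℝ E]

theorem norm_sq_sum_mulOp_cellInd (hh : 0 < h) (N : Finset ℕ)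
    (x : ℕ → Lp E 2 (volume.restrict (Ioo 0 T))) :
    ‖∑ J ∈ N, mulOp (cellInd T h J) (x J)‖ ^ 2 = ∑ J ∈ N, ‖mulOp (cellInd T h J) (x J)‖ ^ 2 := by
  rw [← real_inner_self_eq_norm_sq, sum_inner]
  refine Finset.sum_congr rfl fun J hJ => ?_
  rw [inner_sum, Finset.sum_eq_single_of_mem J hJ fun J' _ hne => by
    rw [inner_mulOp_left, mulOp_cellInd_cellInd hh, if_neg hne.symm, inner_zero_right],
    real_inner_self_eq_norm_sq]

theorem norm_mulOp_cellInd_le (hh : 0 < h) (J : ℕ) (x : Lp E 2 (volume.restrict (Ioo 0 T))) :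
    ‖mulOp (cellInd T h J) x‖ ≤ ‖x‖ := by
  have h1 : ‖mulOp (cellInd T h J) x‖ ^ 2 = inner ℝ x (mulOp (cellInd T h J) x) := by
    rw [← real_inner_self_eq_norm_sq, inner_mulOp_left, mulOp_cellInd_cellInd hh, if_pos rfl]
  have h2 := real_inner_le_norm x (mulOp (cellInd T h J) x)
  by_contra hlt
  push Not at hlt
  nlinarith [norm_nonneg x]

theorem sum_norm_sq_mulOp_cellInd (hh : 0 < h) {N : ℕ} (hN : N * h = T)
    (x : Lp E 2 (volume.restrict (Ioo 0 T))) :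
    ∑ J ∈ Finset.range N, ‖mulOp (cellInd T h J) x‖ ^ 2 = ‖x‖ ^ 2 := by
  rw [← norm_sq_sum_mulOp_cellInd hh _ fun _ => x, sum_mulOp_cellInd hh hN]

end CellOperators

section Rotation

variable {V H : Type*} [NormedAddCommGroup V] [InnerProductSpace ℝ V]
  [NormedAddCommGroup H] [InnerProductSpace ℝ H] {T : ℝ}
  (R : Lp H 2 (volume.restrict (Ioo 0 T)) →ₗ[ℝ] Lp V 2 (volume.restrict (Ioo 0 T)))
  (B : ℕ → Lp V 2 (volume.restrict (Ioo 0 T)) →L[ℝ] Lp H 2 (volume.restrict (Ioo 0 T)))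
  (h : ℝ) (v₀ : Lp V 2 (volume.restrict (Ioo 0 T)))

/-- The chaos coefficients of order `n` in the basis that arises from the normalized cell indicators
by the matrix `C`, when only the noise in the first `J` cells and the first `L` components
is retained. -/
def rotatedChaos (C : ℕ → ℕ → ℝ) (L J n : ℕ) (p : Fin n → ℕ × ℕ) :
    Lp V 2 (volume.restrict (Ioo 0 T)) :=
  ∑ q ∈ Fintype.piFinset fun _ : Fin n => Finset.range J ×ˢ Finset.range L,
    (∏ l, kronId C (p l) (q l)) • cellChaos R B h v₀ n q

theorem rotatedChaos_zero (C : ℕ → ℕ → ℝ) (L J : ℕ) (p : Fin 0 → ℕ × ℕ) :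
    rotatedChaos R B h v₀ C L J 0 p = v₀ := by
  simp [rotatedChaos, cellChaos]

/-- The recursion for the rotated coefficients: the last noise acts in the cell `J'`, the others in
the cells before `J'`. -/
theorem rotatedChaos_succ (C : ℕ → ℕ → ℝ) {L : ℕ} (J : ℕ) {n : ℕ} {p : Fin (n + 1) → ℕ × ℕ}
    (hp : ∀ l, (p l).2 < L) :
    rotatedChaos R B h v₀ C L J (n + 1) p = R (∑ l, ∑ J' ∈ Finset.range J,
      C (p l).1 J' • mulOp (bump T h J') (B (p l).2
        (rotatedChaos R B h v₀ C L J' n fun i => p (l.succAbove i)))) := by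
  have h1 : rotatedChaos R B h v₀ C L J (n + 1) p = R (∑ l : Fin (n + 1),
      ∑ q ∈ Fintype.piFinset fun _ : Fin (n + 1) => Finset.range J ×ˢ Finset.range L,
        (∏ l, kronId C (p l) (q l)) • if ∀ i : Fin n, (q (l.succAbove i)).1 < (q l).1 then
          mulOp (bump T h (q l).1) (B (q l).2 (cellChaos R B h v₀ n fun i => q (l.succAbove i)))
        else 0) := by
    rw [rotatedChaos, Finset.sum_comm, map_sum]
    simp_rw [← Finset.smul_sum, map_smul]
    rfl
  rw [h1]
  congr 1
  refine Finset.sum_congr rfl fun l _ => ?_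
  have h2 := sum_piFinset_succAbove l (Finset.range J ×ˢ Finset.range L)
    fun r (q : Fin n → ℕ × ℕ) => (kronId C (p l) r * ∏ i, kronId C (p (l.succAbove i)) (q i)) •
      if ∀ i : Fin n, (q i).1 < r.1 then mulOp (bump T h r.1) (B r.2 (cellChaos R B h v₀ n q))
      else 0
  simp_rw [Fin.prod_univ_succAbove _ l]
  rw [h2, Finset.sum_product]
  refine Finset.sum_congr rfl fun J' hJ' => ?_
  rw [Finset.sum_eq_single_of_mem (p l).2 (Finset.mem_range.2 (hp l))]
  · have h3 : Fintype.piFinset (fun _ : Fin n => Finset.range J' ×ˢ Finset.range L)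
        = (Fintype.piFinset fun _ : Fin n => Finset.range J ×ˢ Finset.range L).filter
          fun q => ∀ i, (q i).1 < J' := by
      ext q
      simp only [Fintype.mem_piFinset, Finset.mem_product, Finset.mem_range, Finset.mem_filter]
      constructor
      · exact fun hq => ⟨fun i => ⟨(hq i).1.trans (Finset.mem_range.1 hJ'), (hq i).2⟩,
          fun i => (hq i).1⟩
      · exact fun hq i => ⟨hq.2 i, (hq.1 i).2⟩
    rw [rotatedChaos, h3, Finset.sum_filter, map_sum, map_sum, Finset.smul_sum]
    refine Finset.sum_congr rfl fun q _ => ?_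
    have h4 : kronId C (p l) (J', (p l).2) = C (p l).1 J' := if_pos rfl
    split_ifs
    · rw [map_smul, map_smul, smul_smul, h4]
    · simp
  · intro k _ hne
    refine Finset.sum_eq_zero fun q _ => ?_
    have h4 : kronId C (p l) (J', k) = 0 := if_neg hne.symm
    rw [h4, zero_mul, zero_smul]

/-- The adapted version of `rotatedChaos`: on each cell only the noise before that cell is
retained. -/
def adaptedChaos (C : ℕ → ℕ → ℝ) (L N n : ℕ) (p : Fin n → ℕ × ℕ) :
    Lp V 2 (volume.restrict (Ioo 0 T)) :=
  ∑ J ∈ Finset.range N, mulOp (cellInd T h J) (rotatedChaos R B h v₀ C L J n p)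

variable {h}

theorem mulOp_bump_adaptedChaos (hh : 0 < h) (C : ℕ → ℕ → ℝ) (L : ℕ) {N J : ℕ}
    (hJ : J ∈ Finset.range N) (n : ℕ) (p : Fin n → ℕ × ℕ) :
    mulOp (bump T h J) (adaptedChaos R B h v₀ C L N n p)
      = mulOp (bump T h J) (rotatedChaos R B h v₀ C L J n p) := by
  rw [adaptedChaos, map_sum, Finset.sum_eq_single_of_mem J hJ fun J' _ hne => by
    rw [mulOp_bump_cellInd hh, if_neg hne.symm], mulOp_bump_cellInd hh, if_pos rfl]

variable {B}

theorem mulOp_bump_op_adaptedChaos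
    (hB : ∀ k e x, mulOp e (B k x) = B k (mulOp e x)) (hh : 0 < h) (C : ℕ → ℕ → ℝ) (L : ℕ)
    {N J : ℕ} (hJ : J ∈ Finset.range N) (n : ℕ) (p : Fin n → ℕ × ℕ) (k : ℕ) :
    mulOp (bump T h J) (B k (adaptedChaos R B h v₀ C L N n p))
      = mulOp (bump T h J) (B k (rotatedChaos R B h v₀ C L J n p)) := by
  rw [hB, hB, mulOp_bump_adaptedChaos R B v₀ hh C L hJ]

/-- The rotated coefficients solve the recursion of the chaos coefficients for the step functions
`∑_J C_{iJ} bump_J`, with the adapted version in the forcing term. -/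
theorem rotatedChaos_succ_eq (hB : ∀ k e x, mulOp e (B k x) = B k (mulOp e x)) (hh : 0 < h)
    (C : ℕ → ℕ → ℝ) {L : ℕ} (N : ℕ) {n : ℕ} {p : Fin (n + 1) → ℕ × ℕ} (hp : ∀ l, (p l).2 < L) :
    rotatedChaos R B h v₀ C L N (n + 1) p = R (∑ l,
      mulOp (∑ J ∈ Finset.range N, C (p l).1 J • bump T h J) (B (p l).2
        (adaptedChaos R B h v₀ C L N n fun i => p (l.succAbove i)))) := by
  rw [rotatedChaos_succ R B h v₀ C N hp]
  congr 1
  refine Finset.sum_congr rfl fun l _ => ?_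
  rw [map_sum, sum_apply]
  refine Finset.sum_congr rfl fun J hJ => ?_
  rw [map_smul, smul_apply, mulOp_bump_op_adaptedChaos R v₀ hB hh C L hJ]

/-- By causality, the rotated coefficient and its adapted version differ on the cell `J` only by the
effect of the noise in this cell. -/
theorem rotatedChaos_sub_adaptedChaos (hB : ∀ k e x, mulOp e (B k x) = B k (mulOp e x))
    (hR : ∀ (f : Lp H 2 (volume.restrict (Ioo 0 T))) (a : ℝ),
      (∀ᵐ t ∂volume.restrict (Ioo 0 T), t < a → f t = 0) →
        ∀ᵐ t ∂volume.restrict (Ioo 0 T), t < a → R f t = 0)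
    (hh : 0 < h) (C : ℕ → ℕ → ℝ) {L N : ℕ} (hN : N * h = T) {n : ℕ} {p : Fin (n + 1) → ℕ × ℕ}
    (hp : ∀ l, (p l).2 < L) :
    rotatedChaos R B h v₀ C L N (n + 1) p - adaptedChaos R B h v₀ C L N (n + 1) p
      = ∑ J ∈ Finset.range N, mulOp (cellInd T h J) (R (∑ l, C (p l).1 J • mulOp (bump T h J)
          (B (p l).2 (adaptedChaos R B h v₀ C L N n fun i => p (l.succAbove i))))) := by
  rw [← sum_mulOp_cellInd hh hN (rotatedChaos R B h v₀ C L N (n + 1) p), adaptedChaos,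
    ← Finset.sum_sub_distrib]
  refine Finset.sum_congr rfl fun J hJ => ?_
  set g : ℕ → Lp H 2 (volume.restrict (Ioo 0 T)) := fun J' => ∑ l, C (p l).1 J' •
    mulOp (bump T h J') (B (p l).2 (rotatedChaos R B h v₀ C L J' n fun i => p (l.succAbove i)))
  have h1 : ∀ J, rotatedChaos R B h v₀ C L J (n + 1) p = R (∑ J' ∈ Finset.range J, g J') := by
    intro J
    rw [rotatedChaos_succ R B h v₀ C J hp, Finset.sum_comm]
  have h2 : ∑ l, C (p l).1 J • mulOp (bump T h J)
      (B (p l).2 (adaptedChaos R B h v₀ C L N n fun i => p (l.succAbove i))) = g J :=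
    Finset.sum_congr rfl fun l _ => by rw [mulOp_bump_op_adaptedChaos R v₀ hB hh C L hJ]
  have h3 : ∑ J' ∈ Finset.range N, g J' - ∑ J' ∈ Finset.range J, g J'
      = g J + ∑ J' ∈ Finset.Ico (J + 1) N, g J' := by
    have hJN := Finset.mem_range.1 hJ
    rw [← Finset.sum_Ico_eq_sub g hJN.le, Finset.sum_eq_sum_Ico_succ_bot hJN]
  rw [h2, ← map_sub, h1 N, h1 J, ← map_sub, h3, map_add, map_add, add_eq_left]
  -- The forcing terms from later cells vanish before the end of the cell `J`.
  have h4 : ∀ J' ∈ Finset.Ico (J + 1) N, ∀ᵐ t ∂volume.restrict (Ioo 0 T),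
      t < (J + 1) * h → g J' t = 0 := by
    intro J' hJ'
    have e : g J' = mulOp (bump T h J') (∑ l, C (p l).1 J' • (B (p l).2
        (rotatedChaos R B h v₀ C L J' n fun i => p (l.succAbove i)))) := by
      rw [map_sum]
      simp_rw [map_smul]
      rfl
    rw [e]
    filter_upwards [coeFn_mulOp (bump T h J') (∑ l, C (p l).1 J' • (B (p l).2
      (rotatedChaos R B h v₀ C L J' n fun i => p (l.succAbove i)))), coeFn_bump T h J']
      with t h5 h6 ht
    have h7 : t ∉ cell h J' := fun h8 => by
      have : (J + 1 : ℝ) ≤ J' := by exact_mod_cast (Finset.mem_Ico.1 hJ').1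
      have := h8.1
      nlinarith
    rw [h5, h6, indicator_of_notMem h7, zero_smul]
  have h5 : ∀ᵐ t ∂volume.restrict (Ioo 0 T),
      t < (J + 1) * h → (∑ J' ∈ Finset.Ico (J + 1) N, g J') t = 0 := by
    filter_upwards [Lp.coeFn_finsetSum (Finset.Ico (J + 1) N) g,
      (Finset.eventually_all _).2 h4] with t h6 h7 ht
    rw [h6, Finset.sum_apply]
    exact Finset.sum_eq_zero fun J' hJ' => h7 J' hJ' ht
  apply Lp.ext
  filter_upwards [hR _ _ h5, coeFn_mulOp (cellInd T h J) (R (∑ J' ∈ Finset.Ico (J + 1) N, g J')),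
    coeFn_cellInd T h J, Lp.coeFn_zero V 2 (volume.restrict (Ioo 0 T))] with t h6 h7 h8 h9
  rw [h7, h8, h9, Pi.zero_apply]
  by_cases ht : t ∈ cell h J
  · rw [h6 ht.2, smul_zero]
  · rw [indicator_of_notMem ht, zero_smul]

end Rotation

/-! ### Refinement of the partition -/

section Approximation

open Filter Topology

variable {T : ℝ}

/-- The length of the cells when `(0,T)` is divided into `N + 1` cells. -/
def mesh (T : ℝ) (N : ℕ) : ℝ := T / (N + 1 : ℕ)

theorem mesh_pos (hT : 0 < T) (N : ℕ) : 0 < mesh T N := by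
  rw [mesh]; positivity

theorem mul_mesh (T : ℝ) (N : ℕ) : (N + 1 : ℕ) * mesh T N = T := by
  rw [mesh]; field_simp

theorem tendsto_mesh (T : ℝ) : Tendsto (mesh T) atTop (𝓝 0) := by
  have := tendsto_const_div_atTop_nhds_zero_nat T
  exact this.comp (tendsto_add_atTop_nat 1)

/-- Step functions on the partition are dense in `L₂` as the mesh tends to zero. -/
theorem tendsto_sum_inner_smul_bump (hT : 0 < T) (f : Lp ℝ 2 (volume.restrict (Ioo 0 T))) :
    Tendsto (fun N => ∑ J ∈ Finset.range (N + 1),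
      (inner ℝ f (toL2 (bump T (mesh T N) J)) : ℝ) • toL2 (bump T (mesh T N) J)) atTop (𝓝 f) := by
  rw [tendsto_iff_norm_sub_tendsto_zero, Metric.tendsto_atTop]
  intro ε hε
  have hη : 0 < ε / (2 * (√T + 1)) := by positivity
  obtain ⟨g, hgc, hfg, hg, hg2⟩ := (Lp.memLp f).exists_hasCompactSupport_eLpNorm_sub_le
    (by simp) (ε := ENNReal.ofReal (ε / 2 / 2)) (by simp; positivity)
  have hu := Metric.uniformContinuous_iff.1 (hgc.uniformContinuous_of_continuous hg) _ hη
  obtain ⟨δ, hδ, hgδ⟩ := hu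
  obtain ⟨N₀, hN₀⟩ := (Metric.tendsto_atTop.1 (tendsto_mesh T)) δ hδ
  refine ⟨N₀, fun N hN => ?_⟩
  have hm := mesh_pos hT N
  have hmδ : mesh T N < δ := by
    have := hN₀ N hN
    rwa [Real.dist_eq, sub_zero, abs_of_pos hm] at this
  rw [Real.dist_eq, sub_zero, abs_of_nonneg (norm_nonneg _), norm_sub_rev]
  -- Compare with the step function that takes the values of `g` at the left end points.
  refine (norm_sub_sum_inner_smul_le (toL2_bump_inner hm (mul_mesh T N)) f
    fun J => g (J * mesh T N) * √(mesh T N)).trans_lt ?_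
  set s := ∑ J ∈ Finset.range (N + 1),
    (g (J * mesh T N) * √(mesh T N)) • toL2 (bump T (mesh T N) J)
  have hs : ∀ᵐ t ∂volume.restrict (Ioo 0 T), ‖g t - s t‖ ≤ ε / (2 * (√T + 1)) := by
    have h1 : ∀ᵐ t ∂volume.restrict (Ioo 0 T), ∀ J : ℕ,
        ((g (J * mesh T N) * √(mesh T N)) • toL2 (bump T (mesh T N) J) :
          Lp ℝ 2 (volume.restrict (Ioo 0 T))) t
        = (cell (mesh T N) J).indicator (fun _ => g (J * mesh T N)) t := by
      refine ae_all_iff.2 fun J => ?_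
      filter_upwards [Lp.coeFn_smul (g (J * mesh T N) * √(mesh T N))
        (toL2 (bump T (mesh T N) J)), coeFn_toL2 (bump T (mesh T N) J),
        coeFn_bump T (mesh T N) J] with t h2 h3 h4
      have : √(mesh T N) ≠ 0 := (Real.sqrt_pos.2 hm).ne'
      rw [h2, Pi.smul_apply, h3, h4]
      by_cases ht : t ∈ cell (mesh T N) J
      · simp [ht, this]
      · simp [ht]
    filter_upwards [h1, Lp.coeFn_finsetSum (Finset.range (N + 1)) fun J : ℕ =>
      ((g (J * mesh T N) * √(mesh T N)) • toL2 (bump T (mesh T N) J) :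
          Lp ℝ 2 (volume.restrict (Ioo 0 T))), ae_restrict_mem measurableSet_Ioo]
      with t h2 h3 ht
    obtain ⟨J, hJ, hJt⟩ := exists_mem_cell hm (mul_mesh T N) ht
    rw [h3, Finset.sum_apply, Finset.sum_eq_single_of_mem J hJ, h2, indicator_of_mem hJt]
    · rw [← dist_eq_norm]
      refine (hgδ ?_).le
      rw [Real.dist_eq, abs_lt]
      have h4 := hJt.1
      have h5 := hJt.2
      constructor <;> nlinarith
    · intro J' _ hne
      rw [h2, indicator_of_notMem fun h' => hne (eq_of_mem_cell hm h' hJt)]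
  have h1 : ‖f - hg2.toLp‖ ≤ ε / 2 / 2 := by
    rw [Lp.norm_def]
    refine ENNReal.toReal_le_of_le_ofReal (by positivity) ?_
    refine le_trans (le_of_eq (eLpNorm_congr_ae ?_)) hfg
    filter_upwards [Lp.coeFn_sub f hg2.toLp, hg2.coeFn_toLp] with t h2 h3
    rw [h2, Pi.sub_apply, h3]
    rfl
  have h2 : ‖hg2.toLp - s‖ ≤ √T * (ε / (2 * (√T + 1))) := by
    have := Lp.norm_le_of_ae_bound (f := hg2.toLp - s) hη.le (by
      filter_upwards [hs, Lp.coeFn_sub hg2.toLp s, hg2.coeFn_toLp] with t h2 h3 h4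
      rw [h3, Pi.sub_apply, h4]
      exact h2)
    refine this.trans (le_of_eq ?_)
    congr 1
    simp [Real.sqrt_eq_rpow, measureUnivNNReal, Real.coe_toNNReal _ hT.le, ENNReal.ofReal]
  have h3 : √T * (ε / (2 * (√T + 1))) ≤ ε / 2 := by
    have h0 := Real.sqrt_nonneg T
    have : √T * (ε / (2 * (√T + 1))) = ε / 2 * (√T / (√T + 1)) := by field_simp
    rw [this]
    refine mul_le_of_le_one_right (by positivity) ?_
    rw [div_le_one (by positivity)]
    linarith
  have h4 : ‖f - s‖ ≤ ‖f - hg2.toLp‖ + ‖hg2.toLp - s‖ := by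
    have := norm_add_le (f - hg2.toLp) (hg2.toLp - s)
    rwa [sub_add_sub_cancel] at this
  linarith

theorem ae_norm_le_norm {Ω : Type*} [MeasurableSpace Ω] {μ : Measure Ω} (e : Lp ℝ ∞ μ) :
    ∀ᵐ t ∂μ, ‖e t‖ ≤ ‖e‖ := by
  filter_upwards [ae_le_eLpNormEssSup (f := e) (μ := μ)] with t ht
  rw [Lp.norm_def, eLpNorm_exponent_top, ← toReal_enorm]
  refine ENNReal.toReal_mono ?_ ht
  rw [← eLpNorm_exponent_top]
  exact (Lp.memLp e).eLpNorm_ne_top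

/-- The coefficients of bounded functions with respect to the normalized cell indicators are of the
order of the square root of the mesh. -/
theorem abs_inner_toL2_bump_le {h : ℝ} (hh : 0 < h) (e : Lp ℝ ∞ (volume.restrict (Ioo 0 T)))
    (J : ℕ) : |(inner ℝ (toL2 e) (toL2 (bump T h J)) : ℝ)| ≤ ‖e‖ * √h := by
  rw [L2.inner_def, ← Real.norm_eq_abs]
  have hv : volume (cell h J) = ENNReal.ofReal h := by
    rw [cell, Real.volume_Ico]; ring_nf
  have h1 : (volume.restrict (Ioo 0 T)).real (cell h J) ≤ h :=
    ENNReal.toReal_le_of_le_ofReal hh.le ((Measure.restrict_apply_le _ _).trans hv.le)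
  refine (norm_integral_le_of_norm_le
    (g := (cell h J).indicator fun _ => ‖e‖ * (√h)⁻¹) ?_ ?_).trans ?_
  · exact (integrable_const _).indicator (measurableSet_cell h J)
  · filter_upwards [coeFn_toL2 e, coeFn_toL2 (bump T h J), coeFn_bump T h J,
      ae_norm_le_norm e] with t h2 h3 h4 h5
    rw [h2, h3, h4]
    by_cases ht : t ∈ cell h J
    · simp only [indicator_of_mem ht, RCLike.inner_apply, norm_mul, RCLike.conj_to_real]
      rw [Real.norm_of_nonneg (by positivity : (0 : ℝ) ≤ (√h)⁻¹), mul_comm]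
      gcongr
    · simp [ht]
  · rw [integral_indicator_const _ (measurableSet_cell h J), smul_eq_mul]
    calc _ ≤ h * (‖e‖ * (√h)⁻¹) := by gcongr
      _ = ‖e‖ * (√h * √h * (√h)⁻¹) := by rw [Real.mul_self_sqrt hh.le]; ring
      _ = ‖e‖ * √h := by
        have : √h ≠ 0 := (Real.sqrt_pos.2 hh).ne'
        field_simp

/-- Finitely many sequences that converge in `L₂` converge almost everywhere along a common
subsequence. -/
theorem exists_subseq_tendsto_ae {Ω ι E : Type*} [MeasurableSpace Ω] {μ : Measure Ω}
    [NormedAddCommGroup E] (s : Finset ι) {x : ℕ → ι → Lp E 2 μ} {y : ι → Lp E 2 μ}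
    (h : ∀ i ∈ s, Tendsto (fun N => x N i) atTop (𝓝 (y i))) :
    ∃ φ : ℕ → ℕ, StrictMono φ ∧
      ∀ᵐ t ∂μ, ∀ i ∈ s, Tendsto (fun N => x (φ N) i t) atTop (𝓝 (y i t)) := by
  classical
  induction s using Finset.induction_on with
  | empty => exact ⟨id, strictMono_id, by simp⟩
  | insert i s _ ih =>
    obtain ⟨φ, hφ, h1⟩ := ih fun j hj => h j (Finset.mem_insert_of_mem hj)
    have h2 := (h i (Finset.mem_insert_self i s)).comp hφ.tendsto_atTop
    obtain ⟨ψ, hψ, h3⟩ := (tendstoInMeasure_of_tendsto_Lp h2).exists_seq_tendsto_ae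
    refine ⟨φ ∘ ψ, hφ.comp hψ, ?_⟩
    filter_upwards [h1, h3] with t h4 h5 j hj
    rcases Finset.mem_insert.1 hj with rfl | hj
    · exact h5
    · exact (h4 j hj).comp hψ.tendsto_atTop

end Approximation

section Limit

open Filter Topology

variable {V H : Type*} [NormedAddCommGroup V] [InnerProductSpace ℝ V]
  [NormedAddCommGroup H] [InnerProductSpace ℝ H] {T : ℝ}

/-- The chaos coefficients for the noise expanded in the functions `e_i`, with multi-indices
represented by sequences: `chaos n p` is the coefficient of `α = ∑_l δ_{p_l}`, times `√(α!)`. -/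
def chaos (R : Lp H 2 (volume.restrict (Ioo 0 T)) →ₗ[ℝ] Lp V 2 (volume.restrict (Ioo 0 T)))
    (B : ℕ → Lp V 2 (volume.restrict (Ioo 0 T)) →L[ℝ] Lp H 2 (volume.restrict (Ioo 0 T)))
    (e : ℕ → Lp ℝ ∞ (volume.restrict (Ioo 0 T))) (v₀ : Lp V 2 (volume.restrict (Ioo 0 T))) :
    (n : ℕ) → (Fin n → ℕ × ℕ) → Lp V 2 (volume.restrict (Ioo 0 T))
  | 0, _ => v₀
  | n + 1, p => R (∑ l : Fin (n + 1),
      mulOp (e (p l).1) (B (p l).2 (chaos R B e v₀ n fun i => p (l.succAbove i))))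

variable
  {R : Lp H 2 (volume.restrict (Ioo 0 T)) →ₗ[ℝ] Lp V 2 (volume.restrict (Ioo 0 T))}
  {B : ℕ → Lp V 2 (volume.restrict (Ioo 0 T)) →L[ℝ] Lp H 2 (volume.restrict (Ioo 0 T))}
  {v₀ : Lp V 2 (volume.restrict (Ioo 0 T))} {κ : ℝ}

/-- The solution operator depends continuously on the multiplier in the norm of `L₂`, although
multipliers are bounded functions. -/
theorem tendsto_apply_mulOp
    (hκ : ∀ e g, ‖R (mulOp e g)‖ ≤ κ * (‖toL2 e‖ * ‖g‖))
    {s : ℕ → Lp ℝ ∞ (volume.restrict (Ioo 0 T))} {e : Lp ℝ ∞ (volume.restrict (Ioo 0 T))}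
    (hs : Tendsto (fun N => toL2 (s N)) atTop (𝓝 (toL2 e)))
    {x : ℕ → Lp H 2 (volume.restrict (Ioo 0 T))} {y : Lp H 2 (volume.restrict (Ioo 0 T))}
    (hx : Tendsto x atTop (𝓝 y)) :
    Tendsto (fun N => R (mulOp (s N) (x N))) atTop (𝓝 (R (mulOp e y))) := by
  rw [tendsto_iff_norm_sub_tendsto_zero] at hs ⊢
  have hx' := tendsto_iff_norm_sub_tendsto_zero.1 hx
  have h1 : Tendsto (fun N => κ * (‖toL2 (s N) - toL2 e‖ * ‖x N‖) + κ * (‖toL2 e‖ * ‖x N - y‖))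
      atTop (𝓝 (κ * (0 * ‖y‖) + κ * (‖toL2 e‖ * 0))) :=
    ((hs.mul hx.norm).const_mul κ).add ((hx'.const_mul _).const_mul κ)
  rw [show κ * (0 * ‖y‖) + κ * (‖toL2 e‖ * 0) = 0 by ring] at h1
  refine squeeze_zero (fun _ => norm_nonneg _) (fun N => ?_) h1
  have h2 : R (mulOp (s N) (x N)) - R (mulOp e y)
      = R (mulOp (s N - e) (x N)) + R (mulOp e (x N - y)) := by
    rw [← map_sub, ← map_add]
    congr 1
    rw [map_sub mulOp, map_sub (mulOp e), sub_apply]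
    abel
  rw [h2]
  refine (norm_add_le _ _).trans (add_le_add ?_ (hκ _ _))
  have := hκ (s N - e) (x N)
  rwa [map_sub toL2] at this

/-- The difference between the rotated coefficient and its adapted version is controlled by the
mesh: a single cell contributes one of the `n + 1` noises. -/
theorem norm_sq_rotatedChaos_sub_adaptedChaos_le
    (hκ : ∀ e g, ‖R (mulOp e g)‖ ≤ κ * (‖toL2 e‖ * ‖g‖))
    (hR : ∀ (f : Lp H 2 (volume.restrict (Ioo 0 T))) (a : ℝ),
      (∀ᵐ t ∂volume.restrict (Ioo 0 T), t < a → f t = 0) →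
        ∀ᵐ t ∂volume.restrict (Ioo 0 T), t < a → R f t = 0)
    (hB : ∀ k e x, mulOp e (B k x) = B k (mulOp e x))
    {h : ℝ} (hh : 0 < h) (e : ℕ → Lp ℝ ∞ (volume.restrict (Ioo 0 T))) {L N : ℕ} (hN : N * h = T)
    {n : ℕ} {p : Fin (n + 1) → ℕ × ℕ} (hp : ∀ l, (p l).2 < L)
    {C : ℕ → ℕ → ℝ} (hC : ∀ i J, C i J = inner ℝ (toL2 (e i)) (toL2 (bump T h J))) :
    ‖rotatedChaos R B h v₀ C L N (n + 1) p - adaptedChaos R B h v₀ C L N (n + 1) p‖ ^ 2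
      ≤ h * ((n + 1) * ∑ l, (κ * ‖e (p l).1‖) ^ 2 *
        ‖B (p l).2 (adaptedChaos R B h v₀ C L N n fun i => p (l.succAbove i))‖ ^ 2) := by
  rw [rotatedChaos_sub_adaptedChaos R v₀ hB hR hh C hN hp, norm_sq_sum_mulOp_cellInd hh]
  set g : Fin (n + 1) → Lp H 2 (volume.restrict (Ioo 0 T)) := fun l =>
    B (p l).2 (adaptedChaos R B h v₀ C L N n fun i => p (l.succAbove i))
  have h1 : ∀ J ∈ Finset.range N,
      ‖mulOp (cellInd T h J) (R (∑ l, C (p l).1 J • mulOp (bump T h J) (g l)))‖ ^ 2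
        ≤ h * ((n + 1) * ∑ l, (κ * ‖e (p l).1‖) ^ 2 * ‖mulOp (cellInd T h J) (g l)‖ ^ 2) := by
    intro J hJ
    have hb : ‖toL2 (bump T h J)‖ = 1 := by
      have := toL2_bump_inner hh hN J hJ J hJ
      rw [if_pos rfl, real_inner_self_eq_norm_sq] at this
      exact (pow_eq_one_iff_of_nonneg (norm_nonneg _) two_ne_zero).1 this
    have h2 : ∀ l, ‖C (p l).1 J • R (mulOp (bump T h J) (g l))‖
        ≤ √h * (κ * ‖e (p l).1‖ * ‖mulOp (cellInd T h J) (g l)‖) := by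
      intro l
      have h3 : R (mulOp (bump T h J) (g l))
          = R (mulOp (bump T h J) (mulOp (cellInd T h J) (g l))) := by
        rw [mulOp_bump_cellInd hh, if_pos rfl]
      have h4 := hκ (bump T h J) (mulOp (cellInd T h J) (g l))
      rw [hb, one_mul] at h4
      rw [norm_smul, Real.norm_eq_abs, hC, h3]
      calc _ ≤ ‖e (p l).1‖ * √h * (κ * ‖mulOp (cellInd T h J) (g l)‖) :=
            mul_le_mul (abs_inner_toL2_bump_le hh _ J) h4 (norm_nonneg _) (by positivity)
        _ = _ := by ring
    have h5 : ‖R (∑ l, C (p l).1 J • mulOp (bump T h J) (g l))‖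
        ≤ √h * ∑ l, κ * ‖e (p l).1‖ * ‖mulOp (cellInd T h J) (g l)‖ := by
      rw [map_sum, Finset.mul_sum]
      simp_rw [map_smul]
      exact norm_sum_le_of_le _ fun l _ => h2 l
    calc _ ≤ (√h * ∑ l, κ * ‖e (p l).1‖ * ‖mulOp (cellInd T h J) (g l)‖) ^ 2 := by
          gcongr
          exact (norm_mulOp_cellInd_le hh J _).trans h5
      _ = h * (∑ l, κ * ‖e (p l).1‖ * ‖mulOp (cellInd T h J) (g l)‖) ^ 2 := by
          rw [mul_pow, Real.sq_sqrt hh.le]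
      _ ≤ h * ((n + 1) * ∑ l, (κ * ‖e (p l).1‖ * ‖mulOp (cellInd T h J) (g l)‖) ^ 2) := by
          gcongr
          have := sq_sum_le_card_mul_sum_sq (s := Finset.univ)
            (f := fun l : Fin (n + 1) => κ * ‖e (p l).1‖ * ‖mulOp (cellInd T h J) (g l)‖)
          simpa using this
      _ = _ := by simp_rw [mul_pow]
  refine (Finset.sum_le_sum h1).trans (le_of_eq ?_)
  rw [← Finset.mul_sum, ← Finset.mul_sum, Finset.sum_comm]
  simp_rw [← Finset.mul_sum, sum_norm_sq_mulOp_cellInd hh hN]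
  rfl

/-- As the mesh tends to zero, the rotated coefficients of the discretized expansion converge to the
coefficients of the chaos expansion. -/
theorem tendsto_rotatedChaos (hT : 0 < T)
    (hκ : ∀ e g, ‖R (mulOp e g)‖ ≤ κ * (‖toL2 e‖ * ‖g‖))
    (hR : ∀ (f : Lp H 2 (volume.restrict (Ioo 0 T))) (a : ℝ),
      (∀ᵐ t ∂volume.restrict (Ioo 0 T), t < a → f t = 0) →
        ∀ᵐ t ∂volume.restrict (Ioo 0 T), t < a → R f t = 0)
    (hB : ∀ k e x, mulOp e (B k x) = B k (mulOp e x))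
    (e : ℕ → Lp ℝ ∞ (volume.restrict (Ioo 0 T))) {L : ℕ}
    {C : ℕ → ℕ → ℕ → ℝ}
    (hC : ∀ N i J, C N i J = inner ℝ (toL2 (e i)) (toL2 (bump T (mesh T N) J)))
    (n : ℕ) (p : Fin n → ℕ × ℕ) (hp : ∀ l, (p l).2 < L) :
    Tendsto (fun N => rotatedChaos R B (mesh T N) v₀ (C N) L (N + 1) n p) atTop
        (𝓝 (chaos R B e v₀ n p)) ∧
      Tendsto (fun N => adaptedChaos R B (mesh T N) v₀ (C N) L (N + 1) n p) atTop
        (𝓝 (chaos R B e v₀ n p)) := by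
  induction n with
  | zero =>
    simp only [adaptedChaos, rotatedChaos_zero, chaos,
      sum_mulOp_cellInd (mesh_pos hT _) (mul_mesh T _)]
    exact ⟨tendsto_const_nhds, tendsto_const_nhds⟩
  | succ n ih =>
    have h1 : ∀ l : Fin (n + 1), Tendsto (fun N => B (p l).2
        (adaptedChaos R B (mesh T N) v₀ (C N) L (N + 1) n fun i => p (l.succAbove i))) atTop
        (𝓝 (B (p l).2 (chaos R B e v₀ n fun i => p (l.succAbove i)))) := fun l =>
      ((B (p l).2).continuous.tendsto _).comp (ih (fun i => p (l.succAbove i)) fun i => hp _).2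
    have h2 : Tendsto (fun N => rotatedChaos R B (mesh T N) v₀ (C N) L (N + 1) (n + 1) p) atTop
        (𝓝 (chaos R B e v₀ (n + 1) p)) := by
      rw [chaos, map_sum]
      simp_rw [rotatedChaos_succ_eq R v₀ hB (mesh_pos hT _) _ _ hp, map_sum R]
      refine tendsto_finsetSum _ fun l _ => tendsto_apply_mulOp hκ ?_ (h1 l)
      simp_rw [map_sum, map_smul, hC]
      exact tendsto_sum_inner_smul_bump hT (toL2 (e (p l).1))
    refine ⟨h2, ?_⟩
    have h3 : Tendsto (fun N => mesh T N * ((n + 1) * ∑ l, (κ * ‖e (p l).1‖) ^ 2 *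
        ‖B (p l).2 (adaptedChaos R B (mesh T N) v₀ (C N) L (N + 1) n
          fun i => p (l.succAbove i))‖ ^ 2)) atTop (𝓝 0) := by
      have := (tendsto_mesh T).mul ((tendsto_finsetSum Finset.univ fun l (_ : l ∈ Finset.univ) =>
        (((h1 l).norm.pow 2).const_mul ((κ * ‖e (p l).1‖) ^ 2))).const_mul (n + 1 : ℝ))
      rwa [zero_mul] at this
    have h4 : Tendsto (fun N => ‖rotatedChaos R B (mesh T N) v₀ (C N) L (N + 1) (n + 1) p
        - adaptedChaos R B (mesh T N) v₀ (C N) L (N + 1) (n + 1) p‖ ^ 2) atTop (𝓝 0) :=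
      squeeze_zero (fun _ => sq_nonneg _) (fun N => norm_sq_rotatedChaos_sub_adaptedChaos_le hκ hR
        hB (mesh_pos hT N) e (mul_mesh T N) hp (hC N)) h3
    have h5 := (tendsto_zero_iff_norm_tendsto_zero.2
      (by simpa using h4.sqrt : Tendsto (fun N =>
        ‖rotatedChaos R B (mesh T N) v₀ (C N) L (N + 1) (n + 1) p
        - adaptedChaos R B (mesh T N) v₀ (C N) L (N + 1) (n + 1) p‖) atTop (𝓝 0)))
    have h6 := h2.sub h5
    simpa using h6

/-- A bound for the discretized expansion that is uniform in the mesh passes to the chaos expansion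
with respect to an arbitrary orthonormal system. -/
theorem sum_chaos_le_of_cellChaos_le (S : NormalTriple V H) (hT : 0 < T)
    (hκ : ∀ e g, ‖R (mulOp e g)‖ ≤ κ * (‖toL2 e‖ * ‖g‖))
    (hR : ∀ (f : Lp H 2 (volume.restrict (Ioo 0 T))) (a : ℝ),
      (∀ᵐ t ∂volume.restrict (Ioo 0 T), t < a → f t = 0) →
        ∀ᵐ t ∂volume.restrict (Ioo 0 T), t < a → R f t = 0)
    (hB : ∀ k e x, mulOp e (B k x) = B k (mulOp e x))
    {e : ℕ → Lp ℝ ∞ (volume.restrict (Ioo 0 T))} (he : Orthonormal ℝ fun i => toL2 (e i))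
    {L n : ℕ} {β : ℝ → ℝ}
    (hβ : ∀ N, ∀ᵐ t ∂volume.restrict (Ioo 0 T),
      ∑ q ∈ Fintype.piFinset fun _ : Fin n => Finset.range (N + 1) ×ˢ Finset.range L,
        ‖S.emb (cellChaos R B (mesh T N) v₀ n q t)‖ ^ 2 ≤ β t) (I : Finset ℕ) :
    ∀ᵐ t ∂volume.restrict (Ioo 0 T),
      ∑ p ∈ Fintype.piFinset fun _ : Fin n => I ×ˢ Finset.range L,
        ‖S.emb (chaos R B e v₀ n p t)‖ ^ 2 ≤ β t := by
  set C : ℕ → ℕ → ℕ → ℝ := fun N i J => inner ℝ (toL2 (e i)) (toL2 (bump T (mesh T N) J))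
  have h1 : ∀ N, ∀ᵐ t ∂volume.restrict (Ioo 0 T),
      ∑ p ∈ Fintype.piFinset fun _ : Fin n => I ×ˢ Finset.range L,
        ‖S.emb (rotatedChaos R B (mesh T N) v₀ (C N) L (N + 1) n p t)‖ ^ 2 ≤ β t := by
    intro N
    have h2 : ∀ᵐ t ∂volume.restrict (Ioo 0 T), ∀ p : Fin n → ℕ × ℕ,
        S.emb (rotatedChaos R B (mesh T N) v₀ (C N) L (N + 1) n p t)
        = ∑ q ∈ Fintype.piFinset fun _ : Fin n => Finset.range (N + 1) ×ˢ Finset.range L,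
          (∏ l, kronId (C N) (p l) (q l)) • S.emb (cellChaos R B (mesh T N) v₀ n q t) := by
      refine ae_all_iff.2 fun p => ?_
      filter_upwards [Lp.coeFn_finsetSum
        (Fintype.piFinset fun _ : Fin n => Finset.range (N + 1) ×ˢ Finset.range L)
        fun q => (∏ l, kronId (C N) (p l) (q l)) • cellChaos R B (mesh T N) v₀ n q,
        ae_all_iff.2 fun q : Fin n → ℕ × ℕ => Lp.coeFn_smul (∏ l, kronId (C N) (p l) (q l))
          (cellChaos R B (mesh T N) v₀ n q)] with t h3 h4
      rw [rotatedChaos, h3, Finset.sum_apply, map_sum]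
      refine Finset.sum_congr rfl fun q _ => ?_
      rw [h4, Pi.smul_apply, map_smul]
    filter_upwards [h2, hβ N] with t h3 h4
    simp_rw [h3]
    exact (sum_norm_sq_prod_le_of_contraction (kronId_contraction (sum_inner_mul_sq_le he
      (toL2_bump_inner (mesh_pos hT N) (mul_mesh T N)) I) (Finset.range L)) n _).trans h4
  obtain ⟨φ, _, h2⟩ := exists_subseq_tendsto_ae
    (Fintype.piFinset fun _ : Fin n => I ×ˢ Finset.range L)
    (x := fun N p => rotatedChaos R B (mesh T N) v₀ (C N) L (N + 1) n p)
    (y := fun p => chaos R B e v₀ n p) fun p hp =>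
      (tendsto_rotatedChaos hT hκ hR hB e (fun _ _ _ => rfl) n p fun l =>
        Finset.mem_range.1 (Finset.mem_product.1 (Fintype.mem_piFinset.1 hp l)).2).1
  filter_upwards [h2, ae_all_iff.2 h1] with t h3 h4
  refine le_of_tendsto (tendsto_finsetSum _ fun p hp =>
    (((S.emb.continuous.tendsto _).comp (h3 p hp)).norm.pow 2))
    (Eventually.of_forall fun N => h4 (φ N))

end Limit

section SolutionOperator

variable {V H : Type*} [NormedAddCommGroup V] [InnerProductSpace ℝ V] [CompleteSpace V]
  [NormedAddCommGroup H] [InnerProductSpace ℝ H] [CompleteSpace H] {T K c : ℝ}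
  {A : ℝ → V →L[ℝ] StrongDual ℝ V}

/-- Since the energy estimate involves the `L₁` norm of the forcing term, only the `L₂` norm of the
multiplier enters. -/
theorem norm_solutionOp_mulOp_le (S : NormalTriple V H) (hT : 0 < T)
    (hA : IsCoerciveFamily T A K c) (e : Lp ℝ ∞ (volume.restrict (Ioo 0 T)))
    (g : Lp H 2 (volume.restrict (Ioo 0 T))) :
    ‖solutionOp S hT hA (mulOp e g)‖ ≤ (√(2 * c))⁻¹ * (‖toL2 e‖ * ‖g‖) := by
  have h1 := (isSolution_solutionOp S hT hA (mulOp e g)).integral_norm_sq_le hT hA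
    (right_mem_Icc.2 hT.le)
  rw [← integral_timeInterval_eq hT.le, ← integral_timeInterval_eq hT.le,
    ← norm_sq_eq_integral] at h1
  have h2 : (∫ s in Ioo 0 T, ‖mulOp e g s‖) ^ 2 ≤ ‖toL2 e‖ ^ 2 * ‖g‖ ^ 2 := by
    have e1 : ∫ s in Ioo 0 T, ‖mulOp e g s‖ = ∫ s in Ioo 0 T, ‖toL2 e s‖ * ‖g s‖ := by
      refine integral_congr_ae ?_
      filter_upwards [coeFn_mulOp e g, coeFn_toL2 e] with s h3 h4
      rw [h3, h4, norm_smul]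
    rw [e1, norm_sq_eq_integral, norm_sq_eq_integral]
    exact sq_integral_mul_le (Lp.memLp _).norm (Lp.memLp _).norm
  have hc : 0 < 2 * c := by linarith [hA.pos]
  have hc' := Real.sqrt_pos.2 hc
  rw [← div_eq_inv_mul, le_div_iff₀' hc']
  refine le_of_sq_le_sq ?_ (by positivity)
  rw [mul_pow, mul_pow, Real.sq_sqrt hc.le]
  exact h1.trans h2

end SolutionOperator

/-! ### From sequences of indices to multi-indices -/

section Combinatorics

/-- The factorial `α! = ∏_{i,k} α_i^k!` of a multi-index. -/
def multiFactorial (α : MultiIndex) : ℕ := α.prod fun _ a => a.factorial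

/-- The multi-index that counts the values of a finite sequence. -/
def tally {n : ℕ} (p : Fin n → ℕ × ℕ) : MultiIndex := ∑ l, Finsupp.single (p l) 1

theorem lower_add_single {α : MultiIndex} {r : ℕ × ℕ} (hr : r ∈ α.support) :
    lower α r + Finsupp.single r 1 = α := by
  have h1 : Finsupp.single r 1 ≤ α :=
    Finsupp.single_le_iff.2 (Nat.one_le_iff_ne_zero.2 (Finsupp.mem_support_iff.1 hr))
  exact tsub_add_cancel_of_le h1

theorem multiFactorial_eq {α : MultiIndex} {r : ℕ × ℕ} (hr : r ∈ α.support) :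
    multiFactorial α = α r * multiFactorial (lower α r) := by
  have h0 : ∀ i : ℕ × ℕ, (fun (_ : ℕ × ℕ) (a : ℕ) => a.factorial) i 0 = 1 := fun _ => rfl
  have h1 : (lower α r).erase r = α.erase r := by
    ext i
    by_cases hi : i = r
    · simp [hi]
    · simp [hi, lower]
  have h2 : lower α r r = α r - 1 := by simp [lower]
  have h3 : α r ≠ 0 := Finsupp.mem_support_iff.1 hr
  rw [multiFactorial, multiFactorial, ← Finsupp.mul_prod_erase' α r _ h0,
    ← Finsupp.mul_prod_erase' (lower α r) r _ h0, h1, h2, ← mul_assoc, Nat.mul_factorial_pred h3]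

theorem order_add (α β : MultiIndex) : order (α + β) = order α + order β :=
  Finsupp.sum_add_index' (fun _ => rfl) fun _ _ _ => rfl

theorem order_lower {α : MultiIndex} {r : ℕ × ℕ} (hr : r ∈ α.support) {n : ℕ}
    (hα : order α = n + 1) : order (lower α r) = n := by
  rw [← lower_add_single hr, order_add] at hα
  simpa [order] using hα

theorem tally_succAbove {n : ℕ} (p : Fin (n + 1) → ℕ × ℕ) (l : Fin (n + 1)) :
    tally p = tally (fun i => p (l.succAbove i)) + Finsupp.single (p l) 1 := by
  rw [tally, Fin.sum_univ_succAbove _ l, add_comm]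
  rfl

theorem mem_support_tally {n : ℕ} (p : Fin n → ℕ × ℕ) (l : Fin n) : p l ∈ (tally p).support := by
  rw [Finsupp.mem_support_iff, tally, Finsupp.finsetSum_apply]
  refine (Finset.sum_pos' (fun _ _ => Nat.zero_le _) ⟨l, Finset.mem_univ l, ?_⟩).ne'
  simp

theorem lower_tally {n : ℕ} (p : Fin (n + 1) → ℕ × ℕ) (l : Fin (n + 1)) :
    lower (tally p) (p l) = tally fun i => p (l.succAbove i) := by
  rw [tally_succAbove p l, lower, add_tsub_cancel_right]

/-- Summation over the terms of a sequence, grouped by their values. -/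
theorem sum_eq_sum_support_tally {M : Type*} [AddCommGroup M] [Module ℝ M] {n : ℕ}
    (p : Fin n → ℕ × ℕ) (f : ℕ × ℕ → M) :
    ∑ l, f (p l) = ∑ r ∈ (tally p).support, (tally p r : ℝ) • f r := by
  have h1 := Finsupp.sum_finsetSum_index (s := Finset.univ)
    (g := fun l : Fin n => (Finsupp.single (p l) 1 : MultiIndex))
    (h := fun r a => (a : ℝ) • f r) (fun _ => by simp) fun _ _ _ => by
      push_cast
      rw [add_smul]
  have h2 : ∀ l : Fin n, (Finsupp.single (p l) 1 : MultiIndex).sum (fun r a => (a : ℝ) • f r)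
      = f (p l) := fun l => by
    rw [Finsupp.sum_single_index] <;> simp
  simp_rw [h2] at h1
  exact h1

/-- A multi-index `α` of order `n` is the tally of `n! / α!` sequences. -/
theorem sum_multiFactorial_tally (Q : Finset (ℕ × ℕ)) (n : ℕ) (α : MultiIndex)
    (hα : order α = n) (hQ : α.support ⊆ Q) :
    ∑ p ∈ Fintype.piFinset fun _ : Fin n => Q, (if tally p = α then multiFactorial α else 0)
      = n.factorial := by
  induction n generalizing α with
  | zero =>
    have h0 : α = 0 := by
      ext i
      have h1 := (Finset.sum_eq_zero_iff.1 hα) i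
      by_contra h2
      exact h2 (h1 (Finsupp.mem_support_iff.2 h2))
    subst h0
    simp [tally, multiFactorial]
  | succ n ih =>
    simp_rw [tally_succAbove _ (0 : Fin (n + 1))]
    rw [sum_piFinset_succAbove (0 : Fin (n + 1)) Q fun r p =>
      if tally p + Finsupp.single r 1 = α then multiFactorial α else 0]
    have h1 : ∀ r ∈ α.support, ∑ p ∈ Fintype.piFinset fun _ : Fin n => Q,
        (if tally p + Finsupp.single r 1 = α then multiFactorial α else 0)
          = α r * n.factorial := by
      intro r hr
      rw [← ih (lower α r) (order_lower hr hα) ((Finsupp.support_mono tsub_le_self).trans hQ),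
        Finset.mul_sum]
      refine Finset.sum_congr rfl fun p _ => ?_
      have h2 : tally p + Finsupp.single r 1 = α ↔ tally p = lower α r := by
        constructor
        · rintro rfl
          rw [lower, add_tsub_cancel_right]
        · intro h3
          rw [h3, lower_add_single hr]
      simp only [h2, mul_ite, mul_zero, multiFactorial_eq hr]
    rw [← Finset.sum_subset hQ, Finset.sum_congr rfl h1, ← Finset.sum_mul, Nat.factorial_succ,
      ← hα]
    · rfl
    · intro r _ hr
      refine Finset.sum_eq_zero fun p _ => if_neg fun h2 => hr ?_
      rw [Finsupp.mem_support_iff, ← h2]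
      simp

end Combinatorics

section Coefficients

variable {V H : Type*} [NormedAddCommGroup V] [InnerProductSpace ℝ V]
  [NormedAddCommGroup H] [InnerProductSpace ℝ H] {T : ℝ}
  {R : Lp H 2 (volume.restrict (Ioo 0 T)) →ₗ[ℝ] Lp V 2 (volume.restrict (Ioo 0 T))}
  {B : ℕ → Lp V 2 (volume.restrict (Ioo 0 T)) →L[ℝ] Lp H 2 (volume.restrict (Ioo 0 T))}
  {e : ℕ → Lp ℝ ∞ (volume.restrict (Ioo 0 T))}
  {w : MultiIndex → Lp V 2 (volume.restrict (Ioo 0 T))}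

/-- The symmetrized form of the propagator: `chaos n p` is the coefficient of the tally of `p`, up
to normalization. -/
theorem chaos_eq_smul
    (hw : ∀ α, α ≠ 0 → w α = R (∑ r ∈ α.support,
      √(α r : ℝ) • mulOp (e r.1) (B r.2 (w (lower α r))))) (n : ℕ) (p : Fin n → ℕ × ℕ) :
    chaos R B e (w 0) n p = √(multiFactorial (tally p) : ℝ) • w (tally p) := by
  induction n with
  | zero => simp [chaos, tally, multiFactorial]
  | succ n ih =>
    have h0 : tally p ≠ 0 := fun h => by
      have := mem_support_tally p 0
      simp [h] at this
    rw [chaos, hw _ h0, ← map_smul]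
    congr 1
    simp_rw [ih, ← lower_tally, map_smul]
    rw [sum_eq_sum_support_tally p fun r => √(multiFactorial (lower (tally p) r) : ℝ) •
      mulOp (e r.1) (B r.2 (w (lower (tally p) r))), Finset.smul_sum]
    refine Finset.sum_congr rfl fun r hr => ?_
    rw [smul_smul, smul_smul, multiFactorial_eq hr]
    push_cast
    rw [Real.sqrt_mul (Nat.cast_nonneg _), mul_right_comm, Real.mul_self_sqrt (Nat.cast_nonneg _)]

/-- The sum over sequences counts each coefficient of order `n` exactly `n!` times. -/
theorem sum_coeff_le_of_chaos_le (S : NormalTriple V H)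
    (hw : ∀ α, α ≠ 0 → w α = R (∑ r ∈ α.support,
      √(α r : ℝ) • mulOp (e r.1) (B r.2 (w (lower α r))))) {n : ℕ} {β : ℝ → ℝ}
    (hβ : ∀ I L, ∀ᵐ t ∂volume.restrict (Ioo 0 T),
      ∑ p ∈ Fintype.piFinset fun _ : Fin n => Finset.range I ×ˢ Finset.range L,
        ‖S.emb (chaos R B e (w 0) n p t)‖ ^ 2 ≤ β t)
    (F : Finset MultiIndex) (hF : ∀ α ∈ F, order α = n) :
    ∀ᵐ t ∂volume.restrict (Ioo 0 T), n.factorial * ∑ α ∈ F, ‖S.emb (w α t)‖ ^ 2 ≤ β t := by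
  obtain ⟨N, hN⟩ : ∃ N, ∀ α ∈ F, α.support ⊆ Finset.range N ×ˢ Finset.range N := by
    refine ⟨F.sup (fun α => α.support.sup fun r => max r.1 r.2) + 1, fun α hα r hr => ?_⟩
    have h1 : max r.1 r.2 ≤ F.sup (fun α => α.support.sup fun r => max r.1 r.2) :=
      (Finset.le_sup (f := fun r : ℕ × ℕ => max r.1 r.2) hr).trans
        (Finset.le_sup (f := fun α : MultiIndex => α.support.sup fun r => max r.1 r.2) hα)
    rw [Finset.mem_product, Finset.mem_range, Finset.mem_range]
    omega
  filter_upwards [hβ N N, ae_all_iff.2 fun p : Fin n → ℕ × ℕ =>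
    Lp.coeFn_smul (√(multiFactorial (tally p) : ℝ)) (w (tally p))] with t h1 h2
  refine le_trans ?_ h1
  have h3 : ∀ p : Fin n → ℕ × ℕ, ‖S.emb (chaos R B e (w 0) n p t)‖ ^ 2
      = multiFactorial (tally p) * ‖S.emb (w (tally p) t)‖ ^ 2 := by
    intro p
    rw [chaos_eq_smul hw, h2, Pi.smul_apply, map_smul, norm_smul, mul_pow, Real.norm_eq_abs,
      sq_abs, Real.sq_sqrt (Nat.cast_nonneg _)]
  simp_rw [h3]
  calc (n.factorial : ℝ) * ∑ α ∈ F, ‖S.emb (w α t)‖ ^ 2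
      = ∑ α ∈ F, ∑ p ∈ Fintype.piFinset fun _ : Fin n => Finset.range N ×ˢ Finset.range N,
          (if tally p = α then (multiFactorial (tally p) : ℝ) * ‖S.emb (w (tally p) t)‖ ^ 2
            else 0) := by
        rw [Finset.mul_sum]
        refine Finset.sum_congr rfl fun α hα => ?_
        rw [← sum_multiFactorial_tally _ n α (hF α hα) (hN α hα)]
        push_cast
        rw [Finset.sum_mul]
        refine Finset.sum_congr rfl fun p _ => ?_
        split_ifs with hp
        · rw [hp]
        · rw [zero_mul]
    _ ≤ _ := by
        rw [Finset.sum_comm]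
        refine Finset.sum_le_sum fun p _ => ?_
        rw [Finset.sum_ite_eq]
        split_ifs
        · exact le_rfl
        · positivity

end Coefficients

/-! ### The exponentially weighted equation -/

section Weight

variable {T : ℝ} {E : Type*} [NormedAddCommGroup E] [NormedSpace ℝ E]

theorem memLp_top_exp (T lam : ℝ) :
    MemLp (fun t => Real.exp (-lam * t)) ∞ (volume.restrict (Ioo 0 T)) := by
  refine memLp_top_of_bound (by fun_prop) (Real.exp (|lam| * T)) ?_
  filter_upwards [ae_restrict_mem measurableSet_Ioo] with t ht
  rw [Real.norm_of_nonneg (Real.exp_nonneg _)]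
  refine Real.exp_le_exp.2 ?_
  calc -lam * t ≤ |lam| * t := mul_le_mul_of_nonneg_right (neg_le_abs _) ht.1.le
    _ ≤ |lam| * T := mul_le_mul_of_nonneg_left ht.2.le (abs_nonneg _)

/-- The weight `t ↦ exp (-λ t)`, as an essentially bounded function. -/
def expWeight (T lam : ℝ) : Lp ℝ ∞ (volume.restrict (Ioo 0 T)) := (memLp_top_exp T lam).toLp

theorem coeFn_expWeight (T lam : ℝ) :
    expWeight T lam =ᵐ[volume.restrict (Ioo 0 T)] fun t => Real.exp (-lam * t) :=
  (memLp_top_exp T lam).coeFn_toLp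

/-- The square integrable function `t ↦ exp (-λ t) v(t)`. -/
def weighted (lam : ℝ) {v : ℝ → E} (hv : MemLp v 2 (volume.restrict (Ioo 0 T))) :
    Lp E 2 (volume.restrict (Ioo 0 T)) :=
  mulOp (expWeight T lam) hv.toLp

theorem coeFn_weighted (lam : ℝ) {v : ℝ → E} (hv : MemLp v 2 (volume.restrict (Ioo 0 T))) :
    weighted lam hv =ᵐ[volume.restrict (Ioo 0 T)] fun t => Real.exp (-lam * t) • v t := by
  filter_upwards [coeFn_mulOp (expWeight T lam) hv.toLp, coeFn_expWeight T lam, hv.coeFn_toLp]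
    with t h1 h2 h3
  rw [weighted, h1, h2, h3]

end Weight

section Shift

variable {V H : Type*} [NormedAddCommGroup V] [InnerProductSpace ℝ V]
  [NormedAddCommGroup H] [InnerProductSpace ℝ H] {T : ℝ}
  {A : ℝ → V →L[ℝ] StrongDual ℝ V} {M : ℕ → ℝ → V →L[ℝ] H}

/-- The operators `A(t) - λ`, which govern `exp (-λ t) u(t)`. -/
def NormalTriple.shift (S : NormalTriple V H) (A : ℝ → V →L[ℝ] StrongDual ℝ V) (lam : ℝ) :
    ℝ → V →L[ℝ] StrongDual ℝ V :=
  fun t => A t - lam • S.dualEmbL.comp S.emb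

theorem NormalTriple.shift_apply (S : NormalTriple V H) (A : ℝ → V →L[ℝ] StrongDual ℝ V)
    (lam t : ℝ) (v : V) : S.shift A lam t v = A t v - lam • S.dualEmb (S.emb v) := rfl

theorem NormalTriple.shift_apply_self (S : NormalTriple V H) (A : ℝ → V →L[ℝ] StrongDual ℝ V)
    (lam t : ℝ) (v : V) : S.shift A lam t v v = A t v v - lam * ‖S.emb v‖ ^ 2 := by
  rw [S.shift_apply, sub_apply, smul_apply, S.dualEmb_apply, real_inner_self_eq_norm_sq,
    smul_eq_mul]

theorem IsCoefficientFamily.isBddFamily_A (h : IsCoefficientFamily T A M) :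
    ∃ K, IsBddFamily (volume.restrict (Ioo 0 T)) A K := by
  obtain ⟨K, hK⟩ := h.bounded_A
  refine ⟨K, h.measurable_A, ?_⟩
  filter_upwards [ae_restrict_mem measurableSet_Ioo] with t ht
  exact hK t (Ioo_subset_Icc_self ht)

theorem IsCoefficientFamily.isCoerciveFamily_shift (h : IsCoefficientFamily T A M)
    (S : NormalTriple V H) {lam c : ℝ} (hc : 0 < c)
    (hco : ∀ t ∈ Icc 0 T, ∀ v, A t v v - lam * ‖S.emb v‖ ^ 2 ≤ -c * ‖v‖ ^ 2) :
    ∃ K, IsCoerciveFamily T (S.shift A lam) K c := by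
  obtain ⟨K, hK⟩ := h.isBddFamily_A
  refine ⟨K + ‖lam • S.dualEmbL.comp S.emb‖, ⟨fun v => ?_, ?_⟩, hc, ?_⟩
  · exact (hK.meas v).sub aestronglyMeasurable_const
  · filter_upwards [hK.bound] with t ht
    exact (norm_sub_le _ _).trans (add_le_add_left ht _)
  · filter_upwards [ae_restrict_mem measurableSet_Ioo] with t ht v
    rw [S.shift_apply_self]
    exact hco t (Ioo_subset_Icc_self ht) v

/-- Parabolicity and the bound for `A(t)` imply that `∑_k ‖M_k(t) v‖²` is bounded by a constant
times `‖v‖_V²`. -/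
theorem StronglyParabolic.exists_bound {S : NormalTriple V H} (hAM : IsCoefficientFamily T A M)
    {ε C₀ : ℝ} (hε : 0 < ε) (h : StronglyParabolic S T A M ε C₀) :
    ∃ K, 0 < K ∧ ∀ t ∈ Icc 0 T, ∀ v, ∑' k, ‖M k t v‖ ^ 2 ≤ K * ‖v‖ ^ 2 := by
  obtain ⟨K, hK⟩ := hAM.bounded_A
  refine ⟨|C₀| * ‖S.emb‖ ^ 2 + 2 * |K| + 1, by positivity, fun t ht v => ?_⟩
  have h1 := h t ht v
  have h2 : -(|K| * ‖v‖ * ‖v‖) ≤ A t v v := by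
    have h3 : ‖A t v v‖ ≤ |K| * ‖v‖ * ‖v‖ :=
      (A t v).le_of_opNorm_le ((A t).le_of_opNorm_le ((hK t ht).trans (le_abs_self K)) v) v
    exact (abs_le.1 h3).1
  have h4 : C₀ * ‖S.emb v‖ ^ 2 ≤ |C₀| * (‖S.emb‖ * ‖v‖) ^ 2 :=
    (mul_le_mul_of_nonneg_right (le_abs_self C₀) (sq_nonneg _)).trans
      (mul_le_mul_of_nonneg_left (pow_le_pow_left₀ (norm_nonneg _) (S.emb.le_opNorm v) 2)
        (abs_nonneg _))
  nlinarith [mul_nonneg hε.le (sq_nonneg ‖v‖), sq_nonneg ‖v‖]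

theorem IsCoefficientFamily.sum_le (hAM : IsCoefficientFamily T A M) {t : ℝ} (ht : t ∈ Icc 0 T)
    (v : V) (s : Finset ℕ) : ∑ k ∈ s, ‖M k t v‖ ^ 2 ≤ ∑' k, ‖M k t v‖ ^ 2 :=
  (hAM.summable_M t ht v).sum_le_tsum s fun _ _ => sq_nonneg _

theorem IsCoefficientFamily.isBddFamily_M (hAM : IsCoefficientFamily T A M) {K : ℝ}
    (hK : ∀ t ∈ Icc 0 T, ∀ v, ∑' k, ‖M k t v‖ ^ 2 ≤ K * ‖v‖ ^ 2) (k : ℕ) :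
    IsBddFamily (volume.restrict (Ioo 0 T)) (M k) √K := by
  refine ⟨hAM.measurable_M k, ?_⟩
  filter_upwards [ae_restrict_mem measurableSet_Ioo] with t ht
  have ht' := Ioo_subset_Icc_self ht
  refine ContinuousLinearMap.opNorm_le_bound _ (Real.sqrt_nonneg _) fun v => ?_
  have h1 := (hAM.sum_le ht' v {k}).trans (hK t ht' v)
  rw [Finset.sum_singleton] at h1
  have h2 := Real.sqrt_le_sqrt h1
  rwa [Real.sqrt_sq (norm_nonneg _), Real.sqrt_mul' _ (sq_nonneg _),
    Real.sqrt_sq (norm_nonneg _)] at h2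

variable {u₀ : H} {m : HilbertBasis ℕ ℝ (Lp ℝ 2 (volume.restrict (Ioo 0 T)))}
  {v : MultiIndex → ℝ → V} {u : MultiIndex → ℝ → H} {K : ℝ}

/-- The propagator with the terms of the adjoint of the Malliavin derivative collected in one
forcing term. -/
theorem IsWienerChaosSolution.equation_eq_integral {S : NormalTriple V H}
    (hv : IsWienerChaosSolution S T A M (fun i => m i) u₀ v)
    (hu : IsContinuousVersion S T v u) {KA : ℝ}
    (hA : IsBddFamily (volume.restrict (Ioo 0 T)) A KA)
    (hM : ∀ k, IsBddFamily (volume.restrict (Ioo 0 T)) (M k) K)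
    (hm : ∀ i, MemLp (m i) ∞ (volume.restrict (Ioo 0 T))) (α : MultiIndex) :
    ∀ᵐ t ∂volume.restrict (Ioo 0 T), S.dualEmb (S.emb (v α t)) =
      (if α = 0 then S.dualEmb u₀ else 0) + ∫ s in (0 : ℝ)..t, (A s (v α s) + S.dualEmb
        ((∑ r ∈ α.support, √(α r : ℝ) • mulOp (hm r.1).toLp
          ((hM r.2).op (hu.memLp (lower α r)).toLp) :
            Lp H 2 (volume.restrict (Ioo 0 T))) s)) := by
  set F : ℕ × ℕ → Lp H 2 (volume.restrict (Ioo 0 T)) := fun r =>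
    √(α r : ℝ) • mulOp (hm r.1).toLp ((hM r.2).op (hu.memLp (lower α r)).toLp)
  have hF : ∀ r, ∀ᵐ s ∂volume.restrict (Ioo 0 T),
      (√(α r : ℝ) * m r.1 s) • S.dualEmb (M r.2 s (v (lower α r) s)) = S.dualEmb (F r s) := by
    intro r
    filter_upwards [Lp.coeFn_smul √(α r : ℝ) (mulOp (hm r.1).toLp
      ((hM r.2).op (hu.memLp (lower α r)).toLp)), coeFn_mulOp (hm r.1).toLp
      ((hM r.2).op (hu.memLp (lower α r)).toLp), (hm r.1).coeFn_toLp,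
      (hM r.2).coeFn_op (hu.memLp (lower α r)).toLp, (hu.memLp (lower α r)).coeFn_toLp]
      with s h1 h2 h3 h4 h5
    rw [h1, Pi.smul_apply, h2, h3, h4, h5, ← S.dualEmbL_apply, ← S.dualEmbL_apply, map_smul,
      map_smul, smul_smul]
  have hAi : MemLp (fun s => A s (v α s)) 2 (volume.restrict (Ioo 0 T)) := hA.memLp (hu.memLp α)
  filter_upwards [hv.equation α, ae_restrict_mem measurableSet_Ioo] with t h1 ht
  have ht' := Ioo_subset_Icc_self ht
  have h0 : (0 : ℝ) ∈ Icc 0 T := left_mem_Icc.2 (ht'.1.trans ht'.2)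
  rw [h1, add_assoc]
  congr 1
  rw [intervalIntegral.integral_add (intervalIntegrable_of_memLp hAi h0 ht')
    (intervalIntegrable_of_memLp (memLp_dualEmb S (Lp.memLp _)) h0 ht')]
  congr 1
  have h2 : ∫ s in (0 : ℝ)..t, S.dualEmb ((∑ r ∈ α.support, F r :
      Lp H 2 (volume.restrict (Ioo 0 T))) s)
      = ∫ s in (0 : ℝ)..t, ∑ r ∈ α.support, S.dualEmb (F r s) := by
    refine intervalIntegral_congr_ae_Ioo ht' ?_
    filter_upwards [Lp.coeFn_finsetSum α.support F] with s h3
    rw [h3, Finset.sum_apply, ← S.dualEmbL_apply, map_sum]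
    rfl
  rw [h2, intervalIntegral.integral_finsetSum fun r _ =>
    intervalIntegrable_of_memLp (memLp_dualEmb S (Lp.memLp _)) h0 ht', malliavinAdjoint]
  exact Finset.sum_congr rfl fun r _ => intervalIntegral_congr_ae_Ioo ht' (hF r)

/-- The weighted coefficients solve the propagator for the shifted operators. -/
theorem IsWienerChaosSolution.equation_weighted {S : NormalTriple V H}
    (hv : IsWienerChaosSolution S T A M (fun i => m i) u₀ v)
    (hu : IsContinuousVersion S T v u) {KA : ℝ}
    (hA : IsBddFamily (volume.restrict (Ioo 0 T)) A KA)
    (hM : ∀ k, IsBddFamily (volume.restrict (Ioo 0 T)) (M k) K)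
    (hm : ∀ i, MemLp (m i) ∞ (volume.restrict (Ioo 0 T))) (lam : ℝ) (α : MultiIndex) :
    ∀ᵐ t ∂volume.restrict (Ioo 0 T), S.dualEmb (S.emb (weighted lam (hu.memLp α) t)) =
      (if α = 0 then S.dualEmb u₀ else 0) + ∫ s in (0 : ℝ)..t,
        (S.shift A lam s (weighted lam (hu.memLp α) s) + S.dualEmb
          ((∑ r ∈ α.support, √(α r : ℝ) • mulOp (hm r.1).toLp
            ((hM r.2).op (weighted lam (hu.memLp (lower α r)))) :
              Lp H 2 (volume.restrict (Ioo 0 T))) s)) := by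
  set y : StrongDual ℝ V := if α = 0 then S.dualEmb u₀ else 0
  set G : Lp H 2 (volume.restrict (Ioo 0 T)) := ∑ r ∈ α.support, √(α r : ℝ) •
    mulOp (hm r.1).toLp ((hM r.2).op (hu.memLp (lower α r)).toLp)
  have hG : (∑ r ∈ α.support, √(α r : ℝ) • mulOp (hm r.1).toLp
      ((hM r.2).op (weighted lam (hu.memLp (lower α r)))) :
        Lp H 2 (volume.restrict (Ioo 0 T))) = mulOp (expWeight T lam) G := by
    rw [map_sum]
    refine Finset.sum_congr rfl fun r _ => ?_
    rw [map_smul, mulOp_comm, mulOp_op (hM r.2) (expWeight T lam)]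
    rfl
  rw [hG]
  have h1 := hv.equation_eq_integral hu hA hM hm α
  have hx : MemLp (fun s => A s (v α s) + S.dualEmb (G s)) 2 (volume.restrict (Ioo 0 T)) :=
    (hA.memLp (hu.memLp α)).add (memLp_dualEmb S (Lp.memLp G))
  filter_upwards [h1, coeFn_weighted lam (hu.memLp α), ae_restrict_mem measurableSet_Ioo]
    with t h2 h3 ht
  have ht' := Ioo_subset_Icc_self ht
  rw [h3, ← S.dualEmbL_apply, map_smul, map_smul, S.dualEmbL_apply, h2,
    exp_smul_primitive ht'.1 lam (integrableOn_Ioc_of_memLp hx ht'.2) y]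
  congr 1
  refine intervalIntegral_congr_ae_Ioo ht' ?_
  filter_upwards [h1, coeFn_weighted lam (hu.memLp α), coeFn_mulOp (expWeight T lam) G,
    coeFn_expWeight T lam] with s h4 h5 h6 h7
  rw [← h4, h5, h6, h7, S.shift_apply, ← S.dualEmbL_apply, ← S.dualEmbL_apply, ← S.dualEmbL_apply,
    ← S.dualEmbL_apply]
  simp only [map_smul]
  module

end Shift

section Bound

variable {V H : Type*} [NormedAddCommGroup V] [InnerProductSpace ℝ V] [CompleteSpace V]
  [NormedAddCommGroup H] [InnerProductSpace ℝ H] [CompleteSpace H] {T : ℝ}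
  {A : ℝ → V →L[ℝ] StrongDual ℝ V} {M : ℕ → ℝ → V →L[ℝ] H}
  {u₀ : H} {m : HilbertBasis ℕ ℝ (Lp ℝ 2 (volume.restrict (Ioo 0 T)))}
  {v : MultiIndex → ℝ → V} {u : MultiIndex → ℝ → H} {K : ℝ}

/-- A bound for the discretized expansion of the weighted equation yields a bound for
the coefficients of order `n` of the Wiener chaos solution. -/
theorem IsWienerChaosSolution.sum_le_of_cellChaos_le {S : NormalTriple V H} (hT : 0 < T)
    (hv : IsWienerChaosSolution S T A M (fun i => m i) u₀ v)
    (hu : IsContinuousVersion S T v u) {KA : ℝ}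
    (hA : IsBddFamily (volume.restrict (Ioo 0 T)) A KA)
    (hM : ∀ k, IsBddFamily (volume.restrict (Ioo 0 T)) (M k) K)
    (hm : ∀ i, MemLp (m i) ∞ (volume.restrict (Ioo 0 T))) {lam K' c : ℝ}
    (hA' : IsCoerciveFamily T (S.shift A lam) K' c) {n : ℕ} {β : ℝ → ℝ}
    (hβc : Continuous β)
    (hβ : ∀ (h : ℝ) (v₀ : Lp V 2 (volume.restrict (Ioo 0 T))), 0 < h →
      (∀ᵐ t ∂volume.restrict (Ioo 0 T), energy S T (S.shift A lam) v₀ t ≤ ‖u₀‖ ^ 2) →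
      ∀ N L, ∀ᵐ t ∂volume.restrict (Ioo 0 T),
        ∑ q ∈ Fintype.piFinset fun _ : Fin n => Finset.range N ×ˢ Finset.range L,
          energy S T (S.shift A lam)
            (cellChaos (solutionOp S hT hA') (fun k => (hM k).op) h v₀ n q) t ≤ β t)
    (F : Finset MultiIndex) (hF : ∀ α ∈ F, order α = n) {t : ℝ} (ht : t ∈ Icc 0 T) :
    ∑ α ∈ F, ‖u α t‖ ^ 2 ≤ Real.exp (2 * lam * t) * (β t / n.factorial) := by
  set w : MultiIndex → Lp V 2 (volume.restrict (Ioo 0 T)) := fun α => weighted lam (hu.memLp α)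
  set e : ℕ → Lp ℝ ∞ (volume.restrict (Ioo 0 T)) := fun i => (hm i).toLp
  have hwu : ∀ α, ∀ᵐ t ∂volume.restrict (Ioo 0 T),
      S.emb (w α t) = Real.exp (-lam * t) • u α t := by
    intro α
    filter_upwards [coeFn_weighted lam (hu.memLp α), hu.ae_eq α] with t h1 h2
    rw [h1, map_smul, h2]
  have huc : ∀ α, ContinuousOn (fun t => Real.exp (-lam * t) • u α t) (Icc 0 T) := fun α =>
    (by fun_prop : Continuous fun t : ℝ => Real.exp (-lam * t)).continuousOn.smul
      (hu.continuousOn α)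
  have heq := hv.equation_weighted hu hA hM hm lam
  have he : Orthonormal ℝ fun i => toL2 (e i) := by
    have : (fun i => toL2 (e i)) = m := by
      funext i
      apply Lp.ext
      exact (coeFn_toL2 (e i)).trans (hm i).coeFn_toLp
    rw [this]
    exact m.orthonormal
  have h0 : ∀ᵐ t ∂volume.restrict (Ioo 0 T), energy S T (S.shift A lam) (w 0) t ≤ ‖u₀‖ ^ 2 := by
    have h1 := S.energy_le_of_continuousOn hT (u₀ := u₀)
      (hA'.toIsBddFamily.memLp (Lp.memLp (w 0))) (Lp.memLp (w 0)) (huc 0) (hwu 0) (by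
        filter_upwards [heq 0, ae_restrict_mem measurableSet_Ioo] with t h2 ht
        rw [h2, if_pos rfl]
        congr 1
        refine intervalIntegral_congr_ae_Ioo (Ioo_subset_Icc_self ht) ?_
        filter_upwards [Lp.coeFn_zero H 2 (volume.restrict (Ioo 0 T))] with s h3
        rw [Finsupp.support_zero, Finset.sum_empty, h3, Pi.zero_apply, ← S.dualEmbL_apply,
          map_zero, add_zero])
    filter_upwards [h1] with t h2
    rw [energy]
    linarith
  have hw : ∀ α, α ≠ 0 → w α = solutionOp S hT hA' (∑ r ∈ α.support,
      √(α r : ℝ) • mulOp (e r.1) ((hM r.2).op (w (lower α r)))) := by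
    intro α hα
    refine IsSolution.eq_solutionOp hT hA' ?_
    have h1 := heq α
    simp only [if_neg hα, zero_add] at h1
    exact h1
  have hchaos : ∀ I L, ∀ᵐ t ∂volume.restrict (Ioo 0 T),
      ∑ p ∈ Fintype.piFinset fun _ : Fin n => Finset.range I ×ˢ Finset.range L,
        ‖S.emb (chaos (solutionOp S hT hA') (fun k => (hM k).op) e (w 0) n p t)‖ ^ 2 ≤ β t := by
    intro I L
    refine sum_chaos_le_of_cellChaos_le S hT (norm_solutionOp_mulOp_le S hT hA')
      (fun f a hf => (isSolution_solutionOp S hT hA' f).eq_zero_of_lt hT hA' hf)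
      (fun k e x => mulOp_op (hM k) e x) he (fun N => ?_) (Finset.range I)
    filter_upwards [hβ (mesh T N) (w 0) (mesh_pos hT N) h0 (N + 1) L,
      ae_restrict_mem measurableSet_Ioo] with t h1 ht
    exact (Finset.sum_le_sum fun q _ =>
      sq_norm_emb_le_energy S hA' _ (Ioo_subset_Icc_self ht)).trans h1
  have hsum : ∀ᵐ t ∂volume.restrict (Ioo 0 T),
      n.factorial * ∑ α ∈ F, ‖Real.exp (-lam * t) • u α t‖ ^ 2 ≤ β t := by
    have h1 := sum_coeff_le_of_chaos_le (R := solutionOp S hT hA') (B := fun k => (hM k).op)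
      (e := e) (w := w) S hw hchaos F hF
    filter_upwards [h1, ae_all_iff.2 hwu] with t h1 h2
    simpa only [h2] using h1
  have hcont : ContinuousOn (fun t => (n.factorial : ℝ) *
      ∑ α ∈ F, ‖Real.exp (-lam * t) • u α t‖ ^ 2) (Icc 0 T) :=
    continuousOn_const.mul (continuousOn_finsetSum _ fun α _ => (huc α).norm.pow 2)
  have hfin : (n.factorial : ℝ) * ∑ α ∈ F, ‖Real.exp (-lam * t) • u α t‖ ^ 2 ≤ β t :=
    le_of_ae_le_of_continuousOn hT hcont hβc.continuousOn hsum ht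
  have hn : (0 : ℝ) < n.factorial := by positivity
  rw [← le_div_iff₀' hn] at hfin
  have hexp : ∀ α, ‖u α t‖ ^ 2
      = Real.exp (2 * lam * t) * ‖Real.exp (-lam * t) • u α t‖ ^ 2 := by
    intro α
    rw [norm_smul, Real.norm_of_nonneg (Real.exp_nonneg _), mul_pow, ← Real.exp_nat_mul,
      ← mul_assoc, ← Real.exp_add]
    have : 2 * lam * t + ((2 : ℕ) : ℝ) * (-lam * t) = 0 := by push_cast; ring
    rw [this, Real.exp_zero, one_mul]
  simp_rw [hexp]
  rw [← Finset.mul_sum]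
  exact mul_le_mul_of_nonneg_left hfin (Real.exp_nonneg _)

end Bound

theorem summable_and_tsum_le_of_sum_le {ι : Type*} {P : ι → Prop} {f : ι → ℝ} (hf : ∀ i, 0 ≤ f i)
    {r : ℝ} (h : ∀ F : Finset ι, (∀ i ∈ F, P i) → ∑ i ∈ F, f i ≤ r) :
    Summable (fun i : {i // P i} => f i) ∧ ∑' i : {i // P i}, f i ≤ r := by
  have h1 : ∀ F : Finset {i // P i}, ∑ i ∈ F, f i ≤ r := by
    intro F
    have := h (F.map (Function.Embedding.subtype P)) fun i hi => by
      obtain ⟨j, _, rfl⟩ := Finset.mem_map.1 hi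
      exact j.2
    rwa [Finset.sum_map] at this
  exact ⟨summable_of_sum_le (fun i => hf i) h1, Real.tsum_le_of_sum_le (fun i => hf i) h1⟩

end WienerChaos

end

/-! ### The bounds for the coefficients of a given order -/

theorem mainTheorem7
    {V H : Type*} [NormedAddCommGroup V] [InnerProductSpace ℝ V] [CompleteSpace V]
    [NormedAddCommGroup H] [InnerProductSpace ℝ H] [CompleteSpace H]
    (S : WienerChaos.NormalTriple V H) (T : ℝ) (hT : 0 < T)
    (A : ℝ → V →L[ℝ] StrongDual ℝ V) (M : ℕ → ℝ → V →L[ℝ] H)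
    (hAM : WienerChaos.IsCoefficientFamily T A M)
    (ε C₀ : ℝ) (hε : 0 < ε) (hpar : WienerChaos.StronglyParabolic S T A M ε C₀) :
    (∃ b : ℝ, 0 < b ∧
      ∀ (m : HilbertBasis ℕ ℝ (Lp ℝ 2 (volume.restrict (Ioo 0 T)))),
        (∀ i, MemLp (m i) ∞ (volume.restrict (Ioo 0 T))) →
      ∀ (u₀ : H) (v : WienerChaos.MultiIndex → ℝ → V) (u : WienerChaos.MultiIndex → ℝ → H),
        WienerChaos.IsWienerChaosSolution S T A M (fun i => m i) u₀ v →
        WienerChaos.IsContinuousVersion S T v u →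
        ∀ n : ℕ, ∀ t ∈ Icc 0 T,
          Summable (fun α : {α : WienerChaos.MultiIndex // WienerChaos.order α = n} =>
            ‖u α t‖ ^ 2) ∧
          ∑' α : {α : WienerChaos.MultiIndex // WienerChaos.order α = n}, ‖u α t‖ ^ 2
            ≤ Real.exp (C₀ * t) * (‖u₀‖ ^ 2 / (1 + b) ^ n)) ∧
    (∀ C₁ δ C₃ : ℝ, 0 < C₁ → 0 < δ → WienerChaos.Coercive S T A δ C₁ →
      (∀ t ∈ Icc 0 T, ∀ φ : V, ∑' k, ‖M k t φ‖ ^ 2 ≤ C₃ * ‖S.emb φ‖ ^ 2) →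
      ∀ (m : HilbertBasis ℕ ℝ (Lp ℝ 2 (volume.restrict (Ioo 0 T)))),
        (∀ i, MemLp (m i) ∞ (volume.restrict (Ioo 0 T))) →
      ∀ (u₀ : H) (v : WienerChaos.MultiIndex → ℝ → V) (u : WienerChaos.MultiIndex → ℝ → H),
        WienerChaos.IsWienerChaosSolution S T A M (fun i => m i) u₀ v →
        WienerChaos.IsContinuousVersion S T v u →
        ∀ n : ℕ, ∀ t ∈ Icc 0 T,
          Summable (fun α : {α : WienerChaos.MultiIndex // WienerChaos.order α = n} =>
            ‖u α t‖ ^ 2) ∧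
          ∑' α : {α : WienerChaos.MultiIndex // WienerChaos.order α = n}, ‖u α t‖ ^ 2
            ≤ (C₃ * t) ^ n / (n.factorial : ℝ) * Real.exp (2 * C₁ * t) * ‖u₀‖ ^ 2) := by
  obtain ⟨KA, hA⟩ := hAM.isBddFamily_A
  obtain ⟨K, hK0, hK⟩ := hpar.exists_bound hAM hε
  have hM := hAM.isBddFamily_M hK
  constructor
  · -- The surplus `ε ‖v‖²` of the parabolicity condition dominates `b ∑_k ‖M_k v‖²`.
    have hb : 0 < ε / K := div_pos hε hK0
    refine ⟨ε / K, hb, fun m hm u₀ v u hv hu n t ht => ?_⟩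
    obtain ⟨K', hA'⟩ := hAM.isCoerciveFamily_shift S (lam := C₀ / 2) (half_pos hε)
      fun t ht v => by
        have h1 := hpar t ht v
        have h2 : 0 ≤ ∑' k, ‖M k t v‖ ^ 2 := tsum_nonneg fun _ => sq_nonneg _
        linarith
    have hpar' : ∀ L, ∀ᵐ t ∂volume.restrict (Ioo 0 T), ∀ v,
        2 * S.shift A (C₀ / 2) t v v
          + (1 + ε / K) * ∑ k ∈ Finset.range L, ‖M k t v‖ ^ 2 ≤ 0 := by
      intro L
      filter_upwards [ae_restrict_mem measurableSet_Ioo] with t ht v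
      have ht' := Ioo_subset_Icc_self ht
      have h1 := hpar t ht' v
      have h2 := hAM.sum_le ht' v (Finset.range L)
      have h3 : ε / K * ∑ k ∈ Finset.range L, ‖M k t v‖ ^ 2 ≤ ε * ‖v‖ ^ 2 :=
        calc _ ≤ ε / K * (K * ‖v‖ ^ 2) := by
              gcongr
              exact h2.trans (hK t ht' v)
          _ = _ := by field_simp
      rw [S.shift_apply_self]
      linarith
    refine WienerChaos.summable_and_tsum_le_of_sum_le (P := fun α => WienerChaos.order α = n)
      (f := fun α => ‖u α t‖ ^ 2) (fun _ => sq_nonneg _) fun F hF => ?_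
    have h1 := hv.sum_le_of_cellChaos_le hT hu hA hM hm hA'
      (β := fun _ => n.factorial * (‖u₀‖ ^ 2 / (1 + ε / K) ^ n)) continuous_const
      (fun h v₀ hh h0 N L => WienerChaos.sum_cellChaos_le_geometric S hT hA' hM hh h0 N L hb
        (hpar' L) n) F hF ht
    have hn : (n.factorial : ℝ) ≠ 0 := by positivity
    rwa [mul_div_cancel_left₀ _ hn, mul_div_cancel₀ C₀ two_ne_zero] at h1
  · intro C₁ δ C₃ _ hδ hco hC₃ m hm u₀ v u hv hu n t ht
    obtain ⟨K', hA'⟩ := hAM.isCoerciveFamily_shift S (lam := C₁) hδ fun t ht v => by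
      have h1 := hco t ht v
      linarith
    refine WienerChaos.summable_and_tsum_le_of_sum_le (P := fun α => WienerChaos.order α = n)
      (f := fun α => ‖u α t‖ ^ 2) (fun _ => sq_nonneg _) fun F hF => ?_
    rcases lt_or_ge C₃ 0 with hneg | hpos
    · -- A negative constant forces the space `H` to be trivial.
      have h1 : ∀ φ, S.emb φ = 0 := by
        intro φ
        have h2 := hC₃ t ht φ
        have h3 : 0 ≤ ∑' k, ‖M k t φ‖ ^ 2 := tsum_nonneg fun _ => sq_nonneg _
        have h4 : ‖S.emb φ‖ ^ 2 ≤ 0 := by nlinarith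
        simpa using le_antisymm h4 (sq_nonneg _)
      have h2 : ∀ x : H, x = 0 := fun x =>
        S.denseRange.induction_on x isClosed_singleton h1
      simp [h2]
    · have hC₃' : ∀ L, ∀ᵐ t ∂volume.restrict (Ioo 0 T), ∀ v,
          ∑ k ∈ Finset.range L, ‖M k t v‖ ^ 2 ≤ C₃ * ‖S.emb v‖ ^ 2 := by
        intro L
        filter_upwards [ae_restrict_mem measurableSet_Ioo] with t ht v
        have ht' := Ioo_subset_Icc_self ht
        exact (hAM.sum_le ht' v _).trans (hC₃ t ht' v)
      have h1 := hv.sum_le_of_cellChaos_le hT hu hA hM hm hA'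
        (β := fun t => (C₃ * t) ^ n * ‖u₀‖ ^ 2) (by fun_prop)
        (fun h v₀ hh h0 N L => WienerChaos.sum_cellChaos_le_factorial S hT hA' hM hh h0 N L hpos
          (hC₃' L) n) F hF ht
      refine h1.trans (le_of_eq ?_)
      ring
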